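/- Let $d\ge 1$, $q\ge 0$, $p\ge 2$ be integers. Let $\Theta=\Theta_\lambda\times\Theta_\alpha\subset\mathbb{R}\times\mathbb{R}^q$ with $\Theta_\lambda\subset(0,\infty)$, and consider stationary kernels $K_\theta(x,y)=\lambda\,C_\alpha(x-y)$ on $\mathbb{R}^d$, $\theta=(\lambda,\alpha)$, where $C_\alpha:\mathbb{R}^d\to\mathbb{R}$ and $C_\alpha(0)=1$. Put $\rho_\theta^{(l)}(x_1,\dots,x_l)=\det\big(K_\theta(x_i,x_j)\big)_{i,j\le l}$. Assumption 1. For every $(\lambda,\alpha)\in\Theta$, $C_\alpha\in L^2(\mathbb{R}^d)$ and $C_\alpha(x)=\int\varphi(\xi)e^{2\pi i\langle x,\xi\rangle}d\xi$ for an integrable $\varphi$ with $0\le\varphi\le 1/\lambda$. Assumption 2. (i) There is $r'>0$ such that, for $\theta_1,\theta_2\in\Theta$, if $K_{\theta_1}(x,y)=K_{\theta_2}(x,y)$ whenever $|x-y|\le r'$, then $\theta_1=\theta_2$. (ii) For every $\theta\in\Theta$, every $l$ and all pairwise distinct $x_1,\dots,x_l$ the matrix $(K_\theta(x_i,x_j))_{i,j}$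 is positive definite. (iii) $K_\theta(x,y)$ is four times continuously differentiable in $\theta\in\Theta$, and its derivatives of order at most $4$ are bounded uniformly in $\theta,x,y$. (iv) $\Theta$ is compact and convex. Let $\theta_0=(\lambda_0,\alpha_0)$ be an interior point of $\Theta$ and let $X$ be a determinantal point process with kernel $K_{\theta_0}$, that is, a random locally finite subset of $\mathbb{R}^d$ whose $l$-th order joint intensity is $\rho_{\theta_0}^{(l)}$ for every $l\ge 1$. Let $N$ be its counting measure and $N^{(p)}$ the counting measure of the $p$-tuples of pairwise distinct points of $X$. Let $D_n\subset\mathbb{R}^d$ be bounded Borel sets with $|D_n|\asymp n^d$ and $\mu_{d-1}(\partial D_n)\asymp n^{d-1}$ as $n\to\infty$, where $\mu_{d-1}$ is the $(d-1)$-dimensional Hausdorff measure. Let $r>0$, and let $w:(\mathbb{R}^d)^p\to[0,\infty)$ be a bounded, measurable, translation invariant function (that is, $w(x_1+c,\dots,x_p+c)=w(x_1,\dots,x_p)$ for every $c\in\mathbb{R}^d$) with support $\{(x_1,\dots,x_p):|x_1-x_j|\le r,\ 1\le j\le p\}$. Put $$\mathbb{H}_{n1}(\lambda)=\int_{D_n}\log\lambda\,N(dx)-\int_{D_n}\lambda\,du,\qquad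 K_{w,p}(\theta)=\int_{D_n^p}\rho^{(p)}_\theta(x)\,w(x)\,dx,$$ $$\mathbb{H}^{(p)}_{n2}(\lambda,\alpha)=\int_{D_n^p}\big\{\log\rho_\theta^{(p)}(x)-\log K_{w,p}(\theta)\big\}\,w(x)\,N^{(p)}(dx),$$ and let $U^{(p)}_n(\theta)=(\partial_\lambda\mathbb{H}_{n1},\partial_{\alpha_1}\mathbb{H}^{(p)}_{n2},\dots,\partial_{\alpha_q}\mathbb{H}^{(p)}_{n2})^\top$. Then under Assumptions 1 and 2 the components of $U_n^{(p)}(\theta_0)$ (normalized by $|D_n|^{-1/2}$, read as $0$ if $|D_n|=0$) are square integrable, and the covariance matrices $\mathrm{Var}_{\theta_0}\big[|D_n|^{-1/2}U_n^{(p)}(\theta_0)\big]$ converge as $n\to\infty$ to a $(q+1)\times(q+1)$ matrix $$\Sigma^{(p)}(\theta_0)=\begin{pmatrix}\Sigma_{11}&\Sigma_{12}\\ \Sigma_{12}^\top&\Sigma_{22}\end{pmatrix}.$$ Here $\Sigma_{11}=\frac1{\lambda_0}-\int_{\mathbb{R}^d}C_{\alpha_0}(u)^2\,du$, while $(\Sigma_{12})_i=\Lambda(1/\lambda_0,f_i)$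 and $(\Sigma_{22})_{ij}=\Lambda(f_i,f_j)$, where $1/\lambda_0$ is regarded as a constant function of one point, $$f_i(x)=\Big(\frac{\partial_{\alpha_i}\rho^{(p)}_{\theta_0}(x)}{\rho^{(p)}_{\theta_0}(x)}-\kappa_i\Big)w(x),\qquad \kappa_i=\frac{\int\partial_{\alpha_i}\rho^{(p)}_{\theta_0}(0,u)\,w(0,u)\,du}{\int\rho^{(p)}_{\theta_0}(0,u)\,w(0,u)\,du}$$ (with $\kappa_i=0$ if the denominator vanishes), and, for a function $f$ of $s$ points and a function $g$ of $t$ points, $$\Lambda(f,g)=\sum_{l=\max(s,t)}^{s+t}\frac1{l!}\sum_{(a,b)}\int_{(\mathbb{R}^d)^{l-1}}f(z_{a})\,g(z_{b})\,\Big\{\rho^{(l)}_{\theta_0}(z)-\mathbf{1}_{\{l=s+t\}}\,\rho^{(s)}_{\theta_0}(z_a)\,\rho^{(t)}_{\theta_0}(z_b)\Big\}\,du_2\cdots du_l .$$ In this formula $z=(0,u_2,\dots,u_l)$; the inner sum is over all pairs of injections $a:\{1,\dots,s\}\to\{1,\dots,l\}$ and $b:\{1,\dots,t\}\to\{1,\dots,l\}$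 whose ranges together cover $\{1,\dots,l\}$; $z_a=(z_{a(1)},\dots,z_{a(s)})$ and similarly for $z_b$. All these integrals converge absolutely. In particular $\Sigma_{22}$ is given by integrals of joint intensities of orders $p$ to $2p$. -/

import Mathlib

open MeasureTheory ProbabilityTheory Filter Topology Asymptotics
open scoped FourierTransform ENNReal

noncomputable section

namespace DPPScore

/-- The state space `ℝ^d` with its Euclidean norm. -/
abbrev Sp (d : ℕ) := EuclideanSpace ℝ (Fin d)

/-- Parameters `θ = (lam, α)` in `ℝ × ℝ^q`. -/
abbrev Param (q : ℕ) := ℝ × EuclideanSpace ℝ (Fin q)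

/-! ### Point processes and determinantal point processes -/

/-- `X` is a (simple) point process: its values are locally finite subsets of `ℝ^d`, and the
number of points in every bounded Borel set is a random variable. -/
structure IsPointProcess {Ω : Type*} [MeasurableSpace Ω] {d : ℕ} (X : Ω → Set (Sp d)) : Prop where
  finite_inter : ∀ ω (B : Set (Sp d)), Bornology.IsBounded B → (X ω ∩ B).Finite
  measurable_count : ∀ B : Set (Sp d), MeasurableSet B → Bornology.IsBounded B →
    Measurable fun ω => (X ω ∩ B).ncard

/-- The counting measure `N` of a configuration `S`. -/
def countMeasure {d : ℕ} (S : Set (Sp d)) : Measure (Sp d) :=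
  Measure.sum fun x : S => Measure.dirac (x : Sp d)

/-- The counting measure `N^{(p)}` of the `p`-tuples of pairwise distinct points of `S`. -/
def factorialMeasure {d : ℕ} (p : ℕ) (S : Set (Sp d)) : Measure (Fin p → Sp d) :=
  Measure.sum fun x : {x : Fin p → Sp d // Function.Injective x ∧ ∀ i, x i ∈ S} =>
    Measure.dirac (x : Fin p → Sp d)

/-- The matrix `[K](x_1, …, x_p) = (K(x_i, x_j))_{i,j}`. -/
def kernelMatrix {d p : ℕ} (K : Sp d → Sp d → ℝ) (x : Fin p → Sp d) : Matrix (Fin p) (Fin p) ℝ :=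
  Matrix.of fun i j => K (x i) (x j)

/-- The determinantal joint intensity `ρ^{(p)}(x_1, …, x_p) = det [K](x_1, …, x_p)`. -/
def jointIntensity {d p : ℕ} (K : Sp d → Sp d → ℝ) (x : Fin p → Sp d) : ℝ :=
  (kernelMatrix K x).det

/-- `X ∼ DPP(K)` under `P`: for every `p ≥ 1` the `p`-th factorial moment measure of `X` has the
density `det [K]` with respect to Lebesgue measure. -/
structure IsDPP {Ω : Type*} [MeasurableSpace Ω] {d : ℕ} (P : Measure Ω) (X : Ω → Set (Sp d))
    (K : Sp d → Sp d → ℝ) : Prop where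
  isPointProcess : IsPointProcess X
  intensity_nonneg : ∀ p : ℕ, 1 ≤ p → ∀ᵐ x : Fin p → Sp d, 0 ≤ jointIntensity K x
  factorialMoment : ∀ p : ℕ, 1 ≤ p → ∀ A : Fin p → Set (Sp d),
    (∀ i, MeasurableSet (A i)) → (∀ i, Bornology.IsBounded (A i)) →
    ∫⁻ ω, factorialMeasure p (X ω) (Set.univ.pi A) ∂P =
      ∫⁻ x in Set.univ.pi A, ENNReal.ofReal (jointIntensity K x)

/-! ### The parametric model -/

/-- The stationary kernel `K_θ(x, y) = lam * C_α(x - y)`, where `θ = (lam, α)`. -/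
def stationaryKernel {d q : ℕ} (C : EuclideanSpace ℝ (Fin q) → Sp d → ℝ) (θ : Param q)
    (x y : Sp d) : ℝ :=
  θ.1 * C θ.2 (x - y)

/-- `φ` is a spectral density of `c`: a nonnegative integrable function with
`c(x) = ∫ φ(ξ) exp(2πi⟨x, ξ⟩) dξ`. -/
def IsSpectralDensity {d : ℕ} (c φ : Sp d → ℝ) : Prop :=
  (∀ ξ, 0 ≤ φ ξ) ∧ Integrable φ ∧ ∀ x, (c x : ℂ) = 𝓕⁻ (fun ξ => (φ ξ : ℂ)) x

/-- The conditions under which `DPP(K_θ)` exists for every `θ`. -/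
structure ExistenceAssumption {d q : ℕ} (C : EuclideanSpace ℝ (Fin q) → Sp d → ℝ)
    (Θl : Set ℝ) (Θa : Set (EuclideanSpace ℝ (Fin q))) : Prop where
  lam_pos : ∀ lam ∈ Θl, 0 < lam
  normalized : ∀ α ∈ Θa, C α 0 = 1
  memLp_two : ∀ α ∈ Θa, MemLp (C α) 2 volume
  spectral : ∀ lam ∈ Θl, ∀ α ∈ Θa, ∃ φ, IsSpectralDensity (C α) φ ∧ ∀ ξ, φ ξ ≤ 1 / lam

/-- The regularity conditions on the parametric model. -/
structure RegularityAssumption {d q : ℕ} (C : EuclideanSpace ℝ (Fin q) → Sp d → ℝ)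
    (Θl : Set ℝ) (Θa : Set (EuclideanSpace ℝ (Fin q))) : Prop where
  identifiable : ∃ r > 0, ∀ θ₁ ∈ Θl ×ˢ Θa, ∀ θ₂ ∈ Θl ×ˢ Θa,
    (∀ x y : Sp d, ‖x - y‖ ≤ r → stationaryKernel C θ₁ x y = stationaryKernel C θ₂ x y) →
      θ₁ = θ₂
  posDef : ∀ θ ∈ Θl ×ˢ Θa, ∀ (p : ℕ) (x : Fin p → Sp d), Function.Injective x →
    (kernelMatrix (stationaryKernel C θ) x).PosDef
  contDiffOn : ∀ x y : Sp d, ContDiffOn ℝ 4 (fun θ => stationaryKernel C θ x y) (Θl ×ˢ Θa)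
  bounded_deriv : ∃ M : ℝ, ∀ k ≤ 4, ∀ θ ∈ Θl ×ˢ Θa, ∀ x y : Sp d,
    ‖iteratedFDerivWithin ℝ k (fun θ => stationaryKernel C θ x y) (Θl ×ˢ Θa) θ‖ ≤ M
  compact : IsCompact (Θl ×ˢ Θa)
  convex : Convex ℝ (Θl ×ˢ Θa)

/-! ### Observation windows, weights and scores -/

/-- Observation windows: bounded Borel sets with `|D_n| ≍ n^d` and `μ_{d-1}(∂D_n) ≍ n^{d-1}`.
(The second condition forces the boundary measure to be finite and nonzero for large `n`.) -/
structure IsWindowSequence {d : ℕ} (D : ℕ → Set (Sp d)) : Prop where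
  measurableSet : ∀ n, MeasurableSet (D n)
  isBounded : ∀ n, Bornology.IsBounded (D n)
  volume_isTheta : (fun n => (volume (D n)).toReal) =Θ[atTop] fun n => (n : ℝ) ^ d
  frontier_isTheta :
    (fun n => (Measure.hausdorffMeasure ((d : ℝ) - 1) (frontier (D n))).toReal)
      =Θ[atTop] fun n => (n : ℝ) ^ (d - 1)

/-- `S_r^p = {(x_1, …, x_p) : |x_1 - x_j| ≤ r for 1 ≤ j ≤ p}`. -/
def nearTuples (d p : ℕ) (r : ℝ) : Set (Fin p → Sp d) :=
  {x | ∀ i j : Fin p, (i : ℕ) = 0 → ‖x i - x j‖ ≤ r}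

/-- Weight functions: bounded, nonnegative, Borel, translation invariant, with support `S_r^p`. -/
structure IsWeight {d p : ℕ} (r : ℝ) (w : (Fin p → Sp d) → ℝ) : Prop where
  measurable : Measurable w
  nonneg : ∀ x, 0 ≤ w x
  bounded : ∃ M : ℝ, ∀ x, w x ≤ M
  support : tsupport w = nearTuples d p r
  translation : ∀ (c : Sp d) (x : Fin p → Sp d), w (fun i => x i + c) = w x

/-- The quasi-likelihood `∫_D log lam N(dx) - ∫_D lam du` of the configuration `S` in `D`. -/
def intensityLogLik {d : ℕ} (D S : Set (Sp d)) (lam : ℝ) : ℝ :=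
  (∫ _x in D, Real.log lam ∂(countMeasure S)) - ∫ _u in D, lam

/-- The modified `K`-function `∫_{D^p} ρ_θ^{(p)} w dx`. -/
def modifiedK {d p : ℕ} (K : Sp d → Sp d → ℝ) (w : (Fin p → Sp d) → ℝ) (D : Set (Sp d)) : ℝ :=
  ∫ x in Set.univ.pi (fun _ : Fin p => D), jointIntensity K x * w x

/-- The `p`-th order composite likelihood
`∫_{D^p} (log ρ^{(p)} - log K_{w,p}) w dN^{(p)}` of the configuration `S`. -/
def compositeLogLik {d p : ℕ} (K : Sp d → Sp d → ℝ) (w : (Fin p → Sp d) → ℝ)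
    (D S : Set (Sp d)) : ℝ :=
  ∫ x in Set.univ.pi (fun _ : Fin p => D),
    (Real.log (jointIntensity K x) - Real.log (modifiedK K w D)) * w x ∂(factorialMeasure p S)

/-- The partial derivative `∂_{α_i} F` at `θ = (lam, α)`. -/
def partialAlpha {q : ℕ} (i : Fin q) (F : Param q → ℝ) (θ : Param q) : ℝ :=
  deriv (fun t : ℝ => F (θ.1, θ.2 + t • EuclideanSpace.single i (1 : ℝ))) 0

/-- The score `U^{(p)}(θ) = (∂_lam H_1, ∂_{α_1} H_2^{(p)}, …, ∂_{α_q} H_2^{(p)})` of the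
configuration `S` observed in `D`. -/
def score {d p q : ℕ} (C : EuclideanSpace ℝ (Fin q) → Sp d → ℝ) (w : (Fin p → Sp d) → ℝ)
    (D S : Set (Sp d)) (θ : Param q) : Fin (q + 1) → ℝ :=
  Fin.cons (deriv (fun lam => intensityLogLik D S lam) θ.1)
    (fun i => partialAlpha i (fun η => compositeLogLik (stationaryKernel C η) w D S) θ)

/-- The normalized score `|D|^{-1/2} U^{(p)}(θ)`. -/
def normalizedScore {d p q : ℕ} (C : EuclideanSpace ℝ (Fin q) → Sp d → ℝ)
    (w : (Fin p → Sp d) → ℝ) (D S : Set (Sp d)) (θ : Param q) (i : Fin (q + 1)) : ℝ :=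
  (Real.sqrt (volume D).toReal)⁻¹ * score C w D S θ i

/-! ### The limit covariance -/

/-- The tuple `(0, u_2, …, u_l)`. -/
def anchored {d l : ℕ} (u : Fin (l - 1) → Sp d) (i : Fin l) : Sp d :=
  if h : (i : ℕ) = 0 then 0 else u ⟨(i : ℕ) - 1, by omega⟩

/-- The limiting score density: for `x = (x_1, …, x_p)`,
`(∂_{α_i} ρ_θ^{(p)}(x) / ρ_θ^{(p)}(x) - κ_i) w(x)`, where
`κ_i = ∫ ∂_{α_i} ρ_θ^{(p)}(0, u) w(0, u) du / ∫ ρ_θ^{(p)}(0, u) w(0, u) du`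
is the limit of `∂_{α_i} K_{w,p} / K_{w,p}` for growing windows. -/
def limitScoreDensity {d p q : ℕ} (C : EuclideanSpace ℝ (Fin q) → Sp d → ℝ)
    (w : (Fin p → Sp d) → ℝ) (θ : Param q) (i : Fin q) (x : Fin p → Sp d) : ℝ :=
  (partialAlpha i (fun η => jointIntensity (stationaryKernel C η) x) θ
        / jointIntensity (stationaryKernel C θ) x
      - (∫ u : Fin (p - 1) → Sp d,
            partialAlpha i (fun η => jointIntensity (stationaryKernel C η) (anchored u)) θ
              * w (anchored u))
          / ∫ u : Fin (p - 1) → Sp d,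
              jointIntensity (stationaryKernel C θ) (anchored u) * w (anchored u))
    * w x

/-- The ways `(a, b)` of choosing a `p`-tuple and an `s`-tuple of pairwise distinct members among
`l` points that together use all the `l` points. -/
def overlaps (p s l : ℕ) : Set ((Fin p ↪ Fin l) × (Fin s ↪ Fin l)) :=
  {ab | ∀ k, k ∈ Set.range ab.1 ∨ k ∈ Set.range ab.2}

/-- The integrand for the overlap `(a, b)` of a `p`-tuple and an `s`-tuple: with
`z = (0, u_2, …, u_l)`, it is `f(z_a) g(z_b) ρ^{(l)}(z)`, where `ρ^{(l)}(z)` is replaced by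
`ρ^{(l)}(z) - ρ^{(p)}(z_a) ρ^{(s)}(z_b)` when the two tuples are disjoint (`l = p + s`). -/
def overlapIntegrand {d p s l : ℕ} (K : Sp d → Sp d → ℝ) (f : (Fin p → Sp d) → ℝ)
    (g : (Fin s → Sp d) → ℝ) (ab : (Fin p ↪ Fin l) × (Fin s ↪ Fin l))
    (u : Fin (l - 1) → Sp d) : ℝ :=
  f (anchored u ∘ ab.1) * g (anchored u ∘ ab.2) *
    (jointIntensity K (anchored u) -
      if l = p + s then
        jointIntensity K (anchored u ∘ ab.1) * jointIntensity K (anchored u ∘ ab.2)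
      else 0)

open Classical in
/-- `σ` is the sum over `l = max p s, …, p + s` of
`(1 / l!) ∑_{(a, b)} ∫ f(z_a) g(z_b) ρ^{(l)}(z) du_2 ⋯ du_l` (with `ρ^{(l)}` truncated for
`l = p + s`), all the integrals being absolutely convergent. -/
def HasLimitCov {d p s : ℕ} (K : Sp d → Sp d → ℝ) (f : (Fin p → Sp d) → ℝ)
    (g : (Fin s → Sp d) → ℝ) (σ : ℝ) : Prop :=
  (∀ l ∈ Finset.Icc (max p s) (p + s), ∀ ab ∈ overlaps p s l,
      Integrable (overlapIntegrand K f g ab) volume) ∧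
    σ = ∑ l ∈ Finset.Icc (max p s) (p + s), ((l.factorial : ℝ))⁻¹ *
      ∑ ab ∈ Finset.univ.filter (fun ab => ab ∈ overlaps p s l),
        ∫ u : Fin (l - 1) → Sp d, overlapIntegrand K f g ab u

end DPPScore

end

/-!
Each component of the score is, after differentiating under the integral sign, a sum of a
translation invariant finite-range function over the tuples of distinct points of `X` in `D_n`, up
to a deterministic shift; the only dependence of the summand on `n` is the ratio
`∂_{α_i} K_{w,p} / K_{w,p}`, which converges to `κ_i`. The covariance of two such sums splits
according to how the two tuples overlap, and each overlap type contributes the integral over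
`D_n^l` of a translation invariant function `H`. Anchoring the first point at the origin turns this
integral into `∫ |{x : x, x + u_2, …, x + u_l ∈ D_n}| H(0, u) du`. The hypotheses on the windows
make them a Følner sequence, so that the volume in the integrand is asymptotically `|D_n|` for
every `u`, and dominated convergence applies once `H(0, ·)` is integrable.

Integrability is clear by finite range when the two tuples share a point. For disjoint tuples `x`,
`y` it is the integrability over `y` of `det [K](x, y) - det [K](x) det [K](y)`, which relies on
the spectral bound `φ ≤ 1 / λ`: it makes `K` a contraction of `L²`, and expanding the defect in the
Schur complement of `[K](x)` bounds it by `det [K](x)` times an integrable function of `y`. The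
factors `∂ρ / ρ`, singular where points collide, are absorbed since a nonnegative function of `t`
with bounded second derivative satisfies `|∂ρ| ≤ c √ρ`.
-/

noncomputable section

namespace DPPScore

/-! ### Translates of a window -/

section ShiftLoss
open scoped Pointwise symmDiff
variable {G : Type*} [AddCommGroup G]

lemma neg_vadd_set_eq_preimage (D : Set G) (u : G) : -u +ᵥ D = (· + u) ⁻¹' D := by
  simp only [← Set.preimage_vadd, vadd_eq_add, add_comm]

variable [MeasurableSpace G] (μ : Measure G)

/-- The measure of the part of `D` which the translation by `u` moves out of `D`. It measures the
boundary effects of replacing a window by a translate. -/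
def shiftLoss (D : Set G) (u : G) : ℝ≥0∞ :=
  μ (D \ (· + u) ⁻¹' D)

lemma shiftLoss_zero (D : Set G) : shiftLoss μ D 0 = 0 := by
  simp [shiftLoss]

lemma shiftLoss_div_ne_top (D : Set G) (u : G) : shiftLoss μ D u / μ D ≠ ∞ :=
  ne_top_of_le_ne_top ENNReal.one_ne_top
    (ENNReal.div_le_of_le_mul ((measure_mono Set.sdiff_subset).trans_eq (one_mul _).symm))

lemma shiftLoss_le_measure_vadd_symmDiff (D : Set G) (u : G) :
    shiftLoss μ D u ≤ μ ((-u +ᵥ D) ∆ D) := by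
  rw [neg_vadd_set_eq_preimage]
  exact measure_mono Set.subset_union_right

lemma tendsto_shiftLoss_div_of_isAddFoelner {ι : Type*} {F : Filter ι} {D : ι → Set G}
    (hD : IsAddFoelner G μ F D) (u : G) :
    Tendsto (fun i => shiftLoss μ (D i) u / μ (D i)) F (𝓝 0) :=
  tendsto_of_tendsto_of_tendsto_of_le_of_le tendsto_const_nhds
    (hD.tendsto_meas_vadd_symmDiff (-u)) (fun _ => zero_le)
    fun _ => ENNReal.div_le_div_right (shiftLoss_le_measure_vadd_symmDiff μ _ _) _

variable [MeasurableAdd G] [μ.IsAddRightInvariant]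

lemma measure_vadd_symmDiff_le (D : Set G) (u : G) :
    μ ((u +ᵥ D) ∆ D) ≤ shiftLoss μ D (-u) + shiftLoss μ D u := by
  have hgain : μ ((u +ᵥ D) \ D) = shiftLoss μ D u := by
    rw [shiftLoss, ← measure_preimage_add_right μ (-u) (D \ _), Set.preimage_sdiff,
      ← neg_vadd_set_eq_preimage D (-u), neg_neg]
    simp only [Set.preimage_preimage, neg_add_cancel_right, Set.preimage_id']
  calc μ ((u +ᵥ D) ∆ D) ≤ μ ((u +ᵥ D) \ D) + μ (D \ (u +ᵥ D)) := measure_union_le _ _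
    _ = shiftLoss μ D (-u) + shiftLoss μ D u := by
        rw [hgain, shiftLoss.eq_def μ D (-u), ← neg_vadd_set_eq_preimage, neg_neg, add_comm]

lemma shiftLoss_add_le (D : Set G) (u v : G) :
    shiftLoss μ D (u + v) ≤ shiftLoss μ D u + shiftLoss μ D v := by
  have hsub : D \ (· + (u + v)) ⁻¹' D ⊆
      (D \ (· + u) ⁻¹' D) ∪ (· + u) ⁻¹' (D \ (· + v) ⁻¹' D) := by
    rintro x ⟨hx, hx'⟩
    by_cases h : x + u ∈ D
    · exact Or.inr ⟨h, by simpa only [Set.mem_preimage, add_assoc] using hx'⟩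
    · exact Or.inl ⟨hx, h⟩
  calc shiftLoss μ D (u + v)
      ≤ μ (D \ (· + u) ⁻¹' D) + μ ((· + u) ⁻¹' (D \ (· + v) ⁻¹' D)) :=
        (measure_mono hsub).trans (measure_union_le _ _)
    _ = shiftLoss μ D u + shiftLoss μ D v := by rw [measure_preimage_add_right]; rfl

lemma shiftLoss_sum_le (D : Set G) {ι : Type*} (s : Finset ι) (u : ι → G) :
    shiftLoss μ D (∑ k ∈ s, u k) ≤ ∑ k ∈ s, shiftLoss μ D (u k) :=
  Finset.le_sum_of_subadditive _ (shiftLoss_zero μ D).le (shiftLoss_add_le μ D) _ _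

end ShiftLoss

lemma exists_mem_frontier_of_mem_of_add_notMem {E : Type*} [AddCommGroup E] [Module ℝ E]
    [TopologicalSpace E] [ContinuousAdd E] [ContinuousSMul ℝ E] {D : Set E} {x v : E}
    (hx : x ∈ D) (hxv : x + v ∉ D) :
    ∃ τ ∈ Set.Icc (0 : ℝ) 1, x + τ • v ∈ frontier D := by
  by_contra! h
  have hsegment : IsPreconnected ((fun τ : ℝ => x + τ • v) '' Set.Icc 0 1) :=
    isPreconnected_Icc.image _ (by fun_prop)
  have hcover : (fun τ : ℝ => x + τ • v) '' Set.Icc 0 1 ⊆ interior D ∪ interior Dᶜ := by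
    rw [← compl_frontier_eq_union_interior]
    rintro _ ⟨τ, hτ, rfl⟩
    exact h τ hτ
  rcases hsegment.subset_or_subset isOpen_interior isOpen_interior
    (disjoint_compl_right.mono interior_subset interior_subset) hcover with h' | h'
  · exact hxv (interior_subset (h' ⟨1, by simp, by simp⟩))
  · exact interior_subset (h' ⟨0, by simp, by simp⟩) hx

section Sweep
variable {d : ℕ}

lemma volume_setOf_abs_sub_le (y : Sp d) (b : Fin d → ℝ) :
    volume {x : Sp d | ∀ j, |x j - y j| ≤ b j} = ∏ j, ENNReal.ofReal (2 * b j) := by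
  have hbox : {x : Sp d | ∀ j, |x j - y j| ≤ b j} =
      WithLp.ofLp ⁻¹' Set.Icc (fun j => y j - b j) (fun j => y j + b j) := by
    ext x
    simp only [Set.mem_ofPred_eq, Set.mem_preimage, Set.mem_Icc, Pi.le_def, ← forall_and]
    exact forall_congr' fun j => by rw [abs_sub_le_iff]; constructor <;> rintro ⟨h, h'⟩ <;>
      constructor <;> linarith
  rw [hbox, (PiLp.volume_preserving_ofLp (Fin d)).measure_preimage
    measurableSet_Icc.nullMeasurableSet, Real.volume_Icc_pi]
  exact Finset.prod_congr rfl fun j _ => by ring_nf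

lemma abs_apply_sub_le_diam_add {t : Set (Sp d)} (ht : Bornology.IsBounded t) {x y v : Sp d} {τ : ℝ}
    (hτ : τ ∈ Set.Icc (0 : ℝ) 1) (hx : x + τ • v ∈ t) (hy : y ∈ t) (j : Fin d) :
    |x j - y j| ≤ Metric.diam t + |v j| := by
  have hdist : |x j + τ * v j - y j| ≤ Metric.diam t := by
    have hcoord := PiLp.norm_apply_le (x + τ • v - y) j
    rw [← dist_eq_norm] at hcoord
    simpa using hcoord.trans (Metric.dist_le_diam_of_mem ht hx hy)
  have hstep : |τ * v j| ≤ |v j| := by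
    rw [abs_mul, abs_of_nonneg hτ.1]
    exact mul_le_of_le_one_left (abs_nonneg _) hτ.2
  rw [abs_le] at *
  constructor <;> linarith [hdist.1, hdist.2, hstep.1, hstep.2]

lemma prod_diam_add_abs_single_le (k : Fin d) (s : ℝ) {δ : ℝ} (hδ0 : 0 ≤ δ) (hδ1 : δ ≤ 1) :
    ∏ j, 2 * (δ + |(EuclideanSpace.single k s : Sp d) j|) ≤
      2 ^ d * (1 + |s|) * δ ^ (d - 1) := by
  have hrest : ∀ j ∈ Finset.univ.erase k, δ + |(EuclideanSpace.single k s : Sp d) j| = δ :=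
    fun j hj => by simp [Finset.ne_of_mem_erase hj]
  rw [Finset.prod_mul_distrib,
    ← Finset.mul_prod_erase _ (fun j => δ + |(EuclideanSpace.single k s : Sp d) j|)
      (Finset.mem_univ k), Finset.prod_congr rfl hrest]
  simp only [Finset.prod_const, Finset.card_univ, Fintype.card_fin, PiLp.single_apply, if_true,
    Finset.card_erase_of_mem (Finset.mem_univ k), ← mul_assoc]
  gcongr

/-- A set of diameter `δ ≤ 1` moved a distance `|s|` along an axis stays in a box with one side of
length at most `2(1 + |s|)` and the others of length `2δ`. -/
lemma volume_sweep_le (k : Fin d) (s : ℝ) {t : Set (Sp d)} (ht : Metric.ediam t ≤ 1) :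
    volume {x : Sp d | ∃ τ ∈ Set.Icc (0 : ℝ) 1, x + τ • EuclideanSpace.single k s ∈ t} ≤
      ENNReal.ofReal (2 ^ d * (1 + |s|)) * ⨆ _ : t.Nonempty, Metric.ediam t ^ ((d : ℝ) - 1) := by
  rcases t.eq_empty_or_nonempty with rfl | ⟨y, hy⟩
  · simp
  rw [ciSup_pos ⟨y, hy⟩]
  have hfin : Metric.ediam t ≠ ⊤ := ne_top_of_le_ne_top ENNReal.one_ne_top ht
  have hδ0 : 0 ≤ Metric.diam t := Metric.diam_nonneg
  have hδ1 : Metric.diam t ≤ 1 := ENNReal.toReal_le_of_le_ofReal zero_le_one (by simpa using ht)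
  have hδ : Metric.ediam t = ENNReal.ofReal (Metric.diam t) := (ENNReal.ofReal_toReal hfin).symm
  have hd : (d : ℝ) - 1 = (d - 1 : ℕ) := by rw [Nat.cast_pred k.pos]
  calc volume {x : Sp d | ∃ τ ∈ Set.Icc (0 : ℝ) 1, x + τ • EuclideanSpace.single k s ∈ t}
      ≤ volume {x : Sp d | ∀ j, |x j - y j| ≤
          Metric.diam t + |(EuclideanSpace.single k s : Sp d) j|} :=
        measure_mono fun x ⟨_, hτ, hx⟩ => abs_apply_sub_le_diam_add
          (Metric.isBounded_iff_ediam_ne_top.2 hfin) hτ hx hy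
    _ = ENNReal.ofReal (∏ j, 2 * (Metric.diam t + |(EuclideanSpace.single k s : Sp d) j|)) := by
        rw [volume_setOf_abs_sub_le, ENNReal.ofReal_prod_of_nonneg fun j _ => by positivity]
    _ ≤ ENNReal.ofReal (2 ^ d * (1 + |s|) * Metric.diam t ^ (d - 1)) :=
        ENNReal.ofReal_le_ofReal (prod_diam_add_abs_single_le k s hδ0 hδ1)
    _ = ENNReal.ofReal (2 ^ d * (1 + |s|)) * Metric.ediam t ^ ((d : ℝ) - 1) := by
        rw [ENNReal.ofReal_mul (by positivity), ENNReal.ofReal_pow hδ0, hd, ENNReal.rpow_natCast,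
          hδ]

lemma shiftLoss_single_le (D : Set (Sp d)) (k : Fin d) (s : ℝ) :
    shiftLoss volume D (EuclideanSpace.single k s) ≤
      ENNReal.ofReal (2 ^ d * (1 + |s|)) *
        Measure.hausdorffMeasure ((d : ℝ) - 1) (frontier D) := by
  have hc0 : ENNReal.ofReal (2 ^ d * (1 + |s|)) ≠ 0 := by
    rw [ne_eq, ENNReal.ofReal_eq_zero, not_le]
    positivity
  rw [mul_comm, ← ENNReal.div_le_iff hc0 ENNReal.ofReal_ne_top, Measure.hausdorffMeasure_apply]
  refine le_trans ?_ (le_iSup₂_of_le (1 : ℝ≥0∞) one_pos le_rfl)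
  refine le_iInf fun t => le_iInf fun ht => le_iInf fun hdiam => ?_
  rw [ENNReal.div_le_iff hc0 ENNReal.ofReal_ne_top, mul_comm, ← ENNReal.tsum_mul_left]
  calc shiftLoss volume D (EuclideanSpace.single k s)
      ≤ volume (⋃ n, {x : Sp d | ∃ τ ∈ Set.Icc (0 : ℝ) 1,
          x + τ • EuclideanSpace.single k s ∈ t n}) := by
        refine measure_mono fun x hx => ?_
        obtain ⟨τ, hτ, h⟩ := exists_mem_frontier_of_mem_of_add_notMem hx.1 hx.2
        obtain ⟨n, hn⟩ := Set.mem_iUnion.1 (ht h)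
        exact Set.mem_iUnion.2 ⟨n, τ, hτ, hn⟩
    _ ≤ ∑' n, volume {x : Sp d | ∃ τ ∈ Set.Icc (0 : ℝ) 1,
          x + τ • EuclideanSpace.single k s ∈ t n} := measure_iUnion_le _
    _ ≤ _ := ENNReal.tsum_le_tsum fun n => volume_sweep_le k s (hdiam n)

lemma shiftLoss_le_hausdorffMeasure_frontier (D : Set (Sp d)) (u : Sp d) :
    shiftLoss volume D u ≤ ENNReal.ofReal (∑ k, 2 ^ d * (1 + |u k|)) *
        Measure.hausdorffMeasure ((d : ℝ) - 1) (frontier D) := by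
  have hu : u = ∑ k, EuclideanSpace.single k (u k) := by
    ext j
    simp [Finset.sum_apply, Pi.single_apply]
  calc shiftLoss volume D u
      = shiftLoss volume D (∑ k, EuclideanSpace.single k (u k)) := by rw [← hu]
    _ ≤ ∑ k, shiftLoss volume D (EuclideanSpace.single k (u k)) := shiftLoss_sum_le _ _ _ _
    _ ≤ ∑ k, ENNReal.ofReal (2 ^ d * (1 + |u k|)) *
        Measure.hausdorffMeasure ((d : ℝ) - 1) (frontier D) :=
      Finset.sum_le_sum fun k _ => shiftLoss_single_le D k (u k)
    _ = _ := by
      rw [← Finset.sum_mul, ENNReal.ofReal_sum_of_nonneg fun k _ => by positivity]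

end Sweep

namespace IsWindowSequence
open scoped Pointwise symmDiff
variable {d : ℕ} {D : ℕ → Set (Sp d)}

lemma eventually_volume_ne_zero (hD : IsWindowSequence D) :
    ∀ᶠ n in atTop, volume (D n) ≠ 0 := by
  filter_upwards [hD.volume_isTheta.2.eq_zero_imp, eventually_gt_atTop 0] with n h0 hn hvol
  have hpos : (0 : ℝ) < (n : ℝ) ^ d := by positivity
  exact hpos.ne' (h0 (by rw [hvol, ENNReal.toReal_zero]))

lemma eventually_hausdorffMeasure_frontier_ne_top (hD : IsWindowSequence D) :
    ∀ᶠ n in atTop, Measure.hausdorffMeasure ((d : ℝ) - 1) (frontier (D n)) ≠ ⊤ := by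
  filter_upwards [hD.frontier_isTheta.2.eq_zero_imp, eventually_gt_atTop 0] with n h0 hn htop
  have hpos : (0 : ℝ) < (n : ℝ) ^ (d - 1) := by positivity
  exact hpos.ne' (h0 (by rw [htop, ENNReal.toReal_top]))

lemma shiftLoss_isBigO (hD : IsWindowSequence D) (u : Sp d) :
    (fun n => (shiftLoss volume (D n) u).toReal) =O[atTop] fun n => (n : ℝ) ^ (d - 1) := by
  refine IsBigO.trans (IsBigO.of_bound (∑ k, 2 ^ d * (1 + |u k|)) ?_) hD.frontier_isTheta.1
  filter_upwards [hD.eventually_hausdorffMeasure_frontier_ne_top] with n hn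
  rw [Real.norm_of_nonneg ENNReal.toReal_nonneg, Real.norm_of_nonneg ENNReal.toReal_nonneg]
  refine (ENNReal.toReal_mono (ENNReal.mul_ne_top ENNReal.ofReal_ne_top hn)
    (shiftLoss_le_hausdorffMeasure_frontier (D n) u)).trans_eq ?_
  rw [ENNReal.toReal_mul, ENNReal.toReal_ofReal (by positivity)]

lemma tendsto_shiftLoss_div (hd : 1 ≤ d) (hD : IsWindowSequence D) (u : Sp d) :
    Tendsto (fun n => shiftLoss volume (D n) u / volume (D n)) atTop (𝓝 0) := by
  refine (ENNReal.tendsto_toReal_iff (fun n => shiftLoss_div_ne_top _ _ _) ENNReal.zero_ne_top).1 ?_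
  have hbound : (fun n => (shiftLoss volume (D n) u / volume (D n)).toReal) =O[atTop]
      fun n : ℕ => ((n : ℝ))⁻¹ := by
    refine ((hD.shiftLoss_isBigO u).mul hD.volume_isTheta.inv.1).congr'
      (.of_forall fun n => (ENNReal.toReal_div _ _).symm) ?_
    filter_upwards [eventually_gt_atTop 0] with n hn
    obtain ⟨m, rfl⟩ := Nat.exists_eq_add_of_le' hd
    rw [Nat.add_sub_cancel, pow_succ]
    field_simp
  exact hbound.trans_tendsto tendsto_inv_atTop_nhds_zero_nat

lemma isAddFoelner (hd : 1 ≤ d) (hD : IsWindowSequence D) :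
    IsAddFoelner (Sp d) volume atTop D where
  eventually_measurableSet := .of_forall hD.measurableSet
  eventually_meas_ne_zero := hD.eventually_volume_ne_zero
  eventually_meas_ne_top := .of_forall fun n => (hD.isBounded n).measure_lt_top.ne
  tendsto_meas_vadd_symmDiff u := by
    refine tendsto_of_tendsto_of_tendsto_of_le_of_le tendsto_const_nhds
      (by simpa only [add_zero] using
        (hD.tendsto_shiftLoss_div hd (-u)).add (hD.tendsto_shiftLoss_div hd u))
      (fun n => zero_le) fun n => ?_
    simp only [← ENNReal.add_div]
    exact ENNReal.div_le_div_right (measure_vadd_symmDiff_le _ _ _) _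

end IsWindowSequence

/-! ### Translation invariant functions of several points -/

/-- `H` is invariant under simultaneous translations of its arguments. -/
def TranslationInvariant {ι G β : Type*} [Add G] (H : (ι → G) → β) : Prop :=
  ∀ (c : G) (z : ι → G), H (fun i => z i + c) = H z

section Anchored
variable {d l : ℕ}

lemma anchored_zero (hl : 1 ≤ l) (u : Fin (l - 1) → Sp d) : anchored u (⟨0, hl⟩ : Fin l) = 0 :=
  dif_pos rfl

lemma measurable_anchored :
    Measurable fun u : Fin (l - 1) → Sp d => (anchored u : Fin l → Sp d) := by
  refine measurable_pi_lambda _ fun i => ?_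
  unfold anchored
  split_ifs
  · exact measurable_const
  · exact measurable_pi_apply _

lemma measurePreserving_anchored_add (hl : 1 ≤ l) :
    MeasurePreserving fun q : Sp d × (Fin (l - 1) → Sp d) =>
      (fun i => anchored q.2 i + q.1 : Fin l → Sp d) := by
  obtain ⟨m, rfl⟩ := Nat.exists_eq_add_of_le' hl
  have hshear : MeasurePreserving fun q : Sp d × (Fin m → Sp d) => (q.1, q.2 + fun _ => q.1) :=
    (MeasurePreserving.id volume).skew_product (g := fun R u => u + fun _ => R)
      (by fun_prop) (.of_forall fun R => map_add_right_eq_self _ _)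
  have hcomp : (fun q : Sp d × (Fin (m + 1 - 1) → Sp d) =>
      (fun i => anchored q.2 i + q.1 : Fin (m + 1) → Sp d)) =
      (MeasurableEquiv.piFinSuccAbove (fun _ => Sp d) 0).symm ∘
        fun q : Sp d × (Fin m → Sp d) => (q.1, q.2 + fun _ => q.1) := by
    funext q i
    refine Fin.cases ?_ (fun j => ?_) i <;>
      simp [anchored, MeasurableEquiv.piFinSuccAbove, Fin.insertNthEquiv]
  rw [hcomp]
  exact (volume_preserving_piFinSuccAbove (fun _ : Fin (m + 1) => Sp d) 0).symm.comp hshear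

lemma lintegral_eq_lintegral_anchored_add (hl : 1 ≤ l) {F : (Fin l → Sp d) → ℝ≥0∞}
    (hF : Measurable F) :
    ∫⁻ z, F z = ∫⁻ R, ∫⁻ u : Fin (l - 1) → Sp d, F (fun i => anchored u i + R) := by
  have hmp := measurePreserving_anchored_add (d := d) hl
  rw [← hmp.lintegral_comp hF, Measure.volume_eq_prod, lintegral_prod]
  exact (hF.comp hmp.measurable).aemeasurable

lemma lintegral_indicator_mul_of_translationInvariant (k : Fin l) {H : (Fin l → Sp d) → ℝ≥0∞}
    (hH : Measurable H) (hinv : TranslationInvariant H) {B : Set (Sp d)} (hB : MeasurableSet B) :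
    ∫⁻ z, B.indicator 1 (z k) * H z =
      volume B * ∫⁻ u : Fin (l - 1) → Sp d, H (anchored u) := by
  have hmeas : Measurable fun z : Fin l → Sp d => B.indicator (1 : Sp d → ℝ≥0∞) (z k) * H z :=
    ((measurable_one.indicator hB).comp (measurable_pi_apply k)).mul hH
  rw [lintegral_eq_lintegral_anchored_add k.pos hmeas, lintegral_lintegral_swap,
    ← lintegral_const_mul (volume B) (f := fun u : Fin (l - 1) → Sp d => H (anchored u))
      (hH.comp measurable_anchored)]
  case hf => exact (hmeas.comp (measurePreserving_anchored_add k.pos).measurable).aemeasurable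
  refine lintegral_congr fun u => ?_
  calc ∫⁻ R, B.indicator 1 (anchored u k + R) * H (fun i => anchored u i + R)
      = ∫⁻ R, B.indicator 1 (anchored u k + R) * H (anchored u) :=
        lintegral_congr fun R => by rw [hinv R]
    _ = (∫⁻ R, B.indicator 1 (anchored u k + R)) * H (anchored u) :=
        lintegral_mul_const _ ((measurable_one.indicator hB).comp (measurable_const_add _))
    _ = volume B * H (anchored u) := by
        rw [lintegral_add_left_eq_self fun R => B.indicator (1 : Sp d → ℝ≥0∞) R,
          lintegral_indicator_one hB]

lemma integrable_comp_anchored (k : Fin l) {H : (Fin l → Sp d) → ℝ}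
    (hH : Measurable H) (hinv : TranslationInvariant H)
    (hfin : ∫⁻ z, (Metric.ball (0 : Sp d) 1).indicator 1 (z k) * ‖H z‖ₑ ≠ ∞) :
    Integrable fun u : Fin (l - 1) → Sp d => H (anchored u) := by
  refine ⟨(hH.comp measurable_anchored).aestronglyMeasurable, ?_⟩
  rw [lintegral_indicator_mul_of_translationInvariant k hH.enorm
    (fun c z => by rw [hinv c z]) Metric.isOpen_ball.measurableSet] at hfin
  exact (ENNReal.lt_top_of_mul_ne_top_right hfin (Metric.measure_ball_pos _ _ one_pos).ne')

variable (l)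

/-- The base points `R` for which the tuple `(R, R + u_2, …, R + u_l)` lies in `D`. -/
def baseSet (D : Set (Sp d)) (u : Fin (l - 1) → Sp d) : Set (Sp d) :=
  {R | ∀ i : Fin l, anchored u i + R ∈ D}

variable {l}

lemma baseSet_subset (hl : 1 ≤ l) (D : Set (Sp d)) (u : Fin (l - 1) → Sp d) :
    baseSet l D u ⊆ D := fun R hR => by
  simpa only [anchored_zero hl u, zero_add] using hR ⟨0, hl⟩

lemma volume_le_volume_baseSet_add (D : Set (Sp d)) (u : Fin (l - 1) → Sp d) :
    volume D ≤ volume (baseSet l D u) + ∑ i : Fin l, shiftLoss volume D (anchored u i) := by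
  have hsub : D ⊆ baseSet l D u ∪ ⋃ i : Fin l, D \ (· + anchored u i) ⁻¹' D := by
    intro x hx
    by_cases h : x ∈ baseSet l D u
    · exact Or.inl h
    · obtain ⟨i, hi⟩ := not_forall.1 h
      exact Or.inr (Set.mem_iUnion.2 ⟨i, hx, by rwa [Set.mem_preimage, add_comm]⟩)
  refine (measure_mono hsub).trans ((measure_union_le _ _).trans ?_)
  gcongr
  exact measure_iUnion_fintype_le _ _

lemma measurableSet_setOf_mem_baseSet (hl : 1 ≤ l) {D : Set (Sp d)} (hD : MeasurableSet D) :
    MeasurableSet {q : Sp d × (Fin (l - 1) → Sp d) | q.1 ∈ baseSet l D q.2} := by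
  have hpre : {q : Sp d × (Fin (l - 1) → Sp d) | q.1 ∈ baseSet l D q.2} =
      (fun q i => anchored q.2 i + q.1) ⁻¹' Set.univ.pi fun _ : Fin l => D := by
    ext q
    simp [baseSet]
  rw [hpre]
  exact (measurePreserving_anchored_add hl).measurable (MeasurableSet.univ_pi fun _ => hD)

lemma measurableSet_baseSet (hl : 1 ≤ l) {D : Set (Sp d)} (hD : MeasurableSet D)
    (u : Fin (l - 1) → Sp d) : MeasurableSet (baseSet l D u) :=
  measurable_prodMk_right (measurableSet_setOf_mem_baseSet hl hD)

lemma indicator_pi_anchored_add {H : (Fin l → Sp d) → ℝ} (hinv : TranslationInvariant H)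
    (D : Set (Sp d)) (q : Sp d × (Fin (l - 1) → Sp d)) :
    (Set.univ.pi fun _ => D).indicator H (fun i => anchored q.2 i + q.1) =
      (baseSet l D q.2).indicator (fun _ => H (anchored q.2)) q.1 := by
  have hmem : (fun i => anchored q.2 i + q.1) ∈ (Set.univ.pi fun _ : Fin l => D) ↔
      q.1 ∈ baseSet l D q.2 := by simp [baseSet]
  by_cases h : q.1 ∈ baseSet l D q.2
  · rw [Set.indicator_of_mem h, Set.indicator_of_mem (hmem.2 h), hinv]
  · rw [Set.indicator_of_notMem h, Set.indicator_of_notMem (mt hmem.1 h)]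

lemma integrable_indicator_pi_anchored_add (hl : 1 ≤ l) {D : Set (Sp d)} (hD : MeasurableSet D)
    (hDfin : volume D ≠ ∞) {H : (Fin l → Sp d) → ℝ} (hinv : TranslationInvariant H)
    (hint : Integrable fun u : Fin (l - 1) → Sp d => H (anchored u)) :
    Integrable fun q : Sp d × (Fin (l - 1) → Sp d) =>
      (Set.univ.pi fun _ => D).indicator H (fun i => anchored q.2 i + q.1) := by
  have hone : Integrable (D.indicator fun _ => (1 : ℝ)) :=
    (integrable_indicator_iff hD).2 (integrableOn_const hDfin)
  have hprod : (fun q : Sp d × (Fin (l - 1) → Sp d) =>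
      (Set.univ.pi fun _ => D).indicator H (fun i => anchored q.2 i + q.1)) =
      {q | q.1 ∈ baseSet l D q.2}.indicator
        fun q => D.indicator (fun _ => (1 : ℝ)) q.1 * H (anchored q.2) := by
    funext q
    rw [indicator_pi_anchored_add hinv]
    by_cases h : q.1 ∈ baseSet l D q.2
    · rw [Set.indicator_of_mem h, Set.indicator_of_mem (by exact h),
        Set.indicator_of_mem (baseSet_subset hl D q.2 h), one_mul]
    · rw [Set.indicator_of_notMem h, Set.indicator_of_notMem (by exact h)]
  rw [hprod]
  exact (hone.mul_prod hint).indicator (measurableSet_setOf_mem_baseSet hl hD)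

lemma setIntegral_pi_eq_integral_volume_baseSet_mul (hl : 1 ≤ l) {D : Set (Sp d)}
    (hD : MeasurableSet D) (hDfin : volume D ≠ ∞) {H : (Fin l → Sp d) → ℝ} (hH : Measurable H)
    (hinv : TranslationInvariant H)
    (hint : Integrable fun u : Fin (l - 1) → Sp d => H (anchored u)) :
    ∫ z in Set.univ.pi (fun _ => D), H z =
      ∫ u : Fin (l - 1) → Sp d, (volume (baseSet l D u)).toReal * H (anchored u) := by
  have hmp := measurePreserving_anchored_add (d := d) hl
  have hbox : MeasurableSet (Set.univ.pi fun _ : Fin l => D) := .univ_pi fun _ => hD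
  rw [← integral_indicator hbox, ← hmp.map_eq,
    integral_map hmp.aemeasurable (hH.indicator hbox).aestronglyMeasurable,
    Measure.volume_eq_prod,
    integral_prod_symm _ (integrable_indicator_pi_anchored_add hl hD hDfin hinv hint)]
  refine integral_congr_ae (.of_forall fun u => ?_)
  simp only [fun R => indicator_pi_anchored_add hinv D (R, u)]
  rw [integral_indicator (measurableSet_baseSet hl hD u), setIntegral_const, smul_eq_mul,
    Measure.real]

lemma volume_baseSet_div_le_one (hl : 1 ≤ l) (D : Set (Sp d)) (u : Fin (l - 1) → Sp d) :
    volume (baseSet l D u) / volume D ≤ 1 :=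
  ENNReal.div_le_of_le_mul ((measure_mono (baseSet_subset hl D u)).trans_eq (one_mul _).symm)

lemma tendsto_volume_baseSet_div (hl : 1 ≤ l) {D : ℕ → Set (Sp d)}
    (hD : IsAddFoelner (Sp d) volume atTop D) (u : Fin (l - 1) → Sp d) :
    Tendsto (fun n => volume (baseSet l (D n) u) / volume (D n)) atTop (𝓝 1) := by
  have hlower : Tendsto (fun n => 1 - ∑ i : Fin l,
      shiftLoss volume (D n) (anchored u i) / volume (D n)) atTop (𝓝 1) := by
    have hsum := tendsto_finsetSum Finset.univ fun (i : Fin l) _ =>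
      tendsto_shiftLoss_div_of_isAddFoelner volume hD (anchored u i)
    simpa only [Finset.sum_const_zero, tsub_zero] using
      ENNReal.Tendsto.sub tendsto_const_nhds hsum (Or.inl ENNReal.one_ne_top)
  refine tendsto_of_tendsto_of_tendsto_of_le_of_le' hlower tendsto_const_nhds ?_
    (.of_forall fun n => volume_baseSet_div_le_one hl (D n) u)
  filter_upwards [hD.eventually_meas_ne_zero, hD.eventually_meas_ne_top] with n h0 htop
  rw [tsub_le_iff_right, ← ENNReal.div_self h0 htop]
  simp only [div_eq_mul_inv]
  rw [← Finset.sum_mul, ← add_mul]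
  gcongr
  exact volume_le_volume_baseSet_add (D n) u

theorem tendsto_setIntegral_pi_div (hl : 1 ≤ l) {D : ℕ → Set (Sp d)}
    (hD : IsAddFoelner (Sp d) volume atTop D) {H : (Fin l → Sp d) → ℝ} (hH : Measurable H)
    (hinv : TranslationInvariant H)
    (hint : Integrable fun u : Fin (l - 1) → Sp d => H (anchored u)) :
    Tendsto (fun n => (volume (D n)).toReal⁻¹ * ∫ z in Set.univ.pi (fun _ => D n), H z) atTop
      (𝓝 (∫ u : Fin (l - 1) → Sp d, H (anchored u))) := by
  have hdominated : Tendsto (fun n => ∫ u : Fin (l - 1) → Sp d,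
      (volume (baseSet l (D n) u) / volume (D n)).toReal * H (anchored u)) atTop
      (𝓝 (∫ u : Fin (l - 1) → Sp d, H (anchored u))) := by
    refine tendsto_integral_filter_of_dominated_convergence (fun u => ‖H (anchored u)‖) ?_ ?_
      hint.norm (.of_forall fun u => ?_)
    · filter_upwards [hD.eventually_measurableSet] with n hn
      have hvol : Measurable fun u => volume (baseSet l (D n) u) :=
        measurable_measure_prodMk_right (measurableSet_setOf_mem_baseSet hl hn)
      exact (hvol.div_const _).ennreal_toReal.aestronglyMeasurable.mul hint.1
    · refine .of_forall fun n => .of_forall fun u => ?_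
      rw [norm_mul, Real.norm_of_nonneg ENNReal.toReal_nonneg]
      exact mul_le_of_le_one_left (norm_nonneg _)
        (ENNReal.toReal_le_of_le_ofReal zero_le_one
          (by simpa using volume_baseSet_div_le_one hl (D n) u))
    · simpa only [Function.comp_apply, ENNReal.toReal_one, one_mul] using
        ((ENNReal.tendsto_toReal ENNReal.one_ne_top).comp
          (tendsto_volume_baseSet_div hl hD u)).mul_const (H (anchored u))
  refine hdominated.congr' ?_
  filter_upwards [hD.eventually_measurableSet, hD.eventually_meas_ne_top] with n hn htop
  rw [setIntegral_pi_eq_integral_volume_baseSet_mul hl hn htop hH hinv hint, ← integral_const_mul]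
  simp only [ENNReal.toReal_div, div_eq_inv_mul, mul_assoc]

end Anchored

/-! ### Tuples of distinct points -/

section Tuples
variable {α : Type*} {s t l : ℕ} {T : Finset α}

open Classical in
/-- The `l`-tuples of pairwise distinct members of `T`. -/
def tuples (l : ℕ) (T : Finset α) : Finset (Fin l → α) :=
  (Fintype.piFinset fun _ => T).filter Function.Injective

lemma mem_tuples {x : Fin l → α} : x ∈ tuples l T ↔ (∀ i, x i ∈ T) ∧ Function.Injective x := by
  simp [tuples]

lemma comp_embedding_mem_tuples {z : Fin l → α} (hz : z ∈ tuples l T) (a : Fin s ↪ Fin l) :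
    z ∘ a ∈ tuples s T :=
  mem_tuples.2 ⟨fun i => (mem_tuples.1 hz).1 (a i), (mem_tuples.1 hz).2.comp a.injective⟩

lemma card_tuples (l : ℕ) (T : Finset α) : (tuples l T).card = T.card.descFactorial l := by
  classical
  have hembeddings : T.card.descFactorial l = Fintype.card (Fin l ↪ T) := by
    rw [Fintype.card_embedding_eq, Fintype.card_coe, Fintype.card_fin]
  rw [hembeddings, ← Finset.card_univ]
  refine (Finset.card_bij (fun (e : Fin l ↪ T) _ => Subtype.val ∘ e) ?_ ?_ ?_).symm
  · exact fun e _ => mem_tuples.2 ⟨fun i => (e i).2, Subtype.val_injective.comp e.injective⟩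
  · exact fun e _ e' _ h => DFunLike.coe_injective (Subtype.val_injective.comp_left h)
  · intro x hx
    obtain ⟨hmem, hinj⟩ := mem_tuples.1 hx
    exact ⟨⟨fun i => ⟨x i, hmem i⟩, fun i j h => hinj (congrArg Subtype.val h)⟩,
      Finset.mem_univ _, rfl⟩

lemma exists_embedding_comp_eq {x : Fin s → α} {z : Fin l → α} (hx : Function.Injective x)
    (hxz : ∀ i, ∃ k, z k = x i) : ∃ a : Fin s ↪ Fin l, z ∘ a = x := by
  choose a ha using hxz
  have hax : z ∘ a = x := funext ha
  exact ⟨⟨a, (hax ▸ hx : Function.Injective (z ∘ a)).of_comp⟩, hax⟩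

open Classical in
/-- The ways of obtaining two given tuples as subtuples of an `l`-tuple covered by them. -/
def overlapFiber (T : Finset α) (l : ℕ) (x : Fin s → α) (y : Fin t → α) :
    Finset (((Fin s ↪ Fin l) × (Fin t ↪ Fin l)) × (Fin l → α)) :=
  ((Finset.univ.filter fun ab => ab ∈ overlaps s t l) ×ˢ tuples l T).filter
    fun q => q.2 ∘ q.1.1 = x ∧ q.2 ∘ q.1.2 = y

lemma mem_overlapFiber {x : Fin s → α} {y : Fin t → α}
    {q : ((Fin s ↪ Fin l) × (Fin t ↪ Fin l)) × (Fin l → α)} :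
    q ∈ overlapFiber T l x y ↔
      (q.1 ∈ overlaps s t l ∧ q.2 ∈ tuples l T) ∧ q.2 ∘ q.1.1 = x ∧ q.2 ∘ q.1.2 = y := by
  simp [overlapFiber]

open Classical in
lemma image_eq_union_of_mem_overlapFiber {x : Fin s → α} {y : Fin t → α}
    {q : ((Fin s ↪ Fin l) × (Fin t ↪ Fin l)) × (Fin l → α)} (hq : q ∈ overlapFiber T l x y) :
    Finset.univ.image q.2 = Finset.univ.image x ∪ Finset.univ.image y := by
  obtain ⟨⟨hcover, -⟩, rfl, rfl⟩ := mem_overlapFiber.1 hq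
  ext v
  simp only [Finset.mem_image, Finset.mem_univ, true_and, Finset.mem_union, Function.comp_apply]
  constructor
  · rintro ⟨k, rfl⟩
    exact (hcover k).imp (fun ⟨i, hi⟩ => ⟨i, congrArg q.2 hi⟩) fun ⟨i, hi⟩ => ⟨i, congrArg q.2 hi⟩
  · rintro (⟨i, rfl⟩ | ⟨i, rfl⟩)
    exacts [⟨_, rfl⟩, ⟨_, rfl⟩]

open Classical in
lemma card_overlapFiber_of_eq {x : Fin s → α} {y : Fin t → α} (hx : x ∈ tuples s T)
    (hy : y ∈ tuples t T) (hl : l = (Finset.univ.image x ∪ Finset.univ.image y).card) :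
    (overlapFiber T l x y).card = l.factorial := by
  set U := Finset.univ.image x ∪ Finset.univ.image y with hU
  have hUT : U ⊆ T := by
    simpa [hU, Finset.union_subset_iff, Finset.image_subset_iff]
      using And.intro (mem_tuples.1 hx).1 (mem_tuples.1 hy).1
  rw [← Nat.descFactorial_self, show l.descFactorial l = U.card.descFactorial l by rw [← hl],
    ← card_tuples]
  refine Finset.card_bij (fun q _ => q.2) (fun q hq => ?_) (fun q hq q' hq' h => ?_) fun z hz => ?_
  · refine mem_tuples.2 ⟨fun k => ?_, (mem_tuples.1 (mem_overlapFiber.1 hq).1.2).2⟩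
    rw [hU, ← image_eq_union_of_mem_overlapFiber hq]
    exact Finset.mem_image_of_mem _ (Finset.mem_univ k)
  · obtain ⟨⟨-, hz⟩, ha, hb⟩ := mem_overlapFiber.1 hq
    obtain ⟨-, ha', hb'⟩ := mem_overlapFiber.1 hq'
    have hcancel {r : ℕ} {e e' : Fin r ↪ Fin l} (he : q.2 ∘ e = q.2 ∘ e') : e = e' :=
      DFunLike.coe_injective ((mem_tuples.1 hz).2.comp_left he)
    rw [← h] at ha' hb'
    exact Prod.ext (Prod.ext (hcancel (ha.trans ha'.symm)) (hcancel (hb.trans hb'.symm))) h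
  · obtain ⟨hzU, hzinj⟩ := mem_tuples.1 hz
    have himage : Finset.univ.image z = U := Finset.eq_of_subset_of_card_le
      (by simpa [Finset.image_subset_iff] using hzU)
      (by rw [Finset.card_image_of_injective _ hzinj, Finset.card_univ, Fintype.card_fin, hl])
    have hpre : ∀ v ∈ U, ∃ k, z k = v := fun v hv => by simpa [← himage] using hv
    obtain ⟨a, ha⟩ := exists_embedding_comp_eq (mem_tuples.1 hx).2
      fun i => hpre (x i) (by simp [hU])
    obtain ⟨b, hb⟩ := exists_embedding_comp_eq (mem_tuples.1 hy).2
      fun i => hpre (y i) (by simp [hU])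
    have hcover : (a, b) ∈ overlaps s t l := fun k => by
      have hk := hzU k
      simp only [hU, ← ha, ← hb, Finset.mem_union, Finset.mem_image, Finset.mem_univ, true_and,
        Function.comp_apply, hzinj.eq_iff] at hk
      exact hk
    exact ⟨((a, b), z), mem_overlapFiber.2 ⟨⟨hcover,
      mem_tuples.2 ⟨fun k => hUT (hzU k), hzinj⟩⟩, ha, hb⟩, rfl⟩

open Classical in
lemma card_overlapFiber {x : Fin s → α} {y : Fin t → α} (hx : x ∈ tuples s T)
    (hy : y ∈ tuples t T) :
    (overlapFiber T l x y).card =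
      if l = (Finset.univ.image x ∪ Finset.univ.image y).card then l.factorial else 0 := by
  split_ifs with hl
  · exact card_overlapFiber_of_eq hx hy hl
  · refine Finset.card_eq_zero.2 (Finset.eq_empty_of_forall_notMem fun q hq => hl ?_)
    rw [← image_eq_union_of_mem_overlapFiber hq,
      Finset.card_image_of_injective _ (mem_tuples.1 (mem_overlapFiber.1 hq).1.2).2,
      Finset.card_univ, Fintype.card_fin]

open Classical in
lemma card_image_union_image_mem_Icc {x : Fin s → α} {y : Fin t → α} (hx : Function.Injective x)
    (hy : Function.Injective y) :
    (Finset.univ.image x ∪ Finset.univ.image y).card ∈ Finset.Icc (max s t) (s + t) := by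
  have hxcard : (Finset.univ.image x).card = s := by
    rw [Finset.card_image_of_injective _ hx, Finset.card_univ, Fintype.card_fin]
  have hycard : (Finset.univ.image y).card = t := by
    rw [Finset.card_image_of_injective _ hy, Finset.card_univ, Fintype.card_fin]
  rw [Finset.mem_Icc, max_le_iff]
  exact ⟨⟨hxcard.symm.trans_le (Finset.card_le_card Finset.subset_union_left),
    hycard.symm.trans_le (Finset.card_le_card Finset.subset_union_right)⟩,
    (Finset.card_union_le _ _).trans_eq (congrArg₂ _ hxcard hycard)⟩

open Classical in
lemma sum_overlaps_sum_tuples {R : Type*} [Semiring R] (T : Finset α) (l : ℕ)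
    (f : (Fin s → α) → R) (g : (Fin t → α) → R) :
    ∑ ab ∈ Finset.univ.filter (fun ab => ab ∈ overlaps s t l),
      ∑ z ∈ tuples l T, f (z ∘ ab.1) * g (z ∘ ab.2) =
      ∑ x ∈ tuples s T, ∑ y ∈ tuples t T, ((overlapFiber T l x y).card : R) * (f x * g y) := by
  rw [← Finset.sum_product', ← Finset.sum_product',
    ← Finset.sum_fiberwise_of_maps_to (t := tuples s T ×ˢ tuples t T)
      (g := fun q : ((Fin s ↪ Fin l) × (Fin t ↪ Fin l)) × (Fin l → α) =>
        (q.2 ∘ q.1.1, q.2 ∘ q.1.2))]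
  · refine Finset.sum_congr rfl fun xy _ => ?_
    rw [overlapFiber, ← nsmul_eq_mul, ← Finset.sum_const]
    refine Finset.sum_congr (Finset.filter_congr fun q _ => Prod.ext_iff) fun q hq => ?_
    obtain ⟨hqx, hqy⟩ := (Finset.mem_filter.1 hq).2
    rw [hqx, hqy]
  · intro q hq
    have hz := (Finset.mem_product.1 hq).2
    exact Finset.mem_product.2
      ⟨comp_embedding_mem_tuples hz q.1.1, comp_embedding_mem_tuples hz q.1.2⟩

open Classical in
theorem sum_tuples_mul_sum_tuples {R : Type*} [Field R] [CharZero R] (T : Finset α)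
    (f : (Fin s → α) → R) (g : (Fin t → α) → R) :
    (∑ x ∈ tuples s T, f x) * ∑ y ∈ tuples t T, g y =
      ∑ l ∈ Finset.Icc (max s t) (s + t), (l.factorial : R)⁻¹ *
        ∑ ab ∈ Finset.univ.filter (fun ab => ab ∈ overlaps s t l),
          ∑ z ∈ tuples l T, f (z ∘ ab.1) * g (z ∘ ab.2) := by
  rw [Finset.sum_mul_sum]
  simp only [sum_overlaps_sum_tuples, Finset.mul_sum]
  rw [Finset.sum_comm (s := Finset.Icc _ _)]
  refine Finset.sum_congr rfl fun x hx => ?_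
  rw [Finset.sum_comm (s := Finset.Icc _ _)]
  refine Finset.sum_congr rfl fun y hy => ?_
  have hmem := card_image_union_image_mem_Icc (mem_tuples.1 hx).2 (mem_tuples.1 hy).2
  simp only [card_overlapFiber hx hy]
  rw [Finset.sum_eq_single_of_mem _ hmem fun l _ hl => by simp [hl], if_pos rfl,
    inv_mul_cancel_left₀ (Nat.cast_ne_zero.2 (Nat.factorial_ne_zero _))]

end Tuples

/-! ### Campbell's formula -/

section SumDirac
variable {ι α : Type*} [MeasurableSpace α]

lemma sum_dirac_restrict {s B : Set α} {T : Finset α} (hT : ∀ x, x ∈ T ↔ x ∈ s ∧ x ∈ B)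
    (hB : MeasurableSet B) :
    (Measure.sum fun x : s => Measure.dirac (x : α)).restrict B = ∑ x ∈ T, Measure.dirac x := by
  ext A hA
  rw [Measure.restrict_apply hA, Measure.sum_apply _ (hA.inter hB), Measure.finsetSum_apply,
    tsum_subtype s fun x => Measure.dirac x (A ∩ B), tsum_eq_sum (s := T)]
  · refine Finset.sum_congr rfl fun x hx => ?_
    obtain ⟨hxs, hxB⟩ := (hT x).1 hx
    rw [Set.indicator_of_mem hxs, Measure.dirac_apply' _ (hA.inter hB), Measure.dirac_apply' _ hA,
      Set.inter_indicator_one, Pi.mul_apply, Set.indicator_of_mem hxB, Pi.one_apply, mul_one]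
  · intro x hx
    rw [Set.indicator_apply_eq_zero]
    intro hxs
    rw [Measure.dirac_apply' _ (hA.inter hB),
      Set.indicator_of_notMem fun h => hx ((hT x).2 ⟨hxs, h.2⟩)]

lemma integral_finsetSum_dirac [MeasurableSingletonClass α] (T : Finset α) (F : α → ℝ) :
    ∫ x, F x ∂(∑ x ∈ T, Measure.dirac x) = ∑ x ∈ T, F x := by
  rw [integral_finsetSum_measure fun i _ => integrable_dirac (by simp)]
  simp

lemma pi_finsetSum_dirac [Fintype ι] [DecidableEq ι] (T : Finset α) :
    Measure.pi (fun _ : ι => ∑ x ∈ T, Measure.dirac x) =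
      ∑ x ∈ Fintype.piFinset (fun _ : ι => T), Measure.dirac x := by
  classical
  refine Measure.pi_eq fun A hA => ?_
  simp only [Measure.finsetSum_apply]
  rw [Finset.prod_univ_sum]
  refine Finset.sum_congr rfl fun x _ => ?_
  simp only [Measure.dirac_apply' _ (hA _), Measure.dirac_apply' _ (MeasurableSet.univ_pi hA),
    Set.indicator_apply, Set.mem_univ_pi, Pi.one_apply, Finset.prod_ite_zero, Finset.prod_const_one,
    Finset.mem_univ, true_imp_iff]

lemma measurableSet_setOf_injective [Countable ι] [MeasurableEq α] :
    MeasurableSet {x : ι → α | Function.Injective x} := by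
  simp only [Function.Injective, Set.ofPred_forall]
  refine .iInter fun i => .iInter fun j => ?_
  have hdiag : MeasurableSet {x : ι → α | x i = x j} :=
    measurableSet_eq_fun (measurable_pi_apply i) (measurable_pi_apply j)
  exact hdiag.imp (.const _)

end SumDirac

section Restrict
variable {d l : ℕ} {S D : Set (Sp d)}

lemma countMeasure_restrict (hfin : (S ∩ D).Finite) (hD : MeasurableSet D) :
    (countMeasure S).restrict D = ∑ x ∈ hfin.toFinset, Measure.dirac x :=
  sum_dirac_restrict (fun _ => hfin.mem_toFinset) hD

lemma factorialMeasure_restrict (hfin : (S ∩ D).Finite) (hD : MeasurableSet D) :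
    (factorialMeasure l S).restrict (Set.univ.pi fun _ => D) =
      ∑ x ∈ tuples l hfin.toFinset, Measure.dirac x := by
  refine sum_dirac_restrict (s := {x | Function.Injective x ∧ ∀ i, x i ∈ S}) (fun x => ?_)
    (.univ_pi fun _ => hD)
  simp only [mem_tuples, Set.Finite.mem_toFinset, Set.mem_inter_iff, forall_and, Set.mem_ofPred_eq,
    Set.mem_univ_pi]
  tauto

lemma setIntegral_factorialMeasure (hfin : (S ∩ D).Finite) (hD : MeasurableSet D)
    (F : (Fin l → Sp d) → ℝ) :
    ∫ x in Set.univ.pi (fun _ => D), F x ∂(factorialMeasure l S) =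
      ∑ x ∈ tuples l hfin.toFinset, F x := by
  rw [factorialMeasure_restrict hfin hD, integral_finsetSum_dirac]

lemma restrict_pi_finsetSum_dirac (T : Finset (Sp d)) :
    (Measure.pi fun _ : Fin l => ∑ x ∈ T, Measure.dirac x).restrict {x | Function.Injective x} =
      ∑ x ∈ tuples l T, Measure.dirac x := by
  classical
  ext A hA
  rw [pi_finsetSum_dirac, Measure.restrict_apply hA, Measure.finsetSum_apply,
    Measure.finsetSum_apply, tuples, Finset.sum_filter]
  refine Finset.sum_congr rfl fun x _ => ?_
  rw [Measure.dirac_apply' _ (hA.inter measurableSet_setOf_injective), Measure.dirac_apply' _ hA]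
  simp only [Set.indicator_apply, Set.mem_inter_iff, Set.mem_ofPred_eq, Pi.one_apply, ite_and]
  split_ifs <;> rfl

end Restrict

namespace IsPointProcess
variable {Ω : Type*} [MeasurableSpace Ω] {d : ℕ} {X : Ω → Set (Sp d)} {D : Set (Sp d)}

/-- The points of `X` in the bounded window `D`. -/
def pts (hX : IsPointProcess X) (hDb : Bornology.IsBounded D) (ω : Ω) : Finset (Sp d) :=
  (hX.finite_inter ω D hDb).toFinset

lemma measurable_sum_dirac_pts (hX : IsPointProcess X) (hDb : Bornology.IsBounded D)
    (hD : MeasurableSet D) : Measurable fun ω => ∑ x ∈ hX.pts hDb ω, Measure.dirac x := by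
  refine Measure.measurable_of_measurable_coe _ fun A hA => ?_
  have hcount : ∀ ω, (∑ x ∈ hX.pts hDb ω, Measure.dirac x) A =
      ((X ω ∩ (D ∩ A)).ncard : ℝ≥0∞) := by
    classical
    intro ω
    simp only [Measure.finsetSum_apply, Measure.dirac_apply' _ hA, Set.indicator_apply,
      Pi.one_apply]
    rw [Finset.sum_boole, ← Set.ncard_coe_finset, Finset.coe_filter]
    congr 2
    ext x
    simp only [pts, Set.Finite.mem_toFinset, Set.mem_inter_iff, Set.mem_ofPred_eq, and_assoc]
  simp only [hcount]
  exact (measurable_of_countable fun n : ℕ => (n : ℝ≥0∞)).comp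
    (hX.measurable_count (D ∩ A) (hD.inter hA) (hDb.subset Set.inter_subset_left))

lemma measurable_sum_dirac_tuples (hX : IsPointProcess X) (hDb : Bornology.IsBounded D)
    (hD : MeasurableSet D) (l : ℕ) :
    Measurable fun ω => ∑ x ∈ tuples l (hX.pts hDb ω), Measure.dirac x := by
  have hcoe (A : Set (Sp d)) (hA : MeasurableSet A) :
      Measurable fun ω => (∑ x ∈ hX.pts hDb ω, Measure.dirac x) A :=
    (Measure.measurable_coe hA).comp (hX.measurable_sum_dirac_pts hDb hD)
  have hpi : Measurable fun ω =>
      Measure.pi fun _ : Fin l => ∑ x ∈ hX.pts hDb ω, Measure.dirac x := by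
    refine Measurable.measure_of_isPiSystem generateFrom_pi.symm isPiSystem_pi ?_ ?_
    · rintro _ ⟨A, hA, rfl⟩
      simp only [Measure.pi_pi]
      exact Finset.measurable_prod _ fun i _ => hcoe _ (hA i trivial)
    · simp only [Measure.pi_univ]
      exact Finset.measurable_prod _ fun i _ => hcoe _ .univ
  simp only [← restrict_pi_finsetSum_dirac]
  refine Measure.measurable_of_measurable_coe _ fun A hA => ?_
  simp only [Measure.restrict_apply hA]
  exact (Measure.measurable_coe (hA.inter measurableSet_setOf_injective)).comp hpi

/-- The random counting measure of the `l`-tuples of distinct points in `D`. -/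
def tupleKernel (hX : IsPointProcess X) (hDb : Bornology.IsBounded D) (hD : MeasurableSet D)
    (l : ℕ) : Kernel Ω (Fin l → Sp d) where
  toFun ω := ∑ x ∈ tuples l (hX.pts hDb ω), Measure.dirac x
  measurable' := hX.measurable_sum_dirac_tuples hDb hD l

lemma integral_tupleKernel (hX : IsPointProcess X) (hDb : Bornology.IsBounded D)
    (hD : MeasurableSet D) {l : ℕ} (F : (Fin l → Sp d) → ℝ) (ω : Ω) :
    ∫ x, F x ∂(hX.tupleKernel hDb hD l ω) = ∑ x ∈ tuples l (hX.pts hDb ω), F x :=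
  integral_finsetSum_dirac _ F

end IsPointProcess

namespace IsDPP
variable {Ω : Type*} [MeasurableSpace Ω] {d l : ℕ} {X : Ω → Set (Sp d)} {P : Measure Ω}
  {K : Sp d → Sp d → ℝ} {D : Set (Sp d)}

lemma tupleKernel_comp_apply_pi (hX : IsDPP P X K) (hDb : Bornology.IsBounded D)
    (hD : MeasurableSet D) (hl : 1 ≤ l) {A : Fin l → Set (Sp d)} (hA : ∀ i, MeasurableSet (A i)) :
    (hX.isPointProcess.tupleKernel hDb hD l ∘ₘ P) (Set.univ.pi A) =
      ((volume.restrict (Set.univ.pi fun _ => D)).withDensity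
        fun x => ENNReal.ofReal (jointIntensity K x)) (Set.univ.pi A) := by
  have hAm : MeasurableSet (Set.univ.pi A) := .univ_pi hA
  rw [Measure.bind_apply hAm (Kernel.aemeasurable _), withDensity_apply _ hAm,
    Measure.restrict_restrict hAm, ← Set.pi_inter_distrib,
    ← hX.factorialMoment l hl _ (fun i => (hA i).inter hD)
      fun i => hDb.subset Set.inter_subset_right]
  refine lintegral_congr fun ω => ?_
  rw [Set.pi_inter_distrib, ← Measure.restrict_apply hAm,
    factorialMeasure_restrict (hX.isPointProcess.finite_inter ω D hDb) hD]
  rfl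

theorem tupleKernel_comp_eq_withDensity (hX : IsDPP P X K) (hDb : Bornology.IsBounded D)
    (hD : MeasurableSet D) (hl : 1 ≤ l)
    (hρ : IntegrableOn (fun x : Fin l → Sp d => jointIntensity K x) (Set.univ.pi fun _ => D)) :
    hX.isPointProcess.tupleKernel hDb hD l ∘ₘ P =
      (volume.restrict (Set.univ.pi fun _ => D)).withDensity
        fun x => ENNReal.ofReal (jointIntensity K x) := by
  have hfinite : IsFiniteMeasure ((volume.restrict (Set.univ.pi fun _ => D)).withDensity
      fun x : Fin l → Sp d => ENNReal.ofReal (jointIntensity K x)) :=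
    isFiniteMeasure_withDensity_ofReal hρ.2
  symm
  refine ext_of_generate_finite _ generateFrom_pi.symm isPiSystem_pi ?_ ?_
  · rintro _ ⟨A, hA, rfl⟩
    exact (hX.tupleKernel_comp_apply_pi hDb hD hl fun i => hA i trivial).symm
  · simpa using (hX.tupleKernel_comp_apply_pi hDb hD hl fun _ => MeasurableSet.univ).symm

variable (hX : IsDPP P X K) (hDb : Bornology.IsBounded D) (hD : MeasurableSet D) (hl : 1 ≤ l)
  (hρ : IntegrableOn (fun x : Fin l → Sp d => jointIntensity K x) (Set.univ.pi fun _ => D))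
  {F : (Fin l → Sp d) → ℝ}
  (hF : IntegrableOn (fun x => F x * jointIntensity K x) (Set.univ.pi fun _ => D))

include hD hl hρ hF in
lemma integrable_tupleKernel_comp :
    Integrable F (hX.isPointProcess.tupleKernel hDb hD l ∘ₘ P) := by
  rw [hX.tupleKernel_comp_eq_withDensity hDb hD hl hρ, integrable_withDensity_iff_integrable_smul₀'
    hρ.aemeasurable.ennreal_ofReal (.of_forall fun _ => ENNReal.ofReal_lt_top)]
  refine hF.congr (ae_restrict_of_ae ?_)
  filter_upwards [hX.intensity_nonneg l hl] with x hx
  rw [ENNReal.toReal_ofReal hx, smul_eq_mul, mul_comm]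

include hD hl hρ hF in
lemma integrable_sum_tuples :
    Integrable (fun ω => ∑ x ∈ tuples l (hX.isPointProcess.pts hDb ω), F x) P := by
  have hint := hX.integrable_tupleKernel_comp hDb hD hl hρ hF
  rw [Measure.comp_eq_comp_const_apply] at hint
  simpa only [Kernel.const_apply, hX.isPointProcess.integral_tupleKernel hDb hD F]
    using hint.integral_comp

include hD hl hρ hF in
theorem integral_sum_tuples :
    ∫ ω, ∑ x ∈ tuples l (hX.isPointProcess.pts hDb ω), F x ∂P =
      ∫ x in Set.univ.pi (fun _ => D), F x * jointIntensity K x := by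
  have hint := hX.integrable_tupleKernel_comp hDb hD hl hρ hF
  have hdensity := hX.tupleKernel_comp_eq_withDensity hDb hD hl hρ
  calc ∫ ω, ∑ x ∈ tuples l (hX.isPointProcess.pts hDb ω), F x ∂P
      = ∫ x, F x ∂(hX.isPointProcess.tupleKernel hDb hD l ∘ₘ P) := by
        rw [Measure.comp_eq_comp_const_apply] at hint ⊢
        rw [Kernel.integral_comp hint]
        simp only [Kernel.const_apply, hX.isPointProcess.integral_tupleKernel hDb hD F]
    _ = ∫ x in Set.univ.pi (fun _ => D), F x * jointIntensity K x := by
        rw [hdensity, integral_withDensity_eq_integral_toReal_smul₀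
          hρ.aemeasurable.ennreal_ofReal (.of_forall fun _ => ENNReal.ofReal_lt_top)]
        refine integral_congr_ae (ae_restrict_of_ae ?_)
        filter_upwards [hX.intensity_nonneg l hl] with x hx
        rw [ENNReal.toReal_ofReal hx, smul_eq_mul, mul_comm]

end IsDPP

/-! ### Plancherel's theorem and positive definite functions -/

section Plancherel
variable {V F : Type*} [NormedAddCommGroup V] [InnerProductSpace ℝ V] [FiniteDimensional ℝ V]
  [MeasurableSpace V] [BorelSpace V] [NormedAddCommGroup F] [InnerProductSpace ℂ F]
  {h : V → F}

lemma continuous_fourier_of_integrable (h1 : Integrable h) : Continuous (𝓕 h) :=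
  VectorFourier.fourierIntegral_continuous Real.continuous_fourierChar
    (by exact continuous_inner) h1

lemma integrable_fourierChar_smul (h1 : Integrable h) (y : V) :
    Integrable fun ξ => Real.fourierChar (inner ℝ ξ y) • h ξ := by
  simpa using (Real.fourierIntegral_convergent_iff (f := h) (μ := volume) (-y)).2 h1

variable [CompleteSpace F]

open scoped ContDiff SchwartzMap in
lemma fourier_ae_eq_fourier_toLp (h1 : Integrable h) (h2 : MemLp h 2) :
    𝓕 h =ᵐ[volume] (𝓕 (h2.toLp h) : Lp F 2 (volume : Measure V)) := by
  refine ae_eq_of_integral_contDiff_smul_eq (continuous_fourier_of_integrable h1).locallyIntegrable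
    ((Lp.memLp _).locallyIntegrable (by norm_num)) fun ψ hψ hψc => ?_
  have hψ' : ContDiff ℝ ∞ (fun x => (ψ x : ℂ)) := Complex.ofRealCLM.contDiff.comp hψ
  have hψc' : HasCompactSupport (fun x => (ψ x : ℂ)) :=
    hψc.comp_left (g := fun r : ℝ => (r : ℂ)) (by simp)
  let Ψ : 𝓢(V, ℂ) := hψc'.toSchwartzMap hψ'
  have hLp : ∫ x, (𝓕 Ψ) x • h2.toLp h x = ∫ x, Ψ x • (𝓕 (h2.toLp h) : Lp F 2 volume) x := by
    simpa only [TemperedDistribution.fourier_apply, Lp.toTemperedDistribution_apply] using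
      congrArg (fun T => T Ψ) (Lp.fourier_toTemperedDistribution_eq (h2.toLp h))
  have htoLp : ∫ x, (𝓕 Ψ) x • h2.toLp h x = ∫ x, (𝓕 Ψ) x • h x :=
    integral_congr_ae (h2.coeFn_toLp.mono fun x hx => by simp only [hx])
  have hselfadjoint : ∫ x, (𝓕 (Ψ : V → ℂ)) x • h x = ∫ x, Ψ x • 𝓕 h x := by
    have := VectorFourier.integral_fourierIntegral_smul_eq_flip (L := innerₗ V) (μ := volume)
      (ν := volume) Real.continuous_fourierChar (by exact continuous_inner) Ψ.integrable h1
    rwa [flip_innerₗ] at this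
  rw [htoLp, SchwartzMap.fourier_coe, hselfadjoint] at hLp
  simpa [Ψ] using hLp

lemma eLpNorm_fourier_eq (h1 : Integrable h) (h2 : MemLp h 2) :
    eLpNorm (𝓕 h) 2 volume = eLpNorm h 2 volume := by
  rw [eLpNorm_congr_ae (fourier_ae_eq_fourier_toLp h1 h2), ← eLpNorm_congr_ae h2.coeFn_toLp,
    ← ENNReal.toReal_eq_toReal_iff' (Lp.eLpNorm_ne_top _) (Lp.eLpNorm_ne_top _),
    ← Lp.norm_def, ← Lp.norm_def, Lp.norm_fourier_eq]

lemma lintegral_fourier_enorm_sq (h1 : Integrable h) (h2 : MemLp h 2) :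
    ∫⁻ y, ‖𝓕 h y‖ₑ ^ 2 = ∫⁻ x, ‖h x‖ₑ ^ 2 := by
  have hsq := congrArg (fun r : ℝ≥0∞ => r ^ (2 : ℝ)) (eLpNorm_fourier_eq h1 h2)
  simp only [eLpNorm_eq_lintegral_rpow_enorm_toReal two_ne_zero ENNReal.ofNat_ne_top,
    ENNReal.toReal_ofNat, ← ENNReal.rpow_mul] at hsq
  norm_num at hsq
  exact hsq

end Plancherel

section TrigSum
variable {d : ℕ} {ι : Type*} [Fintype ι]

/-- The trigonometric sum `∑ v_i exp(2πi⟨ξ, x_i⟩)`. -/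
def trigSum (x : ι → Sp d) (v : ι → ℝ) (ξ : Sp d) : ℂ :=
  ∑ i, (v i : ℂ) * (Real.fourierChar (inner ℝ ξ (x i)) : ℂ)

lemma continuous_trigSum (x : ι → Sp d) (v : ι → ℝ) : Continuous (trigSum x v) :=
  continuous_finsetSum _ fun _ _ => continuous_const.mul <|
    continuous_subtype_val.comp (Real.continuous_fourierChar.comp (by fun_prop))

lemma norm_trigSum_le (x : ι → Sp d) (v : ι → ℝ) (ξ : Sp d) : ‖trigSum x v ξ‖ ≤ ∑ i, |v i| := by
  refine (norm_sum_le _ _).trans (Finset.sum_le_sum fun i _ => ?_)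
  rw [norm_mul, Circle.norm_coe, mul_one, Complex.norm_real, Real.norm_eq_abs]

lemma conj_trigSum (x : ι → Sp d) (v : ι → ℝ) (ξ : Sp d) :
    (starRingEnd ℂ) (trigSum x v ξ) =
      ∑ i, (v i : ℂ) * (Real.fourierChar (-inner ℝ ξ (x i)) : ℂ) := by
  simp only [trigSum, map_sum, map_mul, Complex.conj_ofReal, AddChar.map_neg_eq_inv,
    Circle.coe_inv_eq_conj]

end TrigSum

namespace IsSpectralDensity
variable {d : ℕ} {c φ : Sp d → ℝ} (h : IsSpectralDensity c φ)
include h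

lemma const_mul {a : ℝ} (ha : 0 ≤ a) : IsSpectralDensity (fun x => a * c x) fun ξ => a * φ ξ := by
  refine ⟨fun ξ => mul_nonneg ha (h.1 ξ), h.2.1.const_mul a, fun x => ?_⟩
  push_cast
  simp only [h.2.2, Real.fourierInv_eq, ← integral_const_mul, Circle.smul_def, smul_eq_mul]
  exact integral_congr_ae (.of_forall fun ξ => by ring)

lemma continuous : Continuous c := by
  have hre : c = fun x => (𝓕 (fun ξ => (φ ξ : ℂ)) (-x)).re := by
    funext x
    rw [← Real.fourierInv_eq_fourier_neg, ← h.2.2 x, Complex.ofReal_re]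
  rw [hre]
  exact Complex.continuous_re.comp
    ((continuous_fourier_of_integrable h.2.1.ofReal).comp continuous_neg)

lemma neg_apply (x : Sp d) : c (-x) = c x := by
  apply Complex.ofReal_injective
  rw [← Complex.conj_ofReal (c x), h.2.2, h.2.2, Real.fourierInv_eq, Real.fourierInv_eq,
    ← integral_conj]
  refine integral_congr_ae (.of_forall fun ξ => ?_)
  simp [Circle.smul_def, AddChar.map_neg_eq_inv]

variable {ι : Type*} [Fintype ι]

lemma integrable_mul_trigSum (x : ι → Sp d) (v : ι → ℝ) :
    Integrable fun ξ => (φ ξ : ℂ) * trigSum x v ξ :=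
  h.2.1.ofReal.mul_bdd (continuous_trigSum x v).aestronglyMeasurable
    (.of_forall fun ξ => norm_trigSum_le x v ξ)

lemma integrable_mul_norm_trigSum_sq (x : ι → Sp d) (v : ι → ℝ) :
    Integrable fun ξ => φ ξ * ‖trigSum x v ξ‖ ^ 2 := by
  refine h.2.1.mul_bdd ((continuous_trigSum x v).norm.pow 2).aestronglyMeasurable
    (c := (∑ i, |v i|) ^ 2) (.of_forall fun ξ => ?_)
  rw [norm_pow, norm_norm]
  exact pow_le_pow_left₀ (norm_nonneg _) (norm_trigSum_le x v ξ) 2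

lemma sum_mul_apply_sub_eq_fourier (x : ι → Sp d) (v : ι → ℝ) (y : Sp d) :
    ((∑ i, v i * c (x i - y) : ℝ) : ℂ) = 𝓕 (fun ξ => (φ ξ : ℂ) * trigSum x v ξ) y := by
  push_cast
  simp only [h.2.2, Real.fourierInv_eq, Real.fourier_eq, ← integral_const_mul]
  rw [← integral_finsetSum _ fun i _ =>
    (integrable_fourierChar_smul h.2.1.ofReal (x i - y)).const_mul _]
  refine integral_congr_ae (.of_forall fun ξ => ?_)
  simp only [trigSum, Finset.mul_sum, Circle.smul_def, smul_eq_mul]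
  refine Finset.sum_congr rfl fun i _ => ?_
  rw [inner_sub_right, sub_eq_add_neg, AddChar.map_add_eq_mul, Circle.coe_mul]
  ring

lemma sum_sum_mul_apply_sub_eq_integral (x : ι → Sp d) (v : ι → ℝ) :
    ∑ j, v j * ∑ i, v i * c (x i - x j) = ∫ ξ, φ ξ * ‖trigSum x v ξ‖ ^ 2 := by
  apply Complex.ofReal_injective
  rw [Complex.ofReal_sum, ← integral_complex_ofReal]
  simp only [Complex.ofReal_mul (v _), h.sum_mul_apply_sub_eq_fourier, Real.fourier_eq,
    ← integral_const_mul]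
  rw [← integral_finsetSum _ fun j _ => Integrable.const_mul
    ((Real.fourierIntegral_convergent_iff (x j)).2 (h.integrable_mul_trigSum x v)) _]
  refine integral_congr_ae (.of_forall fun ξ => ?_)
  have hsq : ((‖trigSum x v ξ‖ ^ 2 : ℝ) : ℂ) = trigSum x v ξ * (starRingEnd ℂ) (trigSum x v ξ) := by
    rw [Complex.mul_conj, Complex.normSq_eq_norm_sq]
  simp only [Complex.ofReal_mul, hsq, conj_trigSum, Circle.smul_def, smul_eq_mul, Finset.mul_sum]
  exact Finset.sum_congr rfl fun j _ => by ring

lemma sum_sum_nonneg (x : ι → Sp d) (v : ι → ℝ) : 0 ≤ ∑ j, v j * ∑ i, v i * c (x i - x j) := by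
  rw [h.sum_sum_mul_apply_sub_eq_integral]
  exact integral_nonneg fun ξ => mul_nonneg (h.1 ξ) (by positivity)

/-- Convolution by `c` is multiplication by `φ ≤ 1` on the Fourier side, so `K² ≤ K` for the
corresponding operator. -/
lemma lintegral_sq_sum_le (hφ : ∀ ξ, φ ξ ≤ 1) (x : ι → Sp d) (v : ι → ℝ) :
    ∫⁻ y, ENNReal.ofReal ((∑ i, v i * c (x i - y)) ^ 2) ≤
      ENNReal.ofReal (∑ j, v j * ∑ i, v i * c (x i - x j)) := by
  let g : Sp d → ℂ := fun ξ => (φ ξ : ℂ) * trigSum x v ξ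
  have hg : Integrable g := h.integrable_mul_trigSum x v
  have hnorm : ∀ ξ, ‖g ξ‖ ^ 2 ≤ φ ξ * ‖trigSum x v ξ‖ ^ 2 := fun ξ => by
    rw [norm_mul, Complex.norm_real, Real.norm_of_nonneg (h.1 ξ), mul_pow, sq (φ ξ)]
    exact mul_le_mul_of_nonneg_right (mul_le_of_le_one_left (h.1 ξ) (hφ ξ)) (by positivity)
  have hg2 : MemLp g 2 := by
    rw [memLp_two_iff_integrable_sq_norm hg.1]
    refine (h.integrable_mul_norm_trigSum_sq x v).mono' (hg.1.norm.pow 2) (.of_forall fun ξ => ?_)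
    rw [Real.norm_of_nonneg (by positivity)]
    exact hnorm ξ
  calc ∫⁻ y, ENNReal.ofReal ((∑ i, v i * c (x i - y)) ^ 2)
      = ∫⁻ y, ‖𝓕 g y‖ₑ ^ 2 := by
        refine lintegral_congr fun y => ?_
        rw [← h.sum_mul_apply_sub_eq_fourier x v y, ← ofReal_norm,
          ← ENNReal.ofReal_pow (norm_nonneg _), Complex.norm_real, Real.norm_eq_abs, sq_abs]
    _ = ∫⁻ ξ, ‖g ξ‖ₑ ^ 2 := lintegral_fourier_enorm_sq hg hg2
    _ ≤ ∫⁻ ξ, ENNReal.ofReal (φ ξ * ‖trigSum x v ξ‖ ^ 2) := by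
        refine lintegral_mono fun ξ => ?_
        rw [← ofReal_norm, ← ENNReal.ofReal_pow (norm_nonneg _)]
        exact ENNReal.ofReal_le_ofReal (hnorm ξ)
    _ = ENNReal.ofReal (∑ j, v j * ∑ i, v i * c (x i - x j)) := by
        rw [h.sum_sum_mul_apply_sub_eq_integral, ofReal_integral_eq_lintegral_ofReal
          (h.integrable_mul_norm_trigSum_sq x v)
          (.of_forall fun ξ => mul_nonneg (h.1 ξ) (by positivity))]

end IsSpectralDensity

/-! ### Contraction kernels -/

/-- The matrix `(K(x_i, y_j))_{i,j}` for two families of points with arbitrary index types, so that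
`gram K x x` is `kernelMatrix K x` when `x` is indexed by `Fin p`. -/
def gram {E ι κ : Type*} (K : E → E → ℝ) (x : ι → E) (y : κ → E) : Matrix ι κ ℝ :=
  Matrix.of fun i j => K (x i) (y j)

/-- A continuous stationary kernel with `0 ≤ K ≤ 1` as an operator on `L²`, positive definite at
distinct points. The bound `K² ≤ K` is tested on combinations of Dirac masses. -/
structure IsContractionKernel {d : ℕ} (K : Sp d → Sp d → ℝ) : Prop where
  continuous : Continuous fun z : Sp d × Sp d => K z.1 z.2
  add_right : ∀ c x y, K (x + c) (y + c) = K x y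
  posSemidef : ∀ {ι : Type} [Fintype ι] (x : ι → Sp d), (gram K x x).PosSemidef
  posDef : ∀ {l : ℕ} (x : Fin l → Sp d), Function.Injective x → (gram K x x).PosDef
  contraction : ∀ {ι : Type} [Fintype ι] (x : ι → Sp d) (v : ι → ℝ),
    ∫⁻ y, ENNReal.ofReal ((∑ i, v i * K (x i) y) ^ 2) ≤
      ENNReal.ofReal (∑ j, v j * ∑ i, v i * K (x i) (x j))

lemma IsSpectralDensity.isContractionKernel {d : ℕ} {c φ : Sp d → ℝ} (h : IsSpectralDensity c φ)
    (hφ : ∀ ξ, φ ξ ≤ 1) (hpos : ∀ (l : ℕ) (x : Fin l → Sp d), Function.Injective x →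
      (kernelMatrix (fun x y => c (x - y)) x).PosDef) :
    IsContractionKernel fun x y : Sp d => c (x - y) where
  continuous := h.continuous.comp (continuous_fst.sub continuous_snd)
  add_right b x y := by rw [add_sub_add_right_eq_sub]
  posSemidef x := by
    refine Matrix.PosSemidef.of_dotProduct_mulVec_nonneg ?_ fun v => ?_
    · ext i j
      simpa [gram] using h.neg_apply (x i - x j)
    · refine (h.sum_sum_nonneg x v).trans_eq (Finset.sum_congr rfl fun j _ => ?_)
      simp only [Matrix.mulVec, dotProduct, gram, Matrix.of_apply, star_trivial]
      refine congrArg _ (Finset.sum_congr rfl fun i _ => ?_)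
      rw [← neg_sub, h.neg_apply, mul_comm]
  posDef x hx := hpos _ x hx
  contraction x v := h.lintegral_sq_sum_le hφ x v

lemma isContractionKernel_stationaryKernel {d q : ℕ} {C : EuclideanSpace ℝ (Fin q) → Sp d → ℝ}
    {θ : Param q} (hlam : 0 < θ.1) {φ : Sp d → ℝ} (h : IsSpectralDensity (C θ.2) φ)
    (hφ : ∀ ξ, φ ξ ≤ 1 / θ.1) (hpos : ∀ (l : ℕ) (x : Fin l → Sp d), Function.Injective x →
      (kernelMatrix (stationaryKernel C θ) x).PosDef) :
    IsContractionKernel (stationaryKernel C θ) := by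
  refine (h.const_mul hlam.le).isContractionKernel (fun ξ => ?_) hpos
  rw [← mul_one_div_cancel hlam.ne']
  exact mul_le_mul_of_nonneg_left (hφ ξ) hlam.le

/-! ### Determinant estimates -/

section Determinants
open scoped Matrix
variable {ι κ : Type*}

lemma abs_prod_sub_prod_le (s : Finset ι) (a b : ι → ℝ) {M δ : ℝ} (hM : 1 ≤ M)
    (hδ : 0 ≤ δ) (ha : ∀ i, |a i| ≤ M) (hb : ∀ i, |b i| ≤ M) (hab : ∀ i, |a i - b i| ≤ δ) :
    |∏ i ∈ s, a i - ∏ i ∈ s, b i| ≤ s.card * M ^ s.card * δ := by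
  classical
  induction s using Finset.induction_on with
  | empty => simp
  | insert k s hk ih =>
    rw [Finset.prod_insert hk, Finset.prod_insert hk, Finset.card_insert_of_notMem hk]
    have hprod : |∏ i ∈ s, a i| ≤ M ^ s.card := by
      rw [Finset.abs_prod, ← Finset.prod_const]
      exact Finset.prod_le_prod (fun i _ => abs_nonneg _) fun i _ => ha i
    calc |a k * ∏ i ∈ s, a i - b k * ∏ i ∈ s, b i|
        = |(a k - b k) * ∏ i ∈ s, a i + b k * (∏ i ∈ s, a i - ∏ i ∈ s, b i)| := by ring_nf
      _ ≤ |a k - b k| * |∏ i ∈ s, a i| + |b k| * |∏ i ∈ s, a i - ∏ i ∈ s, b i| := by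
          rw [← abs_mul, ← abs_mul]; exact abs_add_le _ _
      _ ≤ δ * M ^ (s.card + 1) + M * (s.card * M ^ s.card * δ) := by
          gcongr
          · exact hab k
          · exact hprod.trans (pow_le_pow_right₀ hM s.card.le_succ)
          · exact hb k
      _ = _ := by push_cast; ring

lemma abs_apply_le_of_posSemidef [Finite ι] {S : Matrix ι ι ℝ} (hS : S.PosSemidef) (i j : ι) :
    |S i j| ≤ (S i i + S j j) / 2 := by
  classical
  cases nonempty_fintype ι
  have hsym : S j i = S i j := by simpa using hS.1.apply i j
  have hadd := hS.dotProduct_mulVec_nonneg (Pi.single i 1 + Pi.single j 1)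
  have hsub := hS.dotProduct_mulVec_nonneg (Pi.single i 1 - Pi.single j 1)
  simp only [star_trivial, Matrix.mulVec_add, Matrix.mulVec_sub, add_dotProduct, sub_dotProduct,
    dotProduct_add, dotProduct_sub, Matrix.mulVec_single_one, single_one_dotProduct,
    Matrix.col_apply, hsym] at hadd hsub
  rw [abs_le]
  constructor <;> linarith

variable [Fintype ι]

lemma abs_det_sub_det_le [DecidableEq ι] (A B : Matrix ι ι ℝ) {M δ : ℝ}
    (hM : 1 ≤ M) (hδ : 0 ≤ δ) (hA : ∀ i j, |A i j| ≤ M) (hB : ∀ i j, |B i j| ≤ M)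
    (hAB : ∀ i j, |A i j - B i j| ≤ δ) :
    |A.det - B.det| ≤ (Fintype.card ι).factorial *
      (Fintype.card ι * M ^ Fintype.card ι * δ) := by
  rw [Matrix.det_apply', Matrix.det_apply', ← Finset.sum_sub_distrib]
  refine (Finset.abs_sum_le_sum_abs _ _).trans ?_
  rw [← Fintype.card_perm, ← Finset.card_univ, ← nsmul_eq_mul]
  refine Finset.sum_le_card_nsmul _ _ _ fun σ _ => ?_
  have hsign : |((Equiv.Perm.sign σ : ℤ) : ℝ)| = 1 := by
    rcases Int.units_eq_one_or (Equiv.Perm.sign σ) with h | h <;> simp [h]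
  rw [← mul_sub, abs_mul, hsign, one_mul]
  exact abs_prod_sub_prod_le _ _ _ hM hδ (fun i => hA _ _) (fun i => hB _ _) fun i => hAB _ _

lemma abs_det_le [DecidableEq ι] (A : Matrix ι ι ℝ) {M : ℝ} (hA : ∀ i j, |A i j| ≤ M) :
    |A.det| ≤ (Fintype.card ι).factorial * M ^ Fintype.card ι := by
  simpa using Matrix.det_le (abv := AbsoluteValue.abs) (A := A) (x := M) hA

lemma abs_apply_le_trace_of_posSemidef {S : Matrix ι ι ℝ} (hS : S.PosSemidef) (i j : ι) :
    |S i j| ≤ S.trace := by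
  have hle : ∀ k, S k k ≤ S.trace := fun k =>
    Finset.single_le_sum (f := fun k => S k k) (fun k _ => hS.diag_nonneg) (Finset.mem_univ k)
  linarith [abs_apply_le_of_posSemidef hS i j, hle i, hle j]

lemma trace_conjTranspose_mul_self_eq_sum [Fintype κ] (A : Matrix κ ι ℝ) :
    (Aᴴ * A).trace = ∑ i, ∑ k, A k i ^ 2 := by
  simp only [Matrix.trace, Matrix.diag, Matrix.mul_apply, Matrix.conjTranspose_apply,
    star_trivial, sq]

section SchurComplement
variable [DecidableEq ι] {A : Matrix ι ι ℝ} {B : Matrix ι κ ℝ} {D : Matrix κ κ ℝ}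

lemma posSemidef_conjTranspose_mul_inv_mul [Finite κ] (hA : A.PosDef) (B : Matrix ι κ ℝ) :
    (Bᴴ * A⁻¹ * B).PosSemidef :=
  hA.inv.posSemidef.conjTranspose_mul_mul_same _

lemma abs_schurComplement_le [Finite κ] (hA : A.PosDef)
    (h : (Matrix.fromBlocks A B Bᴴ D).PosSemidef)
    {M : ℝ} (hD : ∀ k, D k k ≤ M) (i j : κ) : |(D - Bᴴ * A⁻¹ * B) i j| ≤ M := by
  have : Invertible A := Matrix.invertibleOfIsUnitDet _ hA.det_pos.ne'.isUnit
  have hdiag : ∀ k, (D - Bᴴ * A⁻¹ * B) k k ≤ M := fun k => by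
    have := (posSemidef_conjTranspose_mul_inv_mul hA B).diag_nonneg (i := k)
    rw [Matrix.sub_apply]
    linarith [hD k]
  have := abs_apply_le_of_posSemidef ((Matrix.PosDef.fromBlocks₁₁ _ _ hA).1 h) i j
  linarith [hdiag i, hdiag j]

variable [Fintype κ] [DecidableEq κ]

lemma det_fromBlocks_eq_det_mul_det_schurComplement (hA : A.PosDef) :
    (Matrix.fromBlocks A B Bᴴ D).det = A.det * (D - Bᴴ * A⁻¹ * B).det := by
  have : Invertible A := Matrix.invertibleOfIsUnitDet _ hA.det_pos.ne'.isUnit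
  rw [Matrix.det_fromBlocks₁₁, Matrix.invOf_eq_nonsing_inv]

lemma abs_det_fromBlocks_le (hA : A.PosDef) (h : (Matrix.fromBlocks A B Bᴴ D).PosSemidef)
    {M : ℝ} (hD : ∀ k, D k k ≤ M) :
    |(Matrix.fromBlocks A B Bᴴ D).det| ≤
      (Fintype.card κ).factorial * M ^ Fintype.card κ * A.det := by
  rw [det_fromBlocks_eq_det_mul_det_schurComplement hA, abs_mul, abs_of_pos hA.det_pos, mul_comm]
  exact mul_le_mul_of_nonneg_right (abs_det_le _ (abs_schurComplement_le hA h hD))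
    hA.det_pos.le

lemma abs_det_mul_det_sub_det_fromBlocks_le (hA : A.PosDef)
    (h : (Matrix.fromBlocks A B Bᴴ D).PosSemidef) {M : ℝ} (hM : 1 ≤ M) (hD : ∀ i j, |D i j| ≤ M) :
    |A.det * D.det - (Matrix.fromBlocks A B Bᴴ D).det| ≤
      (Fintype.card κ).factorial * (Fintype.card κ * M ^ Fintype.card κ) * A.det *
        (Bᴴ * A⁻¹ * B).trace := by
  have hS := posSemidef_conjTranspose_mul_inv_mul hA B
  rw [det_fromBlocks_eq_det_mul_det_schurComplement hA, ← mul_sub, abs_mul, abs_of_pos hA.det_pos]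
  calc A.det * |D.det - (D - Bᴴ * A⁻¹ * B).det|
      ≤ A.det * ((Fintype.card κ).factorial *
          (Fintype.card κ * M ^ Fintype.card κ * (Bᴴ * A⁻¹ * B).trace)) := by
        refine mul_le_mul_of_nonneg_left (abs_det_sub_det_le _ _ hM hS.trace_nonneg hD
          (abs_schurComplement_le hA h fun k => (le_abs_self _).trans (hD k k)) fun i j => ?_)
          hA.det_pos.le
        rw [Matrix.sub_apply, sub_sub_cancel]
        exact abs_apply_le_trace_of_posSemidef hS i j
    _ = _ := by ring

end SchurComplement
end Determinants

namespace IsContractionKernel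
open scoped Matrix
variable {d : ℕ} {K : Sp d → Sp d → ℝ}

lemma symm (hK : IsContractionKernel K) (x y : Sp d) : K x y = K y x := by
  simpa [gram] using (hK.posSemidef ![x, y]).1.apply 1 0

lemma self_eq (hK : IsContractionKernel K) (x : Sp d) : K x x = K 0 0 := by
  simpa using hK.add_right x 0 0

lemma abs_le (hK : IsContractionKernel K) (x y : Sp d) : |K x y| ≤ K 0 0 := by
  have := abs_apply_le_of_posSemidef (hK.posSemidef ![x, y]) 0 1
  simpa [gram, hK.self_eq] using this

lemma zero_zero_nonneg (hK : IsContractionKernel K) : 0 ≤ K 0 0 :=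
  (abs_nonneg _).trans (hK.abs_le 0 0)

/-- The part `Bᵀ A⁻¹ B` of the Gram matrix of the points `y` that is explained by the points `x`,
where `A` is the Gram matrix of `x` and `B` the cross Gram matrix of `x` and `y`. -/
def explained {ι κ : Type*} [Fintype ι] [DecidableEq ι] (K : Sp d → Sp d → ℝ) (x : ι → Sp d)
    (y : κ → Sp d) : Matrix κ κ ℝ :=
  (gram K x y)ᴴ * (gram K x x)⁻¹ * gram K x y

variable {ι κ : Type} {x : ι → Sp d} {y : κ → Sp d}

lemma gram_sumElim (hK : IsContractionKernel K) :
    gram K (Sum.elim x y) (Sum.elim x y) =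
      Matrix.fromBlocks (gram K x x) (gram K x y) (gram K x y)ᴴ (gram K y y) := by
  ext i j
  rcases i with i | i <;> rcases j with j | j <;> simp [gram, hK.symm (y _) (x _)]

lemma gram_add (hK : IsContractionKernel K) (x : ι → Sp d) (y : κ → Sp d) (c : Sp d) :
    gram K (fun i => x i + c) (fun j => y j + c) = gram K x y := by
  ext i j
  simp [gram, hK.add_right]

variable [Fintype ι]

lemma measurable_sum_mul_add (hK : IsContractionKernel K) (v : ι → ℝ) (z : Sp d) :
    Measurable fun R => ∑ i, v i * K (x i) (z + R) :=
  Continuous.measurable <| continuous_finsetSum _ fun _ _ => continuous_const.mul <|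
    hK.continuous.comp (continuous_const.prodMk (continuous_const_add z))

variable [Fintype κ] [DecidableEq ι]

open scoped MatrixOrder in
/-- With `A⁻¹ = Lᵀ L`, the trace is a sum of squares of combinations `∑ L m i * K (x i) y`, to each
of which `K² ≤ K` applies; the bounds add up to `tr (L A Lᵀ) = tr 1`. -/
lemma lintegral_trace_explained_le (hK : IsContractionKernel K) (hx : (gram K x x).PosDef) :
    ∫⁻ R, ENNReal.ofReal (explained K x fun j => y j + R).trace ≤
      Fintype.card κ * Fintype.card ι := by
  obtain ⟨L, hL⟩ : ∃ L : Matrix ι ι ℝ, (gram K x x)⁻¹ = Lᴴ * L :=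
    CStarAlgebra.nonneg_iff_eq_star_mul_self.mp hx.inv.posSemidef.nonneg
  have htrace : ∀ R, (explained K x fun j => y j + R).trace =
      ∑ j, ∑ m, (∑ i, L m i * K (x i) (y j + R)) ^ 2 := fun R => by
    rw [explained, hL, ← Matrix.mul_assoc, ← Matrix.conjTranspose_mul, Matrix.mul_assoc,
      trace_conjTranspose_mul_self_eq_sum]
    simp only [Matrix.mul_apply, gram, Matrix.of_apply]
  have hrow : ∀ m, ∑ j, L m j * ∑ i, L m i * K (x i) (x j) = (L * gram K x x * Lᴴ) m m := by
    intro m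
    simp only [Matrix.mul_apply, gram, Matrix.of_apply, Matrix.conjTranspose_apply, star_trivial,
      mul_comm]
  have hpos : (L * gram K x x * Lᴴ).PosSemidef := (hK.posSemidef x).mul_mul_conjTranspose_same L
  have htrace_one : (L * gram K x x * Lᴴ).trace = Fintype.card ι := by
    rw [Matrix.trace_mul_comm, ← Matrix.mul_assoc, ← hL,
      Matrix.nonsing_inv_mul _ hx.det_pos.ne'.isUnit, Matrix.trace_one]
  calc ∫⁻ R, ENNReal.ofReal (explained K x fun j => y j + R).trace
      = ∑ j, ∑ m, ∫⁻ R, ENNReal.ofReal ((∑ i, L m i * K (x i) (y j + R)) ^ 2) := by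
        have hmeas : ∀ j m, Measurable fun R =>
            ENNReal.ofReal ((∑ i, L m i * K (x i) (y j + R)) ^ 2) := fun j m =>
          ((hK.measurable_sum_mul_add (L m) (y j)).pow_const 2).ennreal_ofReal
        simp only [htrace, ENNReal.ofReal_sum_of_nonneg fun _ _ => Finset.sum_nonneg fun _ _ =>
          sq_nonneg _, ENNReal.ofReal_sum_of_nonneg fun _ _ => sq_nonneg _]
        rw [lintegral_finsetSum _ fun j _ => Finset.measurable_sum _ fun m _ => hmeas j m]
        exact Finset.sum_congr rfl fun j _ => lintegral_finsetSum _ fun m _ => hmeas j m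
    _ ≤ ∑ _j : κ, ∑ m, ENNReal.ofReal ((L * gram K x x * Lᴴ) m m) := by
        refine Finset.sum_le_sum fun j _ => Finset.sum_le_sum fun m _ => ?_
        rw [lintegral_add_left_eq_self
          (fun z => ENNReal.ofReal ((∑ i, L m i * K (x i) z) ^ 2)) (y j), ← hrow]
        exact hK.contraction x (L m)
    _ = Fintype.card κ * Fintype.card ι := by
        rw [← ENNReal.ofReal_sum_of_nonneg fun m _ => hpos.diag_nonneg]
        change ∑ _j : κ, ENNReal.ofReal (L * gram K x x * Lᴴ).trace = _
        rw [htrace_one]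
        simp

variable [DecidableEq κ]

lemma abs_det_gram_sumElim_le (hK : IsContractionKernel K) (hx : (gram K x x).PosDef) :
    |(gram K (Sum.elim x y) (Sum.elim x y)).det| ≤
      (Fintype.card κ).factorial * K 0 0 ^ Fintype.card κ * (gram K x x).det := by
  rw [hK.gram_sumElim]
  refine abs_det_fromBlocks_le hx ?_ fun k => (hK.self_eq (y k)).le
  rw [← hK.gram_sumElim]
  exact hK.posSemidef _

lemma abs_det_mul_det_sub_det_gram_sumElim_le (hK : IsContractionKernel K)
    (hx : (gram K x x).PosDef) :
    |(gram K x x).det * (gram K y y).det - (gram K (Sum.elim x y) (Sum.elim x y)).det| ≤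
      (Fintype.card κ).factorial * (Fintype.card κ * (K 0 0 + 1) ^ Fintype.card κ) *
        (gram K x x).det * (explained K x y).trace := by
  rw [hK.gram_sumElim]
  refine abs_det_mul_det_sub_det_fromBlocks_le hx ?_ (by linarith [hK.zero_zero_nonneg])
    fun i j => (hK.abs_le _ _).trans (by linarith)
  rw [← hK.gram_sumElim]
  exact hK.posSemidef _

lemma lintegral_det_mul_det_sub_det_le (hK : IsContractionKernel K) (hx : (gram K x x).PosDef) :
    ∫⁻ R, ‖(gram K x x).det * (gram K y y).det -
        (gram K (Sum.elim x fun j => y j + R) (Sum.elim x fun j => y j + R)).det‖ₑ ≤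
      ENNReal.ofReal ((Fintype.card κ).factorial *
        (Fintype.card κ * (K 0 0 + 1) ^ Fintype.card κ) *
        (Fintype.card κ * Fintype.card ι) * (gram K x x).det) := by
  set c : ℝ := (Fintype.card κ).factorial * (Fintype.card κ * (K 0 0 + 1) ^ Fintype.card κ) *
    (gram K x x).det
  have hc : 0 ≤ c := by
    have := hK.zero_zero_nonneg
    have := hx.det_pos
    positivity
  calc ∫⁻ R, ‖(gram K x x).det * (gram K y y).det -
        (gram K (Sum.elim x fun j => y j + R) (Sum.elim x fun j => y j + R)).det‖ₑ
      ≤ ∫⁻ R, ENNReal.ofReal c * ENNReal.ofReal (explained K x fun j => y j + R).trace := by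
        refine lintegral_mono fun R => ?_
        rw [← ENNReal.ofReal_mul hc, ← ofReal_norm, Real.norm_eq_abs, ← hK.gram_add y y R]
        exact ENNReal.ofReal_le_ofReal (hK.abs_det_mul_det_sub_det_gram_sumElim_le hx)
    _ = ENNReal.ofReal c * ∫⁻ R, ENNReal.ofReal (explained K x fun j => y j + R).trace :=
        lintegral_const_mul' _ _ ENNReal.ofReal_ne_top
    _ ≤ ENNReal.ofReal c * (Fintype.card κ * Fintype.card ι) := by
        gcongr
        exact hK.lintegral_trace_explained_le hx
    _ = ENNReal.ofReal (c * (Fintype.card κ * Fintype.card ι)) := by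
        rw [ENNReal.ofReal_mul (p := c) hc, ENNReal.ofReal_mul (Nat.cast_nonneg _),
          ENNReal.ofReal_natCast, ENNReal.ofReal_natCast]
    _ = _ := congrArg _ (mul_right_comm _ _ _)

end IsContractionKernel

/-! ### Integrability of the overlap integrands -/

lemma det_gram_eq_zero_of_not_injective {E ι : Type*} [Fintype ι] [DecidableEq ι]
    (K : E → E → ℝ) {x : ι → E} (hx : ¬ Function.Injective x) : (gram K x x).det = 0 := by
  simp only [Function.Injective, not_forall] at hx
  obtain ⟨i, j, hij, hne⟩ := hx
  exact Matrix.det_zero_of_row_eq hne (by ext k; simp [gram, hij])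

lemma norm_sub_le_of_mem_nearTuples {d s : ℕ} {r : ℝ} {x : Fin s → Sp d}
    (hx : x ∈ nearTuples d s r) (i j : Fin s) : ‖x i - x j‖ ≤ 2 * r := by
  have hs : 0 < s := Nat.zero_lt_of_lt i.2
  calc ‖x i - x j‖ ≤ ‖x i - x ⟨0, hs⟩‖ + ‖x ⟨0, hs⟩ - x j‖ := norm_sub_le_norm_sub_add_norm_sub ..
    _ = ‖x ⟨0, hs⟩ - x i‖ + ‖x ⟨0, hs⟩ - x j‖ := by rw [norm_sub_rev]
    _ ≤ 2 * r := by linarith [hx ⟨0, hs⟩ i rfl, hx ⟨0, hs⟩ j rfl]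

lemma volume_setOf_norm_sub_le_lt_top {d l : ℕ} (k : Fin l) (ρ : ℝ) :
    volume {z : Fin l → Sp d | z k ∈ Metric.ball 0 1 ∧ ∀ j, ‖z k - z j‖ ≤ ρ} < ∞ := by
  refine (measure_mono (t := Set.univ.pi fun _ => Metric.closedBall (0 : Sp d) (1 + ρ)) ?_).trans_lt
    (Bornology.IsBounded.pi fun _ => Metric.isBounded_closedBall).measure_lt_top
  rintro z ⟨hk, hz⟩ j -
  rw [mem_closedBall_zero_iff]
  rw [mem_ball_zero_iff] at hk
  calc ‖z j‖ = ‖z k - (z k - z j)‖ := by rw [sub_sub_cancel]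
    _ ≤ ‖z k‖ + ‖z k - z j‖ := norm_sub_le _ _
    _ ≤ 1 + ρ := add_le_add hk.le (hz j)

lemma volume_setOf_anchored_mem_nearTuples_lt_top {d l : ℕ} (hl : 1 ≤ l) (r : ℝ) :
    volume {u : Fin (l - 1) → Sp d | anchored u ∈ nearTuples d l r} < ∞ := by
  refine (measure_mono (t := Set.univ.pi fun _ => Metric.closedBall (0 : Sp d) r) ?_).trans_lt
    (Bornology.IsBounded.pi fun _ => Metric.isBounded_closedBall).measure_lt_top
  intro u hu j _
  simpa [anchored] using hu ⟨0, hl⟩ ⟨j + 1, by omega⟩ rfl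

/-- The defect `ρ(x) ρ(y) - ρ(x, y)` of the factorization of the determinants of `K` over two
groups of points. -/
def factorizationDefect {E ι κ : Type*} [Fintype ι] [Fintype κ] [DecidableEq ι] [DecidableEq κ]
    (K : E → E → ℝ) (x : ι → E) (y : κ → E) : ℝ :=
  (gram K x x).det * (gram K y y).det - (gram K (Sum.elim x y) (Sum.elim x y)).det

section FactorizationDefect
variable {E ι κ : Type*} [Fintype ι] [Fintype κ] [DecidableEq ι] [DecidableEq κ]

lemma factorizationDefect_comm (K : E → E → ℝ) (x : ι → E) (y : κ → E) :
    factorizationDefect K x y = factorizationDefect K y x := by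
  have hdet : gram K (Sum.elim x y) (Sum.elim x y) =
      (gram K (Sum.elim y x) (Sum.elim y x)).submatrix (Equiv.sumComm ι κ) (Equiv.sumComm ι κ) := by
    ext i j
    rcases i with i | i <;> rcases j with j | j <;> rfl
  rw [factorizationDefect, factorizationDefect, hdet, Matrix.det_submatrix_equiv_self, mul_comm]

lemma factorizationDefect_eq_zero_of_not_injective (K : E → E → ℝ) {x : ι → E}
    (hx : ¬ Function.Injective x) (y : κ → E) : factorizationDefect K x y = 0 := by
  have hxy : ¬ Function.Injective (Sum.elim x y) := fun h => hx (h.comp Sum.inl_injective)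
  rw [factorizationDefect, det_gram_eq_zero_of_not_injective K hx,
    det_gram_eq_zero_of_not_injective K hxy, zero_mul, sub_zero]

end FactorizationDefect

namespace IsContractionKernel
variable {d : ℕ} {K : Sp d → Sp d → ℝ}

lemma jointIntensity_nonneg (hK : IsContractionKernel K) {l : ℕ} (z : Fin l → Sp d) :
    0 ≤ jointIntensity K z :=
  (hK.posSemidef z).det_nonneg

lemma jointIntensity_pos (hK : IsContractionKernel K) {l : ℕ} {z : Fin l → Sp d}
    (hz : Function.Injective z) : 0 < jointIntensity K z :=
  (hK.posDef z hz).det_pos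

lemma continuous_det_gram (hK : IsContractionKernel K) {ι : Type*} [Fintype ι] [DecidableEq ι] :
    Continuous fun z : ι → Sp d => (gram K z z).det :=
  Continuous.matrix_det <| continuous_matrix fun i j =>
    hK.continuous.comp (f := fun z : ι → Sp d => (z i, z j)) (by fun_prop)

lemma measurable_jointIntensity (hK : IsContractionKernel K) {l : ℕ} :
    Measurable fun z : Fin l → Sp d => jointIntensity K z :=
  hK.continuous_det_gram.measurable

lemma exists_abs_jointIntensity_le (hK : IsContractionKernel K) (l : ℕ) :
    ∃ c, ∀ z : Fin l → Sp d, |jointIntensity K z| ≤ c :=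
  ⟨_, fun z => abs_det_le (kernelMatrix K z) fun i j => hK.abs_le (z i) (z j)⟩

lemma translationInvariant_jointIntensity (hK : IsContractionKernel K) {l : ℕ} :
    TranslationInvariant fun z : Fin l → Sp d => jointIntensity K z :=
  fun c z => congrArg Matrix.det (hK.gram_add z z c)

lemma exists_jointIntensity_le_mul_comp (hK : IsContractionKernel K) {s l : ℕ}
    (a : Fin s ↪ Fin l) :
    ∃ c, 0 ≤ c ∧ ∀ z : Fin l → Sp d, jointIntensity K z ≤ c * jointIntensity K (z ∘ a) := by
  classical
  let κ := {k : Fin l // ¬ k ∈ Set.range a}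
  have h0 := hK.zero_zero_nonneg
  refine ⟨(Fintype.card κ).factorial * K 0 0 ^ Fintype.card κ, by positivity, fun z => ?_⟩
  by_cases hz : Function.Injective (z ∘ a)
  swap
  · have hz' : ¬ Function.Injective z := fun h => hz (h.comp a.injective)
    rw [show jointIntensity K z = 0 from det_gram_eq_zero_of_not_injective K hz',
      show jointIntensity K (z ∘ a) = 0 from det_gram_eq_zero_of_not_injective K hz, mul_zero]
  let e : Fin s ⊕ κ ≃ Fin l :=
    ((Equiv.ofInjective a a.injective).sumCongr (Equiv.refl _)).trans
      (Equiv.sumCompl fun k => k ∈ Set.range a)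
  have hgram : gram K (Sum.elim (z ∘ a) fun k : κ => z k) (Sum.elim (z ∘ a) fun k : κ => z k) =
      (gram K z z).submatrix e e := by
    ext i j
    rcases i with i | i <;> rcases j with j | j <;> rfl
  have hdet := hK.abs_det_gram_sumElim_le (y := fun k : κ => z k) (hK.posDef (z ∘ a) hz)
  rw [hgram, Matrix.det_submatrix_equiv_self] at hdet
  exact (le_abs_self _).trans hdet

lemma continuous_factorizationDefect (hK : IsContractionKernel K) {ι κ : Type*} [Fintype ι]
    [Fintype κ] [DecidableEq ι] [DecidableEq κ] :
    Continuous fun q : (ι → Sp d) × (κ → Sp d) => factorizationDefect K q.1 q.2 := by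
  have hsum : Continuous fun q : (ι → Sp d) × (κ → Sp d) => (Sum.elim q.1 q.2 : ι ⊕ κ → Sp d) :=
    continuous_pi fun i => by rcases i with i | i <;> simp only [Sum.elim_inl, Sum.elim_inr] <;>
      fun_prop
  exact ((hK.continuous_det_gram.comp continuous_fst).mul
    (hK.continuous_det_gram.comp continuous_snd)).sub (hK.continuous_det_gram.comp hsum)

lemma factorizationDefect_add (hK : IsContractionKernel K) {ι κ : Type} [Fintype ι] [Fintype κ]
    [DecidableEq ι] [DecidableEq κ] (x : ι → Sp d) (y : κ → Sp d) (c : Sp d) :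
    factorizationDefect K (fun i => x i + c) (fun j => y j + c) = factorizationDefect K x y := by
  have hsum : Sum.elim (fun i => x i + c) (fun j => y j + c) = fun i => Sum.elim x y i + c := by
    ext1 i
    rcases i with i | i <;> rfl
  rw [factorizationDefect, factorizationDefect, hsum, hK.gram_add, hK.gram_add, hK.gram_add]

lemma lintegral_enorm_factorizationDefect_comm (hK : IsContractionKernel K) {ι κ : Type}
    [Fintype ι] [Fintype κ] [DecidableEq ι] [DecidableEq κ] (x : ι → Sp d) (y : κ → Sp d) :
    ∫⁻ R, ‖factorizationDefect K x fun j => y j + R‖ₑ =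
      ∫⁻ R, ‖factorizationDefect K y fun i => x i + R‖ₑ := by
  rw [← lintegral_neg_eq_self]
  refine lintegral_congr fun R => ?_
  rw [← hK.factorizationDefect_add _ _ R, factorizationDefect_comm]
  simp only [neg_add_cancel_right]

/-- The integral is bounded both in terms of `ρ(x)` and in terms of `ρ(y)`, hence by the geometric
mean of the two bounds. -/
lemma exists_lintegral_enorm_factorizationDefect_le (hK : IsContractionKernel K) (s t : ℕ) :
    ∃ c, 0 ≤ c ∧ ∀ (x : Fin s → Sp d) (y : Fin t → Sp d),
      ∫⁻ R, ‖factorizationDefect K x fun j => y j + R‖ₑ ≤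
        ENNReal.ofReal (c * (√(jointIntensity K x) * √(jointIntensity K y))) := by
  have h0 := hK.zero_zero_nonneg
  have hbound : ∀ m n : ℕ, ∃ c, 0 ≤ c ∧ ∀ (x : Fin m → Sp d) (y : Fin n → Sp d),
      ∫⁻ R, ‖factorizationDefect K x fun j => y j + R‖ₑ ≤
        ENNReal.ofReal (c * jointIntensity K x) := fun m n => by
    refine ⟨(Fintype.card (Fin n)).factorial *
      (Fintype.card (Fin n) * (K 0 0 + 1) ^ Fintype.card (Fin n)) *
        (Fintype.card (Fin n) * Fintype.card (Fin m)), by positivity, fun x y => ?_⟩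
    by_cases hx : Function.Injective x
    · refine (le_of_eq ?_).trans (hK.lintegral_det_mul_det_sub_det_le (y := y) (hK.posDef x hx))
      simp only [factorizationDefect, hK.gram_add]
    · simp [factorizationDefect_eq_zero_of_not_injective K hx]
  obtain ⟨c₁, hc₁, hx⟩ := hbound s t
  obtain ⟨c₂, hc₂, hy⟩ := hbound t s
  refine ⟨√c₁ * √c₂, by positivity, fun x y => ?_⟩
  have hp : 0 ≤ c₁ * jointIntensity K x := mul_nonneg hc₁ (hK.jointIntensity_nonneg x)
  have hq : 0 ≤ c₂ * jointIntensity K y := mul_nonneg hc₂ (hK.jointIntensity_nonneg y)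
  calc ∫⁻ R, ‖factorizationDefect K x fun j => y j + R‖ₑ
      ≤ min (ENNReal.ofReal (c₁ * jointIntensity K x)) (ENNReal.ofReal (c₂ * jointIntensity K y)) :=
        le_min (hx x y) ((hK.lintegral_enorm_factorizationDefect_comm x y).trans_le (hy y x))
    _ = ENNReal.ofReal (min (c₁ * jointIntensity K x) (c₂ * jointIntensity K y)) :=
        (ENNReal.ofReal_min _ _).symm
    _ ≤ ENNReal.ofReal (√(c₁ * jointIntensity K x * (c₂ * jointIntensity K y))) := by
        refine ENNReal.ofReal_le_ofReal (Real.le_sqrt_of_sq_le ?_)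
        rw [sq]
        exact mul_le_mul (min_le_left _ _) (min_le_right _ _) (le_min hp hq) hp
    _ = _ := by
        rw [Real.sqrt_mul hp, Real.sqrt_mul hc₁, Real.sqrt_mul hc₂]
        ring_nf

end IsContractionKernel

/-- A translation invariant statistic of `s`-tuples of nearby points, of size `O(ρ^{-1/2})`. The
bound says nothing at tuples with repeated points, where the joint intensity `ρ` vanishes. -/
structure IsLocalStat {d s : ℕ} (K : Sp d → Sp d → ℝ) (r : ℝ) (f : (Fin s → Sp d) → ℝ) :
    Prop where
  measurable : Measurable f
  translationInvariant : TranslationInvariant f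
  eq_zero : ∀ x, x ∉ nearTuples d s r → f x = 0
  bound : ∃ c, ∀ x, |f x| * √(jointIntensity K x) ≤ c

/-- The translation invariant function of `l` points behind `overlapIntegrand`: the latter is its
composition with `anchored`. -/
def overlapFun {d s t l : ℕ} (K : Sp d → Sp d → ℝ) (f : (Fin s → Sp d) → ℝ)
    (g : (Fin t → Sp d) → ℝ) (ab : (Fin s ↪ Fin l) × (Fin t ↪ Fin l)) (z : Fin l → Sp d) : ℝ :=
  f (z ∘ ab.1) * g (z ∘ ab.2) *
    (jointIntensity K z -
      if l = s + t then jointIntensity K (z ∘ ab.1) * jointIntensity K (z ∘ ab.2) else 0)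

section Overlap
variable {d s t l : ℕ} {K : Sp d → Sp d → ℝ} {r : ℝ} {f : (Fin s → Sp d) → ℝ}
  {g : (Fin t → Sp d) → ℝ} {ab : (Fin s ↪ Fin l) × (Fin t ↪ Fin l)}

lemma measurable_comp_index {E ι κ : Type*} [MeasurableSpace E] (a : κ → ι) :
    Measurable fun z : ι → E => z ∘ a :=
  measurable_pi_lambda _ fun i => measurable_pi_apply (a i)

lemma measurable_overlapFun (hK : IsContractionKernel K) (hf : Measurable f) (hg : Measurable g) :
    Measurable (overlapFun K f g ab) := by
  refine ((hf.comp (measurable_comp_index _)).mul (hg.comp (measurable_comp_index _))).mul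
    (hK.measurable_jointIntensity.sub ?_)
  split_ifs
  · exact (hK.measurable_jointIntensity.comp (measurable_comp_index _)).mul
      (hK.measurable_jointIntensity.comp (measurable_comp_index _))
  · exact measurable_const

lemma translationInvariant_overlapFun (hK : IsContractionKernel K) (hf : TranslationInvariant f)
    (hg : TranslationInvariant g) : TranslationInvariant (overlapFun K f g ab) := by
  intro c z
  have hcomp : ∀ {m : ℕ} (a : Fin m ↪ Fin l),
      (fun i => z i + c) ∘ a = fun i => (z ∘ a) i + c := fun a => rfl
  have hρ : ∀ {m : ℕ} (x : Fin m → Sp d),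
      jointIntensity K (fun i => x i + c) = jointIntensity K x :=
    fun x => hK.translationInvariant_jointIntensity c x
  simp only [overlapFun, hcomp, hf c, hg c, hρ]

/-- The factor `ρ(z) = √ρ(z) √ρ(z)` is shared between `f` and `g`, whose own joint intensities
dominate `ρ(z)`. -/
lemma IsLocalStat.exists_abs_mul_jointIntensity_le (hK : IsContractionKernel K)
    (hf : IsLocalStat K r f) (hg : IsLocalStat K r g) (a : Fin s ↪ Fin l) (b : Fin t ↪ Fin l) :
    ∃ c, ∀ z : Fin l → Sp d, |f (z ∘ a) * g (z ∘ b) * jointIntensity K z| ≤ c := by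
  have hshare : ∀ {m : ℕ} {h : (Fin m → Sp d) → ℝ} (_ : IsLocalStat K r h) (a : Fin m ↪ Fin l),
      ∃ c, ∀ z : Fin l → Sp d, |h (z ∘ a)| * √(jointIntensity K z) ≤ c := fun {m h} hh a => by
    obtain ⟨c, hc⟩ := hh.bound
    obtain ⟨c', hc'0, hc'⟩ := hK.exists_jointIntensity_le_mul_comp a
    refine ⟨√c' * c, fun z => ?_⟩
    calc |h (z ∘ a)| * √(jointIntensity K z)
        ≤ |h (z ∘ a)| * √(c' * jointIntensity K (z ∘ a)) := by gcongr; exact hc' z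
      _ = √c' * (|h (z ∘ a)| * √(jointIntensity K (z ∘ a))) := by
          rw [Real.sqrt_mul hc'0]; ring
      _ ≤ √c' * c := by gcongr; exact hc _
  obtain ⟨cf, hcf⟩ := hshare hf a
  obtain ⟨cg, hcg⟩ := hshare hg b
  refine ⟨cf * cg, fun z => ?_⟩
  calc |f (z ∘ a) * g (z ∘ b) * jointIntensity K z|
      = (|f (z ∘ a)| * √(jointIntensity K z)) * (|g (z ∘ b)| * √(jointIntensity K z)) := by
        have hρ := hK.jointIntensity_nonneg z
        rw [abs_mul, abs_mul, abs_of_nonneg hρ, mul_mul_mul_comm, Real.mul_self_sqrt hρ]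
    _ ≤ cf * cg := mul_le_mul (hcf z) (hcg z) (by positivity) ((by positivity : (0 : ℝ) ≤
        |f (z ∘ a)| * √(jointIntensity K z)).trans (hcf z))

lemma exists_mem_range_inter_of_lt (a : Fin s ↪ Fin l) (b : Fin t ↪ Fin l) (hlt : l < s + t) :
    ∃ i j, a i = b j := by
  by_contra! h
  have := Fintype.card_le_of_injective _ (a.injective.sumElim b.injective h)
  simp only [Fintype.card_sum, Fintype.card_fin] at this
  omega

lemma norm_sub_le_of_comp_mem_nearTuples (hab : ab ∈ overlaps s t l) {i : Fin s} {j : Fin t}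
    (hij : ab.1 i = ab.2 j) {z : Fin l → Sp d} (ha : z ∘ ab.1 ∈ nearTuples d s r)
    (hb : z ∘ ab.2 ∈ nearTuples d t r) (k : Fin l) : ‖z (ab.1 i) - z k‖ ≤ 2 * r := by
  rcases hab k with ⟨i', rfl⟩ | ⟨j', rfl⟩
  · exact norm_sub_le_of_mem_nearTuples ha i i'
  · rw [hij]; exact norm_sub_le_of_mem_nearTuples hb j j'

lemma integrable_overlapFun_anchored_of_lt (hK : IsContractionKernel K)
    (hf : IsLocalStat K r f) (hg : IsLocalStat K r g) (hab : ab ∈ overlaps s t l)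
    (hlt : l < s + t) :
    Integrable fun u : Fin (l - 1) → Sp d => overlapFun K f g ab (anchored u) := by
  obtain ⟨c, hc⟩ := hf.exists_abs_mul_jointIntensity_le hK hg ab.1 ab.2
  obtain ⟨i, j, hij⟩ := exists_mem_range_inter_of_lt ab.1 ab.2 hlt
  refine integrable_comp_anchored (ab.1 i) (measurable_overlapFun hK hf.measurable hg.measurable)
    (translationInvariant_overlapFun hK hf.translationInvariant hg.translationInvariant)
    (ne_of_lt ?_)
  let S : Set (Fin l → Sp d) :=
    {z | z (ab.1 i) ∈ Metric.ball 0 1 ∧ ∀ k, ‖z (ab.1 i) - z k‖ ≤ 2 * r}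
  have hle : ∀ z, (Metric.ball (0 : Sp d) 1).indicator 1 (z (ab.1 i)) * ‖overlapFun K f g ab z‖ₑ ≤
      S.indicator (fun _ => ENNReal.ofReal c) z := fun z => by
    by_cases hz : z (ab.1 i) ∈ Metric.ball (0 : Sp d) 1
    swap; · simp [Set.indicator_of_notMem hz]
    by_cases ha : z ∘ ab.1 ∈ nearTuples d s r
    swap; · simp [overlapFun, hf.eq_zero _ ha]
    by_cases hb : z ∘ ab.2 ∈ nearTuples d t r
    swap; · simp [overlapFun, hg.eq_zero _ hb]
    have hzS : z ∈ S := ⟨hz, norm_sub_le_of_comp_mem_nearTuples hab hij ha hb⟩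
    rw [Set.indicator_of_mem hz, Set.indicator_of_mem hzS, Pi.one_apply, one_mul, ← ofReal_norm,
      overlapFun, if_neg hlt.ne, sub_zero, Real.norm_eq_abs]
    exact ENNReal.ofReal_le_ofReal (hc z)
  calc ∫⁻ z, (Metric.ball (0 : Sp d) 1).indicator 1 (z (ab.1 i)) * ‖overlapFun K f g ab z‖ₑ
      ≤ ∫⁻ z, S.indicator (fun _ => ENNReal.ofReal c) z := lintegral_mono hle
    _ ≤ ENNReal.ofReal c * volume S := lintegral_indicator_const_le _ _
    _ < ∞ := ENNReal.mul_lt_top ENNReal.ofReal_lt_top (volume_setOf_norm_sub_le_lt_top _ _)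

lemma measurePreserving_sumElim_comp_symm {E ι κ ι' : Type*} [MeasureSpace E]
    [SigmaFinite (volume : Measure E)] [Fintype ι] [Fintype κ] [Fintype ι'] (e : ι ⊕ κ ≃ ι') :
    MeasurePreserving fun q : (ι → E) × (κ → E) => Sum.elim q.1 q.2 ∘ e.symm := by
  have hcomp : (fun q : (ι → E) × (κ → E) => Sum.elim q.1 q.2 ∘ e.symm) =
      MeasurableEquiv.piCongrLeft (fun _ : ι' => E) e ∘
        (MeasurableEquiv.sumPiEquivProdPi (fun _ : ι ⊕ κ => E)).symm := by
    funext q k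
    obtain ⟨i, rfl⟩ := e.surjective k
    simp only [Function.comp_apply, Equiv.symm_apply_apply]
    rw [MeasurableEquiv.coe_piCongrLeft, Equiv.piCongrLeft_apply_apply]
    rcases i with i | i <;> rfl
  rw [hcomp]
  exact (volume_measurePreserving_piCongrLeft (fun _ : ι' => E) e).comp
    (volume_measurePreserving_sumPiEquivProdPi_symm fun _ : ι ⊕ κ => E)

lemma exists_equiv_of_mem_overlaps (hab : ab ∈ overlaps s t l) (hl : l = s + t) :
    ∃ e : Fin s ⊕ Fin t ≃ Fin l, (∀ i, e (Sum.inl i) = ab.1 i) ∧ ∀ j, e (Sum.inr j) = ab.2 j := by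
  have hsurj : Function.Surjective (Sum.elim ab.1 ab.2) := fun k => by
    rcases hab k with ⟨i, hi⟩ | ⟨i, hi⟩
    exacts [⟨Sum.inl i, hi⟩, ⟨Sum.inr i, hi⟩]
  exact ⟨Equiv.ofBijective _ ((Fintype.bijective_iff_surjective_and_card _).2
    ⟨hsurj, by simp [hl]⟩), fun _ => rfl, fun _ => rfl⟩

lemma enorm_overlapFun_sumElim (hl : l = s + t) {e : Fin s ⊕ Fin t ≃ Fin l}
    (he₁ : ∀ i, e (Sum.inl i) = ab.1 i) (he₂ : ∀ j, e (Sum.inr j) = ab.2 j)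
    (x : Fin s → Sp d) (y : Fin t → Sp d) :
    ‖overlapFun K f g ab (Sum.elim x y ∘ e.symm)‖ₑ =
      ‖f x‖ₑ * (‖g y‖ₑ * ‖factorizationDefect K x y‖ₑ) := by
  have hx : (Sum.elim x y ∘ e.symm) ∘ ab.1 = x := by funext i; simp [← he₁]
  have hy : (Sum.elim x y ∘ e.symm) ∘ ab.2 = y := by funext j; simp [← he₂]
  have hdet : jointIntensity K (Sum.elim x y ∘ e.symm) =
      (gram K (Sum.elim x y) (Sum.elim x y)).det :=
    Matrix.det_submatrix_equiv_self e.symm (gram K (Sum.elim x y) (Sum.elim x y))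
  rw [overlapFun, hx, hy, if_pos hl, hdet, enorm_mul, enorm_mul, mul_assoc, ← enorm_neg (_ - _),
    neg_sub]
  rfl

lemma IsLocalStat.exists_lintegral_mul_factorizationDefect_le (ht : 1 ≤ t)
    (hK : IsContractionKernel K) (hg : IsLocalStat K r g) (s : ℕ) :
    ∃ c < ∞, ∀ x : Fin s → Sp d, ∫⁻ y, ‖g y‖ₑ * ‖factorizationDefect K x y‖ₑ ≤
      ENNReal.ofReal (√(jointIntensity K x)) * c := by
  obtain ⟨cg, hcg⟩ := hg.bound
  obtain ⟨c, hc0, hc⟩ := hK.exists_lintegral_enorm_factorizationDefect_le (d := d) s t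
  let S : Set (Fin (t - 1) → Sp d) := {u | anchored u ∈ nearTuples d t r}
  refine ⟨ENNReal.ofReal (c * cg) * volume S, ENNReal.mul_lt_top ENNReal.ofReal_lt_top
    (volume_setOf_anchored_mem_nearTuples_lt_top ht r), fun x => ?_⟩
  have hm : Measurable fun y => ‖g y‖ₑ * ‖factorizationDefect K x y‖ₑ :=
    hg.measurable.enorm.mul
      (hK.continuous_factorizationDefect.measurable.comp measurable_prodMk_left).enorm
  have hle : ∀ u : Fin (t - 1) → Sp d, ∫⁻ R, ‖g fun i => anchored u i + R‖ₑ *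
        ‖factorizationDefect K x fun i : Fin t => anchored u i + R‖ₑ ≤
      S.indicator (fun _ => ENNReal.ofReal (√(jointIntensity K x) * (c * cg))) u := fun u => by
    simp only [hg.translationInvariant _ (anchored u)]
    rw [lintegral_const_mul' _ _ enorm_ne_top]
    by_cases hu : u ∈ S
    swap; · simp [hg.eq_zero _ hu]
    rw [Set.indicator_of_mem hu]
    calc ‖g (anchored u)‖ₑ * ∫⁻ R, ‖factorizationDefect K x fun i : Fin t => anchored u i + R‖ₑ
        ≤ ‖g (anchored u)‖ₑ * ENNReal.ofReal (c * (√(jointIntensity K x) *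
            √(jointIntensity K (anchored (l := t) u)))) := by gcongr; exact hc x (anchored u)
      _ = ENNReal.ofReal (√(jointIntensity K x) * (c *
            (|g (anchored u)| * √(jointIntensity K (anchored (l := t) u))))) := by
          rw [← ofReal_norm, ← ENNReal.ofReal_mul (norm_nonneg _), Real.norm_eq_abs]
          ring_nf
      _ ≤ ENNReal.ofReal (√(jointIntensity K x) * (c * cg)) := by gcongr; exact hcg _
  have hswap := lintegral_lintegral_swap (μ := volume) (ν := volume)
    (f := fun R (u : Fin (t - 1) → Sp d) =>
      ‖g fun i => anchored u i + R‖ₑ * ‖factorizationDefect K x fun i => anchored u i + R‖ₑ)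
    (hm.comp (measurePreserving_anchored_add ht).measurable).aemeasurable
  rw [lintegral_eq_lintegral_anchored_add ht hm, hswap, ← mul_assoc,
    ← ENNReal.ofReal_mul (Real.sqrt_nonneg _)]
  exact (lintegral_mono hle).trans (lintegral_indicator_const_le _ _)

lemma IsLocalStat.lintegral_indicator_mul_enorm_lt_top (hf : IsLocalStat K r f) (k : Fin s) :
    ∫⁻ x, (Metric.ball (0 : Sp d) 1).indicator 1 (x k) *
      (‖f x‖ₑ * ENNReal.ofReal (√(jointIntensity K x))) < ∞ := by
  obtain ⟨c, hc⟩ := hf.bound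
  let S : Set (Fin s → Sp d) := {x | x k ∈ Metric.ball 0 1 ∧ ∀ j, ‖x k - x j‖ ≤ 2 * r}
  have hle : ∀ x, (Metric.ball (0 : Sp d) 1).indicator 1 (x k) *
      (‖f x‖ₑ * ENNReal.ofReal (√(jointIntensity K x))) ≤
        S.indicator (fun _ => ENNReal.ofReal c) x := fun x => by
    by_cases hxk : x k ∈ Metric.ball (0 : Sp d) 1
    swap; · simp [Set.indicator_of_notMem hxk]
    by_cases hx : x ∈ nearTuples d s r
    swap; · simp [hf.eq_zero _ hx]
    have hxS : x ∈ S := ⟨hxk, norm_sub_le_of_mem_nearTuples hx k⟩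
    rw [Set.indicator_of_mem hxS, Set.indicator_of_mem hxk, Pi.one_apply, one_mul, ← ofReal_norm,
      ← ENNReal.ofReal_mul (norm_nonneg _), Real.norm_eq_abs]
    exact ENNReal.ofReal_le_ofReal (hc x)
  calc _ ≤ ∫⁻ x, S.indicator (fun _ => ENNReal.ofReal c) x := lintegral_mono hle
    _ ≤ ENNReal.ofReal c * volume S := lintegral_indicator_const_le _ _
    _ < ∞ := ENNReal.mul_lt_top ENNReal.ofReal_lt_top (volume_setOf_norm_sub_le_lt_top k _)

lemma integrable_overlapFun_anchored_of_eq (hs : 1 ≤ s) (ht : 1 ≤ t)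
    (hK : IsContractionKernel K) (hf : IsLocalStat K r f) (hg : IsLocalStat K r g)
    (hab : ab ∈ overlaps s t l) (hl : l = s + t) :
    Integrable fun u : Fin (l - 1) → Sp d => overlapFun K f g ab (anchored u) := by
  obtain ⟨e, he₁, he₂⟩ := exists_equiv_of_mem_overlaps hab hl
  obtain ⟨c, hctop, hc⟩ := hg.exists_lintegral_mul_factorizationDefect_le ht hK s
  have hm := measurable_overlapFun (ab := ab) hK hf.measurable hg.measurable
  have hmp := measurePreserving_sumElim_comp_symm (E := Sp d) e
  let k : Fin s := ⟨0, hs⟩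
  refine integrable_comp_anchored (ab.1 k) hm
    (translationInvariant_overlapFun hK hf.translationInvariant hg.translationInvariant)
    (ne_of_lt ?_)
  have hball : Measurable fun z : Fin l → Sp d =>
      (Metric.ball (0 : Sp d) 1).indicator (1 : Sp d → ℝ≥0∞) (z (ab.1 k)) *
        ‖overlapFun K f g ab z‖ₑ :=
    ((measurable_one.indicator Metric.isOpen_ball.measurableSet).comp
      (measurable_pi_apply _)).mul hm.enorm
  have hk : ∀ (x : Fin s → Sp d) (y : Fin t → Sp d),
      (Sum.elim x y ∘ e.symm) (ab.1 k) = x k := fun x y => by simp [← he₁]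
  calc ∫⁻ z : Fin l → Sp d, (Metric.ball (0 : Sp d) 1).indicator 1 (z (ab.1 k)) *
        ‖overlapFun K f g ab z‖ₑ
      = ∫⁻ x : Fin s → Sp d, ∫⁻ y : Fin t → Sp d, (Metric.ball (0 : Sp d) 1).indicator 1 (x k) *
          (‖f x‖ₑ * (‖g y‖ₑ * ‖factorizationDefect K x y‖ₑ)) := by
        rw [← hmp.lintegral_comp hball, Measure.volume_eq_prod]
        refine (lintegral_prod _ (hball.comp hmp.measurable).aemeasurable).trans
          (lintegral_congr fun x => lintegral_congr fun y => ?_)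
        exact congrArg₂ (· * ·) (congrArg _ (hk x y)) (enorm_overlapFun_sumElim hl he₁ he₂ x y)
    _ ≤ ∫⁻ x : Fin s → Sp d, (Metric.ball (0 : Sp d) 1).indicator 1 (x k) *
          (‖f x‖ₑ * ENNReal.ofReal (√(jointIntensity K x))) * c := by
        refine lintegral_mono fun x => ?_
        have hne : (Metric.ball (0 : Sp d) 1).indicator (1 : Sp d → ℝ≥0∞) (x k) ≠ ∞ := by
          by_cases hxk : x k ∈ Metric.ball (0 : Sp d) 1 <;> simp [hxk]
        rw [lintegral_const_mul' _ _ hne, lintegral_const_mul' _ _ enorm_ne_top, mul_assoc,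
          mul_assoc]
        gcongr
        exact hc x
    _ = (∫⁻ x : Fin s → Sp d, (Metric.ball (0 : Sp d) 1).indicator 1 (x k) *
          (‖f x‖ₑ * ENNReal.ofReal (√(jointIntensity K x)))) * c :=
        lintegral_mul_const' _ _ hctop.ne
    _ < ∞ := ENNReal.mul_lt_top (hf.lintegral_indicator_mul_enorm_lt_top k) hctop

lemma integrable_overlapFun_anchored (hs : 1 ≤ s) (ht : 1 ≤ t)
    (hK : IsContractionKernel K) (hf : IsLocalStat K r f) (hg : IsLocalStat K r g)
    (hab : ab ∈ overlaps s t l) (hl : l ≤ s + t) :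
    Integrable fun u : Fin (l - 1) → Sp d => overlapFun K f g ab (anchored u) :=
  hl.lt_or_eq.elim (integrable_overlapFun_anchored_of_lt hK hf hg hab)
    (integrable_overlapFun_anchored_of_eq hs ht hK hf hg hab)

end Overlap

/-! ### Covariances of sums of local statistics -/

section Covariance
variable {d s t l : ℕ} {K : Sp d → Sp d → ℝ} {r : ℝ} {f : (Fin s → Sp d) → ℝ}
  {g : (Fin t → Sp d) → ℝ} {B : Set (Sp d)}

open Classical in
/-- The limit of the covariances of two sums of local statistics, relative to the volume of the
window. -/
def limitCov (K : Sp d → Sp d → ℝ) (f : (Fin s → Sp d) → ℝ) (g : (Fin t → Sp d) → ℝ) : ℝ :=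
  ∑ l ∈ Finset.Icc (max s t) (s + t), ((l.factorial : ℝ))⁻¹ *
    ∑ ab ∈ Finset.univ.filter (fun ab => ab ∈ overlaps s t l),
      ∫ u : Fin (l - 1) → Sp d, overlapIntegrand K f g ab u

lemma hasLimitCov_limitCov (hs : 1 ≤ s) (ht : 1 ≤ t) (hK : IsContractionKernel K)
    (hf : IsLocalStat K r f) (hg : IsLocalStat K r g) : HasLimitCov K f g (limitCov K f g) :=
  ⟨fun _ hl _ hab => integrable_overlapFun_anchored hs ht hK hf hg hab (Finset.mem_Icc.1 hl).2, rfl⟩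

lemma integrableOn_pi_of_abs_le (hBb : Bornology.IsBounded B) {F : (Fin l → Sp d) → ℝ}
    (hF : Measurable F) {c : ℝ} (hc : ∀ z, |F z| ≤ c) :
    IntegrableOn F (Set.univ.pi fun _ => B) :=
  IntegrableOn.of_bound (Bornology.IsBounded.pi fun _ => hBb).measure_lt_top
    hF.aestronglyMeasurable c (.of_forall hc)

lemma IsContractionKernel.integrableOn_jointIntensity (hK : IsContractionKernel K)
    (hBb : Bornology.IsBounded B) :
    IntegrableOn (fun z : Fin l → Sp d => jointIntensity K z) (Set.univ.pi fun _ => B) :=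
  have ⟨_, hc⟩ := hK.exists_abs_jointIntensity_le l
  integrableOn_pi_of_abs_le hBb hK.measurable_jointIntensity hc

lemma IsLocalStat.integrableOn_mul_jointIntensity (hK : IsContractionKernel K)
    (hf : IsLocalStat K r f) (hBb : Bornology.IsBounded B) :
    IntegrableOn (fun x => f x * jointIntensity K x) (Set.univ.pi fun _ => B) := by
  obtain ⟨c, hc⟩ := hf.bound
  obtain ⟨m, hm⟩ := hK.exists_abs_jointIntensity_le (d := d) s
  refine integrableOn_pi_of_abs_le hBb (hf.measurable.mul hK.measurable_jointIntensity)
    (c := c * √m) fun x => ?_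
  have hρ := hK.jointIntensity_nonneg x
  have hc0 : 0 ≤ c := (by positivity : 0 ≤ |f x| * √(jointIntensity K x)).trans (hc x)
  calc |f x * jointIntensity K x|
      = (|f x| * √(jointIntensity K x)) * √(jointIntensity K x) := by
        rw [abs_mul, abs_of_nonneg hρ, mul_assoc, Real.mul_self_sqrt hρ]
    _ ≤ c * √m := by
        gcongr
        · exact hc x
        · exact (le_abs_self _).trans (hm x)

lemma IsLocalStat.integrableOn_comp_mul_comp_mul_jointIntensity (hK : IsContractionKernel K)
    (hf : IsLocalStat K r f) (hg : IsLocalStat K r g) (hBb : Bornology.IsBounded B)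
    (a : Fin s ↪ Fin l) (b : Fin t ↪ Fin l) :
    IntegrableOn (fun z => f (z ∘ a) * g (z ∘ b) * jointIntensity K z)
      (Set.univ.pi fun _ => B) :=
  have ⟨_, hc⟩ := hf.exists_abs_mul_jointIntensity_le hK hg a b
  integrableOn_pi_of_abs_le hBb (((hf.measurable.comp (measurable_comp_index a)).mul
    (hg.measurable.comp (measurable_comp_index b))).mul hK.measurable_jointIntensity) hc

lemma measurePreserving_sumElim_comp_symm_restrict {E ι κ ι' : Type*} [MeasureSpace E]
    [SigmaFinite (volume : Measure E)] [Fintype ι] [Fintype κ] [Fintype ι'] (e : ι ⊕ κ ≃ ι')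
    {B : Set E} (hB : MeasurableSet B) :
    MeasurePreserving (fun q : (ι → E) × (κ → E) => Sum.elim q.1 q.2 ∘ e.symm)
      ((volume.restrict (Set.univ.pi fun _ => B)).prod (volume.restrict (Set.univ.pi fun _ => B)))
      (volume.restrict (Set.univ.pi fun _ => B)) := by
  have hpre : (fun q : (ι → E) × (κ → E) => Sum.elim q.1 q.2 ∘ e.symm) ⁻¹'
      (Set.univ.pi fun _ => B) = (Set.univ.pi fun _ => B) ×ˢ (Set.univ.pi fun _ => B) := by
    ext q
    simp only [Set.mem_preimage, Set.mem_prod, Set.mem_univ_pi, Function.comp_apply,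
      e.symm.forall_congr_left, Equiv.symm_symm, Equiv.symm_apply_apply, Sum.forall, Sum.elim_inl,
      Sum.elim_inr]
  rw [Measure.prod_restrict, ← hpre]
  exact (measurePreserving_sumElim_comp_symm e).restrict_preimage (.univ_pi fun _ => hB)

section Factorization
variable {ab : (Fin s ↪ Fin l) × (Fin t ↪ Fin l)} {F : (Fin s → Sp d) → ℝ}
  {G : (Fin t → Sp d) → ℝ} (hB : MeasurableSet B) (hab : ab ∈ overlaps s t l) (hl : l = s + t)
  (hF : Measurable F) (hG : Measurable G)

include hB hab hl hF hG

lemma integrableOn_comp_mul_comp (hFi : IntegrableOn F (Set.univ.pi fun _ => B))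
    (hGi : IntegrableOn G (Set.univ.pi fun _ => B)) :
    IntegrableOn (fun z => F (z ∘ ab.1) * G (z ∘ ab.2)) (Set.univ.pi fun _ => B) := by
  obtain ⟨e, he₁, he₂⟩ := exists_equiv_of_mem_overlaps hab hl
  have hm : Measurable fun z : Fin l → Sp d => F (z ∘ ab.1) * G (z ∘ ab.2) :=
    (hF.comp (measurable_comp_index ab.1)).mul (hG.comp (measurable_comp_index ab.2))
  refine ((measurePreserving_sumElim_comp_symm_restrict e hB).integrable_comp
    hm.aestronglyMeasurable).1 ((hFi.mul_prod hGi).congr (.of_forall fun q => ?_))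
  simp only [Function.comp_def, ← he₁, ← he₂, Equiv.symm_apply_apply, Sum.elim_inl, Sum.elim_inr]

lemma setIntegral_comp_mul_comp :
    ∫ z in Set.univ.pi (fun _ => B), F (z ∘ ab.1) * G (z ∘ ab.2) =
      (∫ x in Set.univ.pi (fun _ => B), F x) * ∫ y in Set.univ.pi (fun _ => B), G y := by
  obtain ⟨e, he₁, he₂⟩ := exists_equiv_of_mem_overlaps hab hl
  have hm : Measurable fun z : Fin l → Sp d => F (z ∘ ab.1) * G (z ∘ ab.2) :=
    (hF.comp (measurable_comp_index ab.1)).mul (hG.comp (measurable_comp_index ab.2))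
  have hmp := measurePreserving_sumElim_comp_symm_restrict e hB
  rw [← hmp.map_eq, integral_map hmp.aemeasurable hm.aestronglyMeasurable, ← integral_prod_mul]
  simp only [Function.comp_def, ← he₁, ← he₂, Equiv.symm_apply_apply, Sum.elim_inl, Sum.elim_inr]

end Factorization

open Classical in
lemma card_overlaps_add (s t : ℕ) :
    (Finset.univ.filter fun ab => ab ∈ overlaps s t (s + t)).card = (s + t).factorial := by
  have hequivs : Fintype.card (Fin s ⊕ Fin t ≃ Fin (s + t)) = (s + t).factorial := by
    rw [Fintype.card_equiv finSumFinEquiv, Fintype.card_sum, Fintype.card_fin, Fintype.card_fin]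
  rw [← hequivs, ← Finset.card_univ]
  refine (Finset.card_bij (fun e _ => (Function.Embedding.inl.trans e.toEmbedding,
    Function.Embedding.inr.trans e.toEmbedding)) (fun e _ => ?_) (fun e _ e' _ h => ?_)
    fun ab hab => ?_).symm
  · refine Finset.mem_filter.2 ⟨Finset.mem_univ _, fun k => ?_⟩
    obtain ⟨i | i, rfl⟩ := e.surjective k
    exacts [Or.inl ⟨i, rfl⟩, Or.inr ⟨i, rfl⟩]
  · ext1 i
    rcases i with i | i
    exacts [DFunLike.congr_fun (Prod.mk.inj h).1 i, DFunLike.congr_fun (Prod.mk.inj h).2 i]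
  · obtain ⟨e, he₁, he₂⟩ := exists_equiv_of_mem_overlaps (Finset.mem_filter.1 hab).2 rfl
    exact ⟨e, Finset.mem_univ _, Prod.ext (DFunLike.ext _ _ he₁) (DFunLike.ext _ _ he₂)⟩

lemma setIntegral_overlapFun (hK : IsContractionKernel K) (hf : IsLocalStat K r f)
    (hg : IsLocalStat K r g) (hB : MeasurableSet B) (hBb : Bornology.IsBounded B)
    {ab : (Fin s ↪ Fin l) × (Fin t ↪ Fin l)} (hab : ab ∈ overlaps s t l) :
    ∫ z in Set.univ.pi (fun _ => B), overlapFun K f g ab z =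
      (∫ z in Set.univ.pi (fun _ => B), f (z ∘ ab.1) * g (z ∘ ab.2) * jointIntensity K z) -
        if l = s + t then (∫ x in Set.univ.pi (fun _ => B), f x * jointIntensity K x) *
          ∫ x in Set.univ.pi (fun _ => B), g x * jointIntensity K x else 0 := by
  split_ifs with hl
  swap; · simp only [overlapFun, if_neg hl, sub_zero]
  have hfm : Measurable fun x => f x * jointIntensity K x :=
    hf.measurable.mul hK.measurable_jointIntensity
  have hgm : Measurable fun x => g x * jointIntensity K x :=
    hg.measurable.mul hK.measurable_jointIntensity
  rw [← setIntegral_comp_mul_comp hB hab hl hfm hgm, ← integral_sub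
    (hf.integrableOn_comp_mul_comp_mul_jointIntensity hK hg hBb ab.1 ab.2)
    (integrableOn_comp_mul_comp hB hab hl hfm hgm (hf.integrableOn_mul_jointIntensity hK hBb)
      (hg.integrableOn_mul_jointIntensity hK hBb))]
  refine integral_congr_ae (.of_forall fun z => ?_)
  simp only [overlapFun, if_pos hl]
  ring

open Classical in
lemma sum_setIntegral_overlapFun (hK : IsContractionKernel K) (hf : IsLocalStat K r f)
    (hg : IsLocalStat K r g) (hB : MeasurableSet B) (hBb : Bornology.IsBounded B) :
    ∑ l ∈ Finset.Icc (max s t) (s + t), ((l.factorial : ℝ))⁻¹ *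
        ∑ ab ∈ Finset.univ.filter (fun ab => ab ∈ overlaps s t l),
          ∫ z in Set.univ.pi (fun _ => B), overlapFun K f g ab z =
      ∑ l ∈ Finset.Icc (max s t) (s + t), ((l.factorial : ℝ))⁻¹ *
        ∑ ab ∈ Finset.univ.filter (fun ab => ab ∈ overlaps s t l),
          (∫ z in Set.univ.pi (fun _ => B), f (z ∘ ab.1) * g (z ∘ ab.2) * jointIntensity K z) -
      (∫ x in Set.univ.pi (fun _ => B), f x * jointIntensity K x) *
        ∫ x in Set.univ.pi (fun _ => B), g x * jointIntensity K x := by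
  set c := (∫ x in Set.univ.pi (fun _ => B), f x * jointIntensity K x) *
    ∫ x in Set.univ.pi (fun _ => B), g x * jointIntensity K x
  have hdisjoint : ∑ l ∈ Finset.Icc (max s t) (s + t), ((l.factorial : ℝ))⁻¹ *
      ∑ _ab ∈ Finset.univ.filter (fun ab => ab ∈ overlaps s t l), (if l = s + t then c else 0) =
      c := by
    rw [Finset.sum_eq_single (s + t) (fun l _ hl => by
        rw [if_neg hl, Finset.sum_const_zero, mul_zero])
      fun h => absurd (Finset.mem_Icc.2 ⟨max_le (by omega) (by omega), le_rfl⟩) h,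
      if_pos rfl, Finset.sum_const, card_overlaps_add, nsmul_eq_mul, inv_mul_cancel_left₀]
    exact_mod_cast (s + t).factorial_ne_zero
  rw [← hdisjoint, ← Finset.sum_sub_distrib]
  refine Finset.sum_congr rfl fun l _ => ?_
  rw [← mul_sub, ← Finset.sum_sub_distrib]
  exact congrArg _ (Finset.sum_congr rfl fun ab hab =>
    setIntegral_overlapFun hK hf hg hB hBb (Finset.mem_filter.1 hab).2)

variable {Ω : Type*} [MeasurableSpace Ω] {P : Measure Ω} {X : Ω → Set (Sp d)}

/-- The sum of a statistic over the tuples of distinct points of `X` in a bounded window. -/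
def IsPointProcess.statSum (hX : IsPointProcess X) (hBb : Bornology.IsBounded B)
    (f : (Fin s → Sp d) → ℝ) (ω : Ω) : ℝ :=
  ∑ x ∈ tuples s (hX.pts hBb ω), f x

namespace IsDPP

section Moments
variable (hX : IsDPP P X K) (hs : 1 ≤ s) (hK : IsContractionKernel K) (hf : IsLocalStat K r f)
  (hg : IsLocalStat K r g) (hB : MeasurableSet B) (hBb : Bornology.IsBounded B)

include hs hK hf hB

lemma integrable_statSum : Integrable (hX.isPointProcess.statSum hBb f) P :=
  hX.integrable_sum_tuples hBb hB hs (hK.integrableOn_jointIntensity hBb)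
    (hf.integrableOn_mul_jointIntensity hK hBb)

lemma integral_statSum :
    ∫ ω, hX.isPointProcess.statSum hBb f ω ∂P =
      ∫ x in Set.univ.pi (fun _ => B), f x * jointIntensity K x :=
  hX.integral_sum_tuples hBb hB hs (hK.integrableOn_jointIntensity hBb)
    (hf.integrableOn_mul_jointIntensity hK hBb)

include hg

lemma integrable_sum_tuples_comp_mul_comp (hl : l ∈ Finset.Icc (max s t) (s + t))
    (a : Fin s ↪ Fin l) (b : Fin t ↪ Fin l) :
    Integrable (fun ω => ∑ z ∈ tuples l (hX.isPointProcess.pts hBb ω), f (z ∘ a) * g (z ∘ b)) P :=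
  hX.integrable_sum_tuples hBb hB
    (hs.trans ((le_max_left _ _).trans (Finset.mem_Icc.1 hl).1))
    (hK.integrableOn_jointIntensity hBb)
    (hf.integrableOn_comp_mul_comp_mul_jointIntensity hK hg hBb a b)

lemma integral_sum_tuples_comp_mul_comp (hl : l ∈ Finset.Icc (max s t) (s + t))
    (a : Fin s ↪ Fin l) (b : Fin t ↪ Fin l) :
    ∫ ω, ∑ z ∈ tuples l (hX.isPointProcess.pts hBb ω), f (z ∘ a) * g (z ∘ b) ∂P =
      ∫ z in Set.univ.pi (fun _ => B), f (z ∘ a) * g (z ∘ b) * jointIntensity K z :=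
  hX.integral_sum_tuples hBb hB
    (hs.trans ((le_max_left _ _).trans (Finset.mem_Icc.1 hl).1))
    (hK.integrableOn_jointIntensity hBb)
    (hf.integrableOn_comp_mul_comp_mul_jointIntensity hK hg hBb a b)

lemma integrable_statSum_mul : Integrable
    (fun ω => hX.isPointProcess.statSum hBb f ω * hX.isPointProcess.statSum hBb g ω) P := by
  simp only [IsPointProcess.statSum, sum_tuples_mul_sum_tuples]
  exact integrable_finsetSum _ fun l hl => (integrable_finsetSum _ fun ab _ =>
    hX.integrable_sum_tuples_comp_mul_comp hs hK hf hg hB hBb hl ab.1 ab.2).const_mul _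

open Classical in
lemma integral_statSum_mul :
    ∫ ω, hX.isPointProcess.statSum hBb f ω * hX.isPointProcess.statSum hBb g ω ∂P =
      ∑ l ∈ Finset.Icc (max s t) (s + t), ((l.factorial : ℝ))⁻¹ *
        ∑ ab ∈ Finset.univ.filter (fun ab => ab ∈ overlaps s t l),
          ∫ z in Set.univ.pi (fun _ => B), f (z ∘ ab.1) * g (z ∘ ab.2) * jointIntensity K z := by
  have hint := fun (l : ℕ) (hl : l ∈ Finset.Icc (max s t) (s + t))
    (ab : (Fin s ↪ Fin l) × (Fin t ↪ Fin l)) =>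
      hX.integrable_sum_tuples_comp_mul_comp hs hK hf hg hB hBb hl ab.1 ab.2
  simp only [IsPointProcess.statSum, sum_tuples_mul_sum_tuples]
  rw [integral_finsetSum _ fun l hl => (integrable_finsetSum _ fun ab _ =>
    hint l hl ab).const_mul _]
  refine Finset.sum_congr rfl fun l hl => ?_
  rw [integral_const_mul, integral_finsetSum _ fun ab _ => hint l hl ab]
  exact congrArg _ (Finset.sum_congr rfl fun ab _ =>
    hX.integral_sum_tuples_comp_mul_comp hs hK hf hg hB hBb hl ab.1 ab.2)

omit hg in
lemma memLp_statSum : MemLp (hX.isPointProcess.statSum hBb f) 2 P := by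
  rw [memLp_two_iff_integrable_sq (hX.integrable_statSum hs hK hf hB hBb).1]
  simpa only [sq] using hX.integrable_statSum_mul hs hK hf hf hB hBb

open Classical in
lemma cov_statSum [IsProbabilityMeasure P] (ht : 1 ≤ t) :
    cov[hX.isPointProcess.statSum hBb f, hX.isPointProcess.statSum hBb g; P] =
      ∑ l ∈ Finset.Icc (max s t) (s + t), ((l.factorial : ℝ))⁻¹ *
        ∑ ab ∈ Finset.univ.filter (fun ab => ab ∈ overlaps s t l),
          ∫ z in Set.univ.pi (fun _ => B), overlapFun K f g ab z := by
  rw [covariance_eq_sub (hX.memLp_statSum hs hK hf hB hBb) (hX.memLp_statSum ht hK hg hB hBb),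
    hX.integral_statSum hs hK hf hB hBb, hX.integral_statSum ht hK hg hB hBb,
    sum_setIntegral_overlapFun hK hf hg hB hBb, ← hX.integral_statSum_mul hs hK hf hg hB hBb]
  rfl

end Moments

section Limit
variable [IsProbabilityMeasure P] {D : ℕ → Set (Sp d)}

theorem tendsto_cov_statSum (hX : IsDPP P X K) (hs : 1 ≤ s) (ht : 1 ≤ t)
    (hK : IsContractionKernel K) (hf : IsLocalStat K r f) (hg : IsLocalStat K r g)
    (hD : IsAddFoelner (Sp d) volume atTop D) (hDm : ∀ n, MeasurableSet (D n))
    (hDb : ∀ n, Bornology.IsBounded (D n)) :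
    Tendsto (fun n => (volume (D n)).toReal⁻¹ *
      cov[hX.isPointProcess.statSum (hDb n) f, hX.isPointProcess.statSum (hDb n) g; P])
      atTop (𝓝 (limitCov K f g)) := by
  classical
  simp only [fun n => hX.cov_statSum hs hK hf hg (hDm n) (hDb n) ht, Finset.mul_sum, limitCov]
  refine tendsto_finsetSum _ fun l hl => tendsto_finsetSum _ fun ab hab => ?_
  simp only [mul_left_comm (volume (D _)).toReal⁻¹]
  exact (tendsto_setIntegral_pi_div (hs.trans ((le_max_left _ _).trans (Finset.mem_Icc.1 hl).1)) hD
    (measurable_overlapFun hK hf.measurable hg.measurable)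
    (translationInvariant_overlapFun hK hf.translationInvariant hg.translationInvariant)
    (integrable_overlapFun_anchored hs ht hK hf hg (Finset.mem_filter.1 hab).2
      (Finset.mem_Icc.1 hl).2)).const_mul _

end Limit
end IsDPP

lemma covariance_const_mul_sub_mul_sub_const [IsProbabilityMeasure P] {Z W Z' W' : Ω → ℝ}
    (hZ : MemLp Z 2 P) (hW : MemLp W 2 P) (hZ' : MemLp Z' 2 P) (hW' : MemLp W' 2 P)
    (c ε b ε' b' : ℝ) :
    cov[fun ω => c * (Z ω - ε * W ω - b), fun ω => c * (Z' ω - ε' * W' ω - b'); P] =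
      c ^ 2 * cov[Z, Z'; P] - ε' * (c ^ 2 * cov[Z, W'; P]) - ε * (c ^ 2 * cov[W, Z'; P]) +
        ε * ε' * (c ^ 2 * cov[W, W'; P]) := by
  have h : Integrable (fun ω => Z ω - ε * W ω) P :=
    (hZ.sub (hW.const_mul ε)).integrable one_le_two
  have h' : Integrable (fun ω => Z' ω - ε' * W' ω) P :=
    (hZ'.sub (hW'.const_mul ε')).integrable one_le_two
  rw [covariance_const_mul_left, covariance_const_mul_right,
    covariance_sub_const_left h, covariance_sub_const_right h',
    covariance_fun_sub_fun_sub hZ (hW.const_mul ε) hZ' (hW'.const_mul ε'),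
    covariance_const_mul_left, covariance_const_mul_right, covariance_const_mul_left,
    covariance_const_mul_right]
  ring

/-- The random variables `Y n` are, up to deterministic shifts, the sums of `f` over the tuples of
points of `X` in the windows `D n`, normalized by `|D n|^{-1/2}` and perturbed by vanishing
multiples of the sums of another statistic. -/
def IsNormalizedStatSum (hX : IsPointProcess X) (K : Sp d → Sp d → ℝ) (r : ℝ)
    {D : ℕ → Set (Sp d)} (hDb : ∀ n, Bornology.IsBounded (D n)) (f : (Fin s → Sp d) → ℝ)
    (Y : ℕ → Ω → ℝ) : Prop :=
  ∃ f' : (Fin s → Sp d) → ℝ, IsLocalStat K r f' ∧ ∃ ε b : ℕ → ℝ, Tendsto ε atTop (𝓝 0) ∧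
    ∀ n, Y n = fun ω => (√(volume (D n)).toReal)⁻¹ *
      (hX.statSum (hDb n) f ω - ε n * hX.statSum (hDb n) f' ω - b n)

namespace IsNormalizedStatSum
variable [IsProbabilityMeasure P] {D : ℕ → Set (Sp d)} {hDb : ∀ n, Bornology.IsBounded (D n)}
  {Y Z : ℕ → Ω → ℝ}

lemma memLp (hX : IsDPP P X K) (hs : 1 ≤ s) (hK : IsContractionKernel K) (hf : IsLocalStat K r f)
    (hDm : ∀ n, MeasurableSet (D n)) (hY : IsNormalizedStatSum hX.isPointProcess K r hDb f Y)
    (n : ℕ) : MemLp (Y n) 2 P := by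
  obtain ⟨f', hf', ε, b, -, hY⟩ := hY
  rw [hY]
  exact (((hX.memLp_statSum hs hK hf (hDm n) (hDb n)).sub
    ((hX.memLp_statSum hs hK hf' (hDm n) (hDb n)).const_mul _)).sub (memLp_const _)).const_mul _

theorem tendsto_cov (hX : IsDPP P X K) (hs : 1 ≤ s) (ht : 1 ≤ t) (hK : IsContractionKernel K)
    (hf : IsLocalStat K r f) (hg : IsLocalStat K r g) (hD : IsAddFoelner (Sp d) volume atTop D)
    (hDm : ∀ n, MeasurableSet (D n)) (hY : IsNormalizedStatSum hX.isPointProcess K r hDb f Y)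
    (hZ : IsNormalizedStatSum hX.isPointProcess K r hDb g Z) :
    Tendsto (fun n => cov[Y n, Z n; P]) atTop (𝓝 (limitCov K f g)) := by
  obtain ⟨f', hf', ε, b, hε, hY⟩ := hY
  obtain ⟨g', hg', ε', b', hε', hZ⟩ := hZ
  have hL := fun n => hX.memLp_statSum hs hK hf (hDm n) (hDb n)
  have hL' := fun n => hX.memLp_statSum hs hK hf' (hDm n) (hDb n)
  have hR := fun n => hX.memLp_statSum ht hK hg (hDm n) (hDb n)
  have hR' := fun n => hX.memLp_statSum ht hK hg' (hDm n) (hDb n)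
  have hsq : ∀ n, (√(volume (D n)).toReal)⁻¹ ^ 2 = (volume (D n)).toReal⁻¹ := fun n => by
    rw [inv_pow, Real.sq_sqrt ENNReal.toReal_nonneg]
  have hlim := (((hX.tendsto_cov_statSum hs ht hK hf hg hD hDm hDb).sub
    (hε'.mul (hX.tendsto_cov_statSum hs ht hK hf hg' hD hDm hDb))).sub
    (hε.mul (hX.tendsto_cov_statSum hs ht hK hf' hg hD hDm hDb))).add
    ((hε.mul hε').mul (hX.tendsto_cov_statSum hs ht hK hf' hg' hD hDm hDb))
  simp only [hY, hZ,
    fun n => covariance_const_mul_sub_mul_sub_const (hL n) (hL' n) (hR n) (hR' n), hsq]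
  simpa only [zero_mul, sub_zero, add_zero] using hlim

end IsNormalizedStatSum

end Covariance

/-! ### Uniform first order expansions -/

section Expansion
variable {β : Type*} {g h : ℝ → β → ℝ}

/-- The curve `g` of functions has a first order expansion at `0`, with bounded coefficients and
with a remainder which is `O(t²)` uniformly in the argument. -/
def HasUniformExpansion (g : ℝ → β → ℝ) : Prop :=
  ∃ (g' : β → ℝ) (B : ℝ), (∀ x, |g 0 x| ≤ B ∧ |g' x| ≤ B) ∧
    ∀ᶠ t in 𝓝 0, ∀ x, |g t x - g 0 x - g' x * t| ≤ B * t ^ 2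

lemma abs_mul_sub_mul_sub_le {a a' b b' u v t A B : ℝ} (ha : |a| ≤ A) (ha' : |a'| ≤ A)
    (hb : |b| ≤ B) (hb' : |b'| ≤ B) (ht : |t| ≤ 1) (hu : |u - a - a' * t| ≤ A * t ^ 2)
    (hv : |v - b - b' * t| ≤ B * t ^ 2) :
    |u * v - a * b - (a * b' + a' * b) * t| ≤ 6 * (A * B) * t ^ 2 := by
  have hA : 0 ≤ A := (abs_nonneg a).trans ha
  have hB : 0 ≤ B := (abs_nonneg b).trans hb
  have hvb : |v - b| ≤ 2 * B * |t| := calc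
    |v - b| = |(v - b - b' * t) + b' * t| := by ring_nf
    _ ≤ B * t ^ 2 + B * |t| := (abs_add_le _ _).trans (by rw [abs_mul b' t]; gcongr)
    _ = B * |t| * |t| + B * |t| := by rw [← sq_abs]; ring
    _ ≤ B * |t| * 1 + B * |t| := by gcongr
    _ = 2 * B * |t| := by ring
  have hv3 : |v| ≤ 3 * B := calc
    |v| = |(v - b) + b| := by ring_nf
    _ ≤ 2 * B * 1 + B := (abs_add_le _ _).trans (by gcongr; exact hvb.trans (by gcongr))
    _ = 3 * B := by ring
  calc |u * v - a * b - (a * b' + a' * b) * t|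
      = |(u - a - a' * t) * v + a * (v - b - b' * t) + a' * t * (v - b)| := by ring_nf
    _ ≤ A * t ^ 2 * (3 * B) + A * (B * t ^ 2) + A * |t| * (2 * B * |t|) := by
        refine (abs_add_three _ _ _).trans ?_
        rw [abs_mul, abs_mul, abs_mul, abs_mul a' t]
        gcongr
    _ = 6 * (A * B) * t ^ 2 := by rw [← sq_abs t]; ring

lemma hasDerivAt_of_abs_sub_le {f : ℝ → ℝ} {f' B : ℝ}
    (hf : ∀ᶠ t in 𝓝 0, |f t - f 0 - f' * t| ≤ B * t ^ 2) : HasDerivAt f f' 0 := by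
  rw [hasDerivAt_iff_isLittleO_nhds_zero]
  have hO : (fun t : ℝ => f (0 + t) - f 0 - t • f') =O[𝓝 0] fun t : ℝ => t ^ 2 := by
    refine IsBigO.of_bound B (hf.mono fun t ht => ?_)
    rwa [zero_add, Real.norm_eq_abs, smul_eq_mul, mul_comm t, Real.norm_of_nonneg (sq_nonneg t)]
  exact hO.trans_isLittleO (by simpa using isLittleO_pow_id (𝕜 := ℝ) (n := 2) one_lt_two)

lemma abs_le_sqrt_mul_sqrt_of_quadratic_nonneg {a b B τ : ℝ} (hτ : 0 < τ) (hB : τ * B ≤ 1 / 2)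
    (h : 0 ≤ a + b * (-(τ * b)) + B * (-(τ * b)) ^ 2) : |b| ≤ √(2 / τ) * √a := by
  rw [← Real.sqrt_mul (by positivity), ← Real.sqrt_sq_eq_abs]
  refine Real.sqrt_le_sqrt ?_
  rw [div_mul_eq_mul_div, le_div_iff₀ hτ]
  have hle : τ * b ^ 2 * (τ * B) ≤ τ * b ^ 2 * (1 / 2) := by gcongr
  linarith

namespace HasUniformExpansion

lemma comp {γ : Type*} (hg : HasUniformExpansion g) (φ : γ → β) :
    HasUniformExpansion fun t x => g t (φ x) :=
  have ⟨g', B, hB, hg⟩ := hg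
  ⟨g' ∘ φ, B, fun x => hB (φ x), hg.mono fun _ ht x => ht (φ x)⟩

lemma of_abs_le {f : β → ℝ} {B : ℝ} (hf : ∀ x, |f x| ≤ B) :
    HasUniformExpansion fun (_ : ℝ) x => f x := by
  refine ⟨0, B, fun x => ⟨hf x, ?_⟩, .of_forall fun t x => ?_⟩
  all_goals have hB : 0 ≤ B := (abs_nonneg _).trans (hf x)
  · simpa only [Pi.zero_apply, abs_zero] using hB
  · simp only [sub_self, Pi.zero_apply, zero_mul, abs_zero]
    positivity

lemma add (hg : HasUniformExpansion g) (hh : HasUniformExpansion h) :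
    HasUniformExpansion fun t x => g t x + h t x := by
  obtain ⟨g', B, hB, hg⟩ := hg
  obtain ⟨h', B', hB', hh⟩ := hh
  refine ⟨g' + h', B + B', fun x => ⟨(abs_add_le _ _).trans (add_le_add (hB x).1 (hB' x).1),
    (abs_add_le _ _).trans (add_le_add (hB x).2 (hB' x).2)⟩, ?_⟩
  filter_upwards [hg, hh] with t hg hh x
  calc |g t x + h t x - (g 0 x + h 0 x) - (g' + h') x * t|
      = |(g t x - g 0 x - g' x * t) + (h t x - h 0 x - h' x * t)| := by
        rw [Pi.add_apply]; ring_nf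
    _ ≤ B * t ^ 2 + B' * t ^ 2 := (abs_add_le _ _).trans (add_le_add (hg x) (hh x))
    _ = (B + B') * t ^ 2 := by ring

lemma mul (hg : HasUniformExpansion g) (hh : HasUniformExpansion h) :
    HasUniformExpansion fun t x => g t x * h t x := by
  obtain ⟨g', B, hB, hg⟩ := hg
  obtain ⟨h', B', hB', hh⟩ := hh
  have hmul : ∀ {a b : ℝ}, |a| ≤ B → |b| ≤ B' → |a * b| ≤ B * B' := fun {a b} ha hb => by
    rw [abs_mul]
    exact mul_le_mul ha hb (abs_nonneg _) ((abs_nonneg a).trans ha)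
  refine ⟨fun x => g 0 x * h' x + g' x * h 0 x, 6 * (B * B'), fun x => ?_, ?_⟩
  · have h₀ := hmul (hB x).1 (hB' x).1
    have hsum := (abs_add_le _ _).trans
      (add_le_add (hmul (hB x).1 (hB' x).2) (hmul (hB x).2 (hB' x).1))
    have hpos := (abs_nonneg _).trans h₀
    exact ⟨by linarith, by linarith⟩
  · filter_upwards [hg, hh, Metric.closedBall_mem_nhds (0 : ℝ) one_pos] with t hg hh ht x
    exact abs_mul_sub_mul_sub_le (hB x).1 (hB x).2 (hB' x).1 (hB' x).2
      (mem_closedBall_zero_iff.1 ht) (hg x) (hh x)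

lemma sum {ι : Type*} (s : Finset ι) {G : ι → ℝ → β → ℝ} (hG : ∀ i, HasUniformExpansion (G i)) :
    HasUniformExpansion fun t x => ∑ i ∈ s, G i t x := by
  classical
  induction s using Finset.induction_on with
  | empty => simpa only [Finset.sum_empty] using of_abs_le fun _ => abs_zero.le
  | insert a s ha ih => simpa only [Finset.sum_insert ha] using (hG a).add ih

lemma prod {ι : Type*} (s : Finset ι) {G : ι → ℝ → β → ℝ} (hG : ∀ i, HasUniformExpansion (G i)) :
    HasUniformExpansion fun t x => ∏ i ∈ s, G i t x := by
  classical
  induction s using Finset.induction_on with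
  | empty => simpa only [Finset.prod_empty] using of_abs_le fun _ => abs_one.le
  | insert a s ha ih => simpa only [Finset.prod_insert ha] using (hG a).mul ih

lemma jointIntensity {d : ℕ} {K : ℝ → Sp d → Sp d → ℝ}
    (hK : HasUniformExpansion fun t (z : Sp d × Sp d) => K t z.1 z.2) (l : ℕ) :
    HasUniformExpansion fun t (x : Fin l → Sp d) => DPPScore.jointIntensity (K t) x := by
  simp only [DPPScore.jointIntensity, Matrix.det_apply', kernelMatrix, Matrix.of_apply]
  exact sum _ fun σ => (of_abs_le fun _ => le_rfl).mul <|
    prod _ fun k => hK.comp fun x : Fin l → Sp d => (x (σ k), x k)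

lemma hasDerivAt (hg : HasUniformExpansion g) (x : β) :
    HasDerivAt (fun t => g t x) (deriv (fun t => g t x) 0) 0 :=
  have ⟨_, _, _, hg⟩ := hg
  (hasDerivAt_of_abs_sub_le (hg.mono fun _ ht => ht x)).differentiableAt.hasDerivAt

lemma exists_abs_sub_deriv_le (hg : HasUniformExpansion g) :
    ∃ B, (∀ x, |deriv (fun t => g t x) 0| ≤ B) ∧
      ∀ᶠ t in 𝓝 0, ∀ x, |g t x - g 0 x - deriv (fun t => g t x) 0 * t| ≤ B * t ^ 2 := by
  obtain ⟨g', B, hB, hg⟩ := hg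
  have hg' : ∀ x, deriv (fun t => g t x) 0 = g' x := fun x =>
    (hasDerivAt_of_abs_sub_le (hg.mono fun _ ht => ht x)).deriv
  simp only [hg']
  exact ⟨B, fun x => (hB x).2, hg⟩

/-- Landau's inequality: `0 ≤ g t x` is tested at a small multiple `t` of minus the derivative. -/
lemma exists_abs_deriv_le_mul_sqrt (hg : HasUniformExpansion g)
    (hpos : ∀ᶠ t in 𝓝 0, ∀ x, 0 ≤ g t x) :
    ∃ c, 0 ≤ c ∧ ∀ x, |deriv (fun t => g t x) 0| ≤ c * √(g 0 x) := by
  obtain ⟨B, hB, hg⟩ := hg.exists_abs_sub_deriv_le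
  obtain ⟨δ, hδ, hball⟩ := Metric.nhds_basis_closedBall.eventually_iff.1 (hg.and hpos)
  set m := min (1 / 2) δ
  set τ := m / (|B| + 1)
  have hτ : 0 < τ := by positivity
  have hτB : τ * B ≤ m := by
    rw [div_mul_eq_mul_div, div_le_iff₀ (by positivity)]
    gcongr
    linarith [le_abs_self B]
  refine ⟨√(2 / τ), Real.sqrt_nonneg _, fun x => ?_⟩
  set b := deriv (fun t => g t x) 0
  have hmem : -(τ * b) ∈ Metric.closedBall (0 : ℝ) δ := by
    rw [mem_closedBall_zero_iff, norm_neg, Real.norm_eq_abs, abs_mul, abs_of_pos hτ]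
    calc τ * |b| ≤ τ * B := by gcongr; exact hB x
      _ ≤ δ := hτB.trans (min_le_right _ _)
  obtain ⟨hexp, hnonneg⟩ := hball hmem
  refine abs_le_sqrt_mul_sqrt_of_quadratic_nonneg hτ (hτB.trans (min_le_left _ _)) ?_
  linarith [(abs_le.1 (hexp x)).2, hnonneg x]

lemma measurable_deriv [MeasurableSpace β] (hg : HasUniformExpansion g)
    (hm : ∀ᶠ t in 𝓝 0, Measurable (g t)) : Measurable fun x => deriv (fun t => g t x) 0 := by
  obtain ⟨u, hu, hmu⟩ := exists_seq_forall_of_frequently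
    (hm.filter_mono (nhdsWithin_le_nhds (s := {0}ᶜ))).frequently
  refine measurable_of_tendsto_metrizable (fun n => ?_)
    (tendsto_pi_nhds.2 fun x => (hg.hasDerivAt x).tendsto_slope_zero.comp hu)
  simp only [Function.comp_def, zero_add]
  exact ((hmu n).sub hm.self_of_nhds).const_smul (u n)⁻¹

lemma eventually_integrable [MeasurableSpace β] {μ : Measure β} [IsFiniteMeasure μ]
    (hg : HasUniformExpansion g) (hm : ∀ᶠ t in 𝓝 0, Measurable (g t)) :
    ∀ᶠ t in 𝓝 0, Integrable (g t) μ := by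
  obtain ⟨g', B, hB, hg⟩ := hg
  filter_upwards [hg, hm] with t ht hmt
  refine .of_bound hmt.aestronglyMeasurable (B * t ^ 2 + B + B * |t|) (.of_forall fun x => ?_)
  calc ‖g t x‖ = |(g t x - g 0 x - g' x * t) + g 0 x + g' x * t| := by
        rw [Real.norm_eq_abs]; ring_nf
    _ ≤ B * t ^ 2 + B + B * |t| := by
        refine (abs_add_three _ _ _).trans ?_
        rw [abs_mul (g' x)]
        gcongr
        exacts [ht x, (hB x).1, (hB x).2]

lemma hasDerivAt_integral [MeasurableSpace β] {μ : Measure β} [IsFiniteMeasure μ]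
    (hg : HasUniformExpansion g) (hm : ∀ᶠ t in 𝓝 0, Measurable (g t)) :
    HasDerivAt (fun t => ∫ x, g t x ∂μ) (∫ x, deriv (fun t => g t x) 0 ∂μ) 0 := by
  have hint := hg.eventually_integrable (μ := μ) hm
  obtain ⟨B, hB, hexp⟩ := hg.exists_abs_sub_deriv_le
  have hint' : Integrable (fun x => deriv (fun t => g t x) 0) μ :=
    .of_bound (hg.measurable_deriv hm).aestronglyMeasurable B (.of_forall hB)
  refine hasDerivAt_of_abs_sub_le (B := B * μ.real Set.univ) ?_
  filter_upwards [hexp, hint] with t ht hit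
  have hsub : Integrable (fun x => g t x - g 0 x) μ := hit.sub hint.self_of_nhds
  rw [← integral_mul_const, ← integral_sub hit hint.self_of_nhds,
    ← integral_sub hsub (hint'.mul_const t), ← Real.norm_eq_abs, mul_right_comm]
  exact norm_integral_le_of_norm_le_const (.of_forall ht)

end HasUniformExpansion

lemma norm_sub_sub_fderivWithin_le {E F : Type*} [NormedAddCommGroup E] [NormedSpace ℝ E]
    [NormedAddCommGroup F] [NormedSpace ℝ F] {f : E → F} {s : Set E} (hs : Convex ℝ s)
    (hu : UniqueDiffOn ℝ s) (hf : ContDiffOn ℝ 2 f s) {M : ℝ}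
    (hM : ∀ x ∈ s, ‖iteratedFDerivWithin ℝ 2 f s x‖ ≤ M) {x y : E} (hx : x ∈ s) (hy : y ∈ s) :
    ‖f y - f x - fderivWithin ℝ f s x (y - x)‖ ≤ M * ‖y - x‖ ^ 2 := by
  have hM0 : 0 ≤ M := (norm_nonneg _).trans (hM x hx)
  have hdiff : DifferentiableOn ℝ f s := hf.differentiableOn two_ne_zero
  have hdiff' : DifferentiableOn ℝ (fderivWithin ℝ f s) s :=
    (hf.fderivWithin hu (m := 1) le_rfl).differentiableOn one_ne_zero
  have hM' : ∀ z ∈ s, ‖fderivWithin ℝ (fderivWithin ℝ f s) s z‖ ≤ M := fun z hz => by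
    rw [← norm_iteratedFDerivWithin_one _ (hu z hz), norm_iteratedFDerivWithin_fderivWithin hu hz]
    exact hM z hz
  have hball : Convex ℝ (s ∩ Metric.closedBall x ‖y - x‖) := hs.inter (convex_closedBall _ _)
  have hmvt := hball.norm_image_sub_le_of_norm_hasFDerivWithin_le' (C := M * ‖y - x‖)
    (φ := fderivWithin ℝ f s x) (fun z hz => (hdiff z hz.1).hasFDerivWithinAt.mono
      Set.inter_subset_left) (fun z hz =>
        (hs.norm_image_sub_le_of_norm_fderivWithin_le hdiff' hM' hx hz.1).trans (by
          gcongr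
          exact mem_closedBall_iff_norm.1 hz.2))
    ⟨hx, Metric.mem_closedBall_self (norm_nonneg _)⟩ ⟨hy, mem_closedBall_iff_norm.2 le_rfl⟩
  rwa [mul_assoc, ← sq] at hmvt

end Expansion

/-! ### Regular curves of kernels -/

section Model
variable {d q : ℕ} {C : EuclideanSpace ℝ (Fin q) → Sp d → ℝ} {Θl : Set ℝ}
  {Θa : Set (EuclideanSpace ℝ (Fin q))} {θ : Param q}

/-- A curve of kernels along which the intensities can be differentiated at time `0`: the kernels
are covariances of determinantal point processes and have a uniform first order expansion. -/
structure IsRegularCurve (K : ℝ → Sp d → Sp d → ℝ) : Prop where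
  isContractionKernel : ∀ᶠ t in 𝓝 0, IsContractionKernel (K t)
  hasUniformExpansion : HasUniformExpansion fun t (z : Sp d × Sp d) => K t z.1 z.2

/-- The parameter `θ` moved by `t` in the direction of `α_i`, as in `partialAlpha`. -/
def shiftAlpha (i : Fin q) (θ : Param q) (t : ℝ) : Param q :=
  (θ.1, θ.2 + t • EuclideanSpace.single i (1 : ℝ))

lemma shiftAlpha_zero (i : Fin q) (θ : Param q) : shiftAlpha i θ 0 = θ := by
  simp [shiftAlpha]

lemma shiftAlpha_sub (i : Fin q) (θ : Param q) (t : ℝ) :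
    shiftAlpha i θ t - θ = t • ((0, EuclideanSpace.single i (1 : ℝ)) : Param q) := by
  ext <;> simp [shiftAlpha]

lemma norm_zero_single (i : Fin q) :
    ‖((0, EuclideanSpace.single i (1 : ℝ)) : Param q)‖ = 1 := by
  simp [Prod.norm_def]

lemma eventually_shiftAlpha_mem {s : Set (Param q)} (hθ : θ ∈ interior s) (i : Fin q) :
    ∀ᶠ t in 𝓝 0, shiftAlpha i θ t ∈ s := by
  have hcont : Continuous (shiftAlpha i θ) := by unfold shiftAlpha; fun_prop
  refine hcont.continuousAt.eventually_mem ?_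
  rw [shiftAlpha_zero]
  exact mem_interior_iff_mem_nhds.1 hθ

/-- The curve of kernels obtained by moving the coordinate `α_i` of the parameter `θ`. -/
def alphaCurve (C : EuclideanSpace ℝ (Fin q) → Sp d → ℝ) (i : Fin q) (θ : Param q) (t : ℝ) :
    Sp d → Sp d → ℝ :=
  stationaryKernel C (shiftAlpha i θ t)

lemma alphaCurve_zero (C : EuclideanSpace ℝ (Fin q) → Sp d → ℝ) (i : Fin q) (θ : Param q) :
    alphaCurve C i θ 0 = stationaryKernel C θ := by
  rw [alphaCurve, shiftAlpha_zero]

lemma RegularityAssumption.hasUniformExpansion_alphaCurve (hreg : RegularityAssumption C Θl Θa)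
    (hθ : θ ∈ interior (Θl ×ˢ Θa)) (i : Fin q) :
    HasUniformExpansion fun t (z : Sp d × Sp d) => alphaCurve C i θ t z.1 z.2 := by
  obtain ⟨M, hM⟩ := hreg.bounded_deriv
  have hθS : θ ∈ Θl ×ˢ Θa := interior_subset hθ
  have huniq : UniqueDiffOn ℝ (Θl ×ˢ Θa) := uniqueDiffOn_convex hreg.convex ⟨θ, hθ⟩
  let F (z : Sp d × Sp d) (η : Param q) : ℝ := stationaryKernel C η z.1 z.2
  let v : Param q := (0, EuclideanSpace.single i 1)
  refine ⟨fun z => fderivWithin ℝ (F z) (Θl ×ˢ Θa) θ v, M, fun z => ⟨?_, ?_⟩, ?_⟩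
  · beta_reduce
    rw [alphaCurve_zero, ← Real.norm_eq_abs, ← norm_iteratedFDerivWithin_zero (𝕜 := ℝ) (f := F z)]
    exact hM 0 (by simp) θ hθS z.1 z.2
  · have hM₁ := hM 1 (by simp) θ hθS z.1 z.2
    rw [norm_iteratedFDerivWithin_one _ (huniq θ hθS)] at hM₁
    simpa only [Real.norm_eq_abs, v, norm_zero_single, mul_one] using
      ContinuousLinearMap.le_of_opNorm_le _ hM₁ v
  · filter_upwards [eventually_shiftAlpha_mem hθ i] with t ht z
    have htaylor := norm_sub_sub_fderivWithin_le hreg.convex huniq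
      ((hreg.contDiffOn z.1 z.2).of_le (by norm_num))
      (fun η hη => hM 2 (by simp) η hη z.1 z.2) hθS ht
    rw [shiftAlpha_sub, map_smul, smul_eq_mul, mul_comm t, norm_smul, norm_zero_single, mul_one,
      Real.norm_eq_abs, Real.norm_eq_abs, sq_abs] at htaylor
    rwa [alphaCurve_zero]

/-- Pointwise form of the assumptions on the model: at `θ`, and along every coordinate direction of
`α` through `θ`. -/
structure IsRegularAt (C : EuclideanSpace ℝ (Fin q) → Sp d → ℝ) (θ : Param q) : Prop where
  lam_pos : 0 < θ.1
  normalized : C θ.2 0 = 1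
  isContractionKernel : IsContractionKernel (stationaryKernel C θ)
  isRegularCurve : ∀ i, IsRegularCurve (alphaCurve C i θ)

lemma RegularityAssumption.isRegularAt (hreg : RegularityAssumption C Θl Θa)
    (hexist : ExistenceAssumption C Θl Θa) (hθ : θ ∈ interior (Θl ×ˢ Θa)) : IsRegularAt C θ := by
  have hcontr : ∀ η ∈ Θl ×ˢ Θa, IsContractionKernel (stationaryKernel C η) := fun η hη =>
    have ⟨_, hφ, hφle⟩ := hexist.spectral η.1 hη.1 η.2 hη.2
    isContractionKernel_stationaryKernel (hexist.lam_pos η.1 hη.1) hφ hφle (hreg.posDef η hη)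
  have hθS : θ ∈ Θl ×ˢ Θa := interior_subset hθ
  exact ⟨hexist.lam_pos _ hθS.1, hexist.normalized _ hθS.2, hcontr θ hθS, fun i =>
    ⟨(eventually_shiftAlpha_mem hθ i).mono fun _ ht => hcontr _ ht,
      hreg.hasUniformExpansion_alphaCurve hθ i⟩⟩

end Model

/-! ### Differentiating the likelihoods along a curve of kernels -/

section Score
variable {d l : ℕ} {K : ℝ → Sp d → Sp d → ℝ} {r : ℝ} {w h : (Fin l → Sp d) → ℝ}

/-- The derivative of the joint intensities at time `0` along the curve of kernels `K`. -/
def intensityDeriv (K : ℝ → Sp d → Sp d → ℝ) (x : Fin l → Sp d) : ℝ :=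
  deriv (fun t => jointIntensity (K t) x) 0

/-- The derivative of `modifiedK` at time `0` along the curve of kernels `K`. -/
def modifiedKDeriv (K : ℝ → Sp d → Sp d → ℝ) (w : (Fin l → Sp d) → ℝ) (B : Set (Sp d)) : ℝ :=
  ∫ x in Set.univ.pi fun _ => B, intensityDeriv K x * w x

/-- The statistic of `l`-tuples whose sum over a configuration is the derivative of
`compositeLogLik` when `κ` is the logarithmic derivative of `modifiedK`. -/
def scoreDensity (K : ℝ → Sp d → Sp d → ℝ) (w : (Fin l → Sp d) → ℝ) (κ : ℝ)
    (x : Fin l → Sp d) : ℝ :=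
  (intensityDeriv K x / jointIntensity (K 0) x - κ) * w x

lemma sum_scoreDensity (κ κ' : ℝ) (s : Finset (Fin l → Sp d)) :
    ∑ x ∈ s, scoreDensity K w κ x =
      ∑ x ∈ s, scoreDensity K w κ' x - (κ - κ') * ∑ x ∈ s, w x := by
  rw [Finset.mul_sum, ← Finset.sum_sub_distrib]
  refine Finset.sum_congr rfl fun x _ => ?_
  rw [scoreDensity, scoreDensity]
  ring

namespace IsWeight

lemma eq_zero (hw : IsWeight r w) {x : Fin l → Sp d} (hx : x ∉ nearTuples d l r) : w x = 0 :=
  image_eq_zero_of_notMem_tsupport (by rwa [hw.support])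

lemma translationInvariant_mul (hw : IsWeight r w) (hinv : TranslationInvariant h) :
    TranslationInvariant fun x => h x * w x := fun c x => by
  beta_reduce
  rw [hinv, hw.translation]

lemma exists_abs_le (hw : IsWeight r w) : ∃ M, ∀ x, |w x| ≤ M := by
  simpa only [abs_of_nonneg (hw.nonneg _)] using hw.bounded

lemma isLocalStat_mul (hw : IsWeight r w) {K : Sp d → Sp d → ℝ} (hm : Measurable h)
    (hinv : TranslationInvariant h) (hb : ∃ c, ∀ x, |h x| * √(jointIntensity K x) ≤ c) :
    IsLocalStat K r fun x => h x * w x := by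
  obtain ⟨M, hM⟩ := hw.exists_abs_le
  obtain ⟨c, hc⟩ := hb
  refine ⟨hm.mul hw.measurable, hw.translationInvariant_mul hinv,
    fun x hx => by rw [hw.eq_zero hx, mul_zero], c * M, fun x => ?_⟩
  rw [abs_mul, mul_right_comm]
  exact mul_le_mul (hc x) (hM x) (abs_nonneg _) (le_trans (by positivity) (hc x))

lemma isLocalStat (hw : IsWeight r w) {K : Sp d → Sp d → ℝ} (hK : IsContractionKernel K) :
    IsLocalStat K r w := by
  obtain ⟨m, hm⟩ := hK.exists_abs_jointIntensity_le (d := d) l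
  have hmul := hw.isLocalStat_mul (K := K) (h := 1) measurable_one (fun _ _ => rfl)
    ⟨√m, fun x => by
      rw [Pi.one_apply, abs_one, one_mul]
      exact Real.sqrt_le_sqrt ((le_abs_self _).trans (hm x))⟩
  simpa only [Pi.one_apply, one_mul] using hmul

lemma integrable_mul_anchored (hw : IsWeight r w) (hl : 1 ≤ l) (hm : Measurable h)
    (hb : ∃ c, ∀ x, |h x| ≤ c) :
    Integrable fun u : Fin (l - 1) → Sp d => h (anchored u) * w (anchored u) := by
  obtain ⟨M, hM⟩ := hw.exists_abs_le
  obtain ⟨c, hc⟩ := hb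
  have hmeas : Measurable fun u : Fin (l - 1) → Sp d => h (anchored u) * w (anchored u) :=
    (hm.mul hw.measurable).comp measurable_anchored
  have hsupp : (Function.support fun u : Fin (l - 1) → Sp d => h (anchored u) * w (anchored u)) ⊆
      {u | anchored u ∈ nearTuples d l r} := fun u hu => by
    by_contra hfar
    exact hu (by simp only [hw.eq_zero hfar, mul_zero])
  refine (integrableOn_iff_integrable_of_support_subset hsupp).1 <|
    .of_bound (volume_setOf_anchored_mem_nearTuples_lt_top hl r) hmeas.aestronglyMeasurable
      (c * M) (.of_forall fun u => ?_)
  rw [Real.norm_eq_abs, abs_mul]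
  exact mul_le_mul (hc _) (hM _) (abs_nonneg _) ((abs_nonneg _).trans (hc (anchored u)))

end IsWeight

lemma isLocalStat_const {K : Sp d → Sp d → ℝ} (hK : IsContractionKernel K) (hr : 0 ≤ r) (c : ℝ) :
    IsLocalStat K r fun _ : Fin 1 → Sp d => c := by
  obtain ⟨m, hm⟩ := hK.exists_abs_jointIntensity_le (d := d) 1
  refine ⟨measurable_const, fun _ _ => rfl, fun x hx => absurd (fun i j _ => ?_) hx, |c| * √m,
    fun x => ?_⟩
  · rwa [Subsingleton.elim i j, sub_self, norm_zero]
  · gcongr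
    exact (le_abs_self _).trans (hm x)

namespace IsRegularCurve

lemma isContractionKernel_zero (hK : IsRegularCurve K) : IsContractionKernel (K 0) :=
  hK.isContractionKernel.self_of_nhds

lemma hasDerivAt_jointIntensity (hK : IsRegularCurve K) (x : Fin l → Sp d) :
    HasDerivAt (fun t => jointIntensity (K t) x) (intensityDeriv K x) 0 :=
  (hK.hasUniformExpansion.jointIntensity l).hasDerivAt x

lemma measurable_intensityDeriv (hK : IsRegularCurve K) :
    Measurable fun x : Fin l → Sp d => intensityDeriv K x :=
  (hK.hasUniformExpansion.jointIntensity l).measurable_deriv <|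
    hK.isContractionKernel.mono fun _ ht => ht.measurable_jointIntensity

lemma translationInvariant_intensityDeriv (hK : IsRegularCurve K) :
    TranslationInvariant fun x : Fin l → Sp d => intensityDeriv K x := fun c x =>
  EventuallyEq.deriv_eq <| hK.isContractionKernel.mono fun _ ht =>
    ht.translationInvariant_jointIntensity c x

lemma exists_abs_intensityDeriv_le_mul_sqrt (hK : IsRegularCurve K) (l : ℕ) :
    ∃ c, 0 ≤ c ∧ ∀ x : Fin l → Sp d, |intensityDeriv K x| ≤ c * √(jointIntensity (K 0) x) :=
  (hK.hasUniformExpansion.jointIntensity l).exists_abs_deriv_le_mul_sqrt <|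
    hK.isContractionKernel.mono fun _ ht => ht.jointIntensity_nonneg

lemma exists_abs_intensityDeriv_le (hK : IsRegularCurve K) (l : ℕ) :
    ∃ c, ∀ x : Fin l → Sp d, |intensityDeriv K x| ≤ c :=
  have ⟨B, hB, _⟩ := (hK.hasUniformExpansion.jointIntensity l).exists_abs_sub_deriv_le
  ⟨B, hB⟩

lemma isLocalStat_scoreDensity (hK : IsRegularCurve K) (hw : IsWeight r w) (κ : ℝ) :
    IsLocalStat (K 0) r (scoreDensity K w κ) := by
  have hK₀ := hK.isContractionKernel_zero
  obtain ⟨c, hc, hderiv⟩ := hK.exists_abs_intensityDeriv_le_mul_sqrt l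
  obtain ⟨m, hm⟩ := hK₀.exists_abs_jointIntensity_le (d := d) l
  refine hw.isLocalStat_mul
    ((hK.measurable_intensityDeriv.div hK₀.measurable_jointIntensity).sub_const κ)
    (fun a x => ?_) ⟨c + |κ| * √m, fun x => ?_⟩
  · have hderiv_inv := hK.translationInvariant_intensityDeriv a x
    have hρ_inv := hK₀.translationInvariant_jointIntensity a x
    beta_reduce at hderiv_inv hρ_inv ⊢
    rw [hderiv_inv, hρ_inv]
  have hρ := hK₀.jointIntensity_nonneg x
  set ρ := jointIntensity (K 0) x
  have hlogDeriv : |intensityDeriv K x / ρ| * √ρ ≤ c := by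
    rw [abs_div, abs_of_nonneg hρ, div_mul_eq_mul_div]
    refine div_le_of_le_mul₀ hρ hc ?_
    calc |intensityDeriv K x| * √ρ ≤ c * √ρ * √ρ := by gcongr; exact hderiv x
      _ = c * ρ := by rw [mul_assoc, Real.mul_self_sqrt hρ]
  calc |intensityDeriv K x / ρ - κ| * √ρ
      ≤ (|intensityDeriv K x / ρ| + |κ|) * √ρ := by gcongr; exact abs_sub _ _
    _ = |intensityDeriv K x / ρ| * √ρ + |κ| * √ρ := add_mul _ _ _
    _ ≤ c + |κ| * √m := by gcongr; exact (le_abs_self _).trans (hm x)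

lemma hasDerivAt_modifiedK (hK : IsRegularCurve K) (hw : IsWeight r w) {B : Set (Sp d)}
    (hB : Bornology.IsBounded B) :
    HasDerivAt (fun t => modifiedK (K t) w B) (modifiedKDeriv K w B) 0 := by
  obtain ⟨M, hM⟩ := hw.exists_abs_le
  have : IsFiniteMeasure (volume.restrict (Set.univ.pi fun _ : Fin l => B)) :=
    isFiniteMeasure_restrict.2 (Bornology.IsBounded.pi fun _ => hB).measure_lt_top.ne
  have hder := ((hK.hasUniformExpansion.jointIntensity l).mul
    (.of_abs_le hM)).hasDerivAt_integral (μ := volume.restrict (Set.univ.pi fun _ => B))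
      (hK.isContractionKernel.mono fun t ht => ht.measurable_jointIntensity.mul hw.measurable)
  simp only [fun x => ((hK.hasDerivAt_jointIntensity x).mul_const (w x)).deriv] at hder
  exact hder

lemma modifiedK_eq_zero (hK : IsRegularCurve K) (hw : IsWeight r w) {B : Set (Sp d)}
    (hB : Bornology.IsBounded B) (h₀ : modifiedK (K 0) w B = 0) (t : ℝ) :
    modifiedK (K t) w B = 0 := by
  have hK₀ := hK.isContractionKernel_zero
  obtain ⟨m, hm⟩ := hK₀.exists_abs_jointIntensity_le (d := d) l
  obtain ⟨M, hM⟩ := hw.exists_abs_le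
  have hint : IntegrableOn (fun x => jointIntensity (K 0) x * w x) (Set.univ.pi fun _ => B) :=
    integrableOn_pi_of_abs_le hB (hK₀.measurable_jointIntensity.mul hw.measurable)
      (c := m * M) fun x => by
        rw [abs_mul]
        exact mul_le_mul (hm x) (hM x) (abs_nonneg _) ((abs_nonneg _).trans (hm x))
  have hzero := (setIntegral_eq_zero_iff_of_nonneg_ae (.of_forall fun x =>
    mul_nonneg (hK₀.jointIntensity_nonneg x) (hw.nonneg x)) hint).1 h₀
  refine integral_eq_zero_of_ae (hzero.mono fun x hx => ?_)
  rcases mul_eq_zero.1 hx with hρ | hwx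
  · have hx' : ¬ Function.Injective x := fun hinj => (hK₀.jointIntensity_pos hinj).ne' hρ
    have hρt : jointIntensity (K t) x = 0 := det_gram_eq_zero_of_not_injective (K t) hx'
    simp only [hρt, zero_mul, Pi.zero_apply]
  · simp only [hwx, mul_zero, Pi.zero_apply]

lemma hasDerivAt_log_modifiedK (hK : IsRegularCurve K) (hw : IsWeight r w) {B : Set (Sp d)}
    (hB : Bornology.IsBounded B) :
    HasDerivAt (fun t => Real.log (modifiedK (K t) w B))
      (modifiedKDeriv K w B / modifiedK (K 0) w B) 0 := by
  by_cases h₀ : modifiedK (K 0) w B = 0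
  · simpa only [hK.modifiedK_eq_zero hw hB h₀, div_zero] using hasDerivAt_const _ _
  · exact (hK.hasDerivAt_modifiedK hw hB).log h₀

lemma hasDerivAt_compositeLogLik (hK : IsRegularCurve K) (hw : IsWeight r w) {D S : Set (Sp d)}
    (hfin : (S ∩ D).Finite) (hD : MeasurableSet D) (hDb : Bornology.IsBounded D) :
    HasDerivAt (fun t => compositeLogLik (K t) w D S)
      (∑ x ∈ tuples l hfin.toFinset,
        scoreDensity K w (modifiedKDeriv K w D / modifiedK (K 0) w D) x) 0 := by
  simp only [compositeLogLik, setIntegral_factorialMeasure hfin hD]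
  refine HasDerivAt.fun_sum fun x hx => ?_
  have hpos := hK.isContractionKernel_zero.jointIntensity_pos (mem_tuples.1 hx).2
  exact (((hK.hasDerivAt_jointIntensity x).log hpos.ne').sub
    (hK.hasDerivAt_log_modifiedK hw hDb)).mul_const _

lemma tendsto_modifiedKDeriv_div (hK : IsRegularCurve K) (hl : 1 ≤ l) (hw : IsWeight r w)
    {D : ℕ → Set (Sp d)} (hD : IsAddFoelner (Sp d) volume atTop D)
    (hDm : ∀ n, MeasurableSet (D n)) (hDb : ∀ n, Bornology.IsBounded (D n)) :
    Tendsto (fun n => modifiedKDeriv K w (D n) / modifiedK (K 0) w (D n)) atTop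
      (𝓝 ((∫ u : Fin (l - 1) → Sp d, intensityDeriv K (anchored u) * w (anchored u)) /
        ∫ u : Fin (l - 1) → Sp d, jointIntensity (K 0) (anchored u) * w (anchored u))) := by
  have hK₀ := hK.isContractionKernel_zero
  have hint := hw.integrable_mul_anchored hl hK₀.measurable_jointIntensity
    (hK₀.exists_abs_jointIntensity_le l)
  have hinv := hw.translationInvariant_mul hK₀.translationInvariant_jointIntensity
  have hm : Measurable fun x => jointIntensity (K 0) x * w x :=
    hK₀.measurable_jointIntensity.mul hw.measurable
  have hlim := tendsto_setIntegral_pi_div hl hD hm hinv hint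
  have hlim' := tendsto_setIntegral_pi_div hl hD (hK.measurable_intensityDeriv.mul hw.measurable)
    (hw.translationInvariant_mul hK.translationInvariant_intensityDeriv)
    (hw.integrable_mul_anchored hl hK.measurable_intensityDeriv (hK.exists_abs_intensityDeriv_le l))
  by_cases h₀ : ∫ u : Fin (l - 1) → Sp d, jointIntensity (K 0) (anchored u) * w (anchored u) = 0
  · have hzero := (integral_eq_zero_iff_of_nonneg (fun u : Fin (l - 1) → Sp d =>
      mul_nonneg (hK₀.jointIntensity_nonneg _) (hw.nonneg _)) hint).1 h₀
    have hK_zero : ∀ n, modifiedK (K 0) w (D n) = 0 := fun n => by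
      rw [modifiedK, setIntegral_pi_eq_integral_volume_baseSet_mul hl (hDm n)
        (hDb n).measure_lt_top.ne hm hinv hint]
      refine integral_eq_zero_of_ae (hzero.mono fun u hu => ?_)
      exact mul_eq_zero_of_right _ hu
    simp only [hK_zero, h₀, div_zero]
    exact tendsto_const_nhds
  · refine (hlim'.div hlim h₀).congr' ?_
    filter_upwards [hD.eventually_meas_ne_zero] with n hn
    exact mul_div_mul_left _ _
      (inv_ne_zero (ENNReal.toReal_ne_zero.2 ⟨hn, (hDb n).measure_lt_top.ne⟩))

end IsRegularCurve
end Score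

/-! ### The components of the score -/

section Components
variable {d q l : ℕ} {C : EuclideanSpace ℝ (Fin q) → Sp d → ℝ} {θ : Param q} {r : ℝ}
  {w : (Fin l → Sp d) → ℝ} {D S : Set (Sp d)}

lemma score_zero (hfin : (S ∩ D).Finite) (hD : MeasurableSet D) (hθ : θ.1 ≠ 0) :
    score C w D S θ 0 = (∑ _x ∈ tuples 1 hfin.toFinset, 1 / θ.1) - (volume D).toReal := by
  have hloglik : intensityLogLik D S =
      fun lam => hfin.toFinset.card * Real.log lam - (volume D).toReal * lam := by
    funext lam
    rw [intensityLogLik, countMeasure_restrict hfin hD, integral_finsetSum_dirac,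
      Finset.sum_const, nsmul_eq_mul, setIntegral_const, smul_eq_mul, Measure.real]
  have hder := ((Real.hasDerivAt_log hθ).const_mul (hfin.toFinset.card : ℝ)).sub
    ((hasDerivAt_id θ.1).const_mul (volume D).toReal)
  rw [score, Fin.cons_zero, hloglik]
  refine hder.deriv.trans ?_
  rw [Finset.sum_const, card_tuples, Nat.descFactorial_one, nsmul_eq_mul, one_div, mul_one]

lemma score_succ {i : Fin q} (hK : IsRegularCurve (alphaCurve C i θ)) (hw : IsWeight r w)
    (hfin : (S ∩ D).Finite) (hD : MeasurableSet D) (hDb : Bornology.IsBounded D) :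
    score C w D S θ i.succ = ∑ x ∈ tuples l hfin.toFinset, scoreDensity (alphaCurve C i θ) w
      (modifiedKDeriv (alphaCurve C i θ) w D / modifiedK (alphaCurve C i θ 0) w D) x :=
  (hK.hasDerivAt_compositeLogLik hw hfin hD hDb).deriv

lemma limitScoreDensity_eq_scoreDensity (C : EuclideanSpace ℝ (Fin q) → Sp d → ℝ)
    (w : (Fin l → Sp d) → ℝ) (θ : Param q) (i : Fin q) :
    limitScoreDensity C w θ i = scoreDensity (alphaCurve C i θ) w
      ((∫ u : Fin (l - 1) → Sp d, intensityDeriv (alphaCurve C i θ) (anchored u) * w (anchored u)) /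
        ∫ u : Fin (l - 1) → Sp d,
          jointIntensity (alphaCurve C i θ 0) (anchored u) * w (anchored u)) := by
  funext x
  rw [scoreDensity, alphaCurve_zero]
  rfl

end Components

/-! ### The limit covariance of the score -/

section LimitVariance
variable {d q : ℕ} {C : EuclideanSpace ℝ (Fin q) → Sp d → ℝ} {θ : Param q}

lemma jointIntensity_one (hC : C θ.2 0 = 1) (x : Fin 1 → Sp d) :
    jointIntensity (stationaryKernel C θ) x = θ.1 := by
  rw [jointIntensity, Matrix.det_fin_one, kernelMatrix, Matrix.of_apply, stationaryKernel,
    sub_self, hC, mul_one]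

lemma jointIntensity_two_anchored (hK : IsContractionKernel (stationaryKernel C θ))
    (hC : C θ.2 0 = 1) (u : Fin 1 → Sp d) :
    jointIntensity (stationaryKernel C θ) (anchored u : Fin 2 → Sp d) =
      θ.1 ^ 2 - (θ.1 * C θ.2 (u 0)) ^ 2 := by
  have hdiag : ∀ y, stationaryKernel C θ y y = θ.1 := fun y => by
    rw [stationaryKernel, sub_self, hC, mul_one]
  have hoff : stationaryKernel C θ (u 0) 0 = θ.1 * C θ.2 (u 0) := by
    rw [stationaryKernel, sub_zero]
  have hanchored : (anchored u : Fin 2 → Sp d) = ![0, u 0] := by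
    funext i
    fin_cases i <;> rfl
  rw [hanchored, jointIntensity, Matrix.det_fin_two]
  simp only [kernelMatrix, Matrix.of_apply, Matrix.cons_val_zero, Matrix.cons_val_one, hdiag,
    hK.symm 0 (u 0), hoff]
  ring

lemma integral_overlapIntegrand_one_one_one (hlam : θ.1 ≠ 0) (hC : C θ.2 0 = 1)
    (ab : (Fin 1 ↪ Fin 1) × (Fin 1 ↪ Fin 1)) :
    ∫ u : Fin (1 - 1) → Sp d, overlapIntegrand (stationaryKernel C θ)
      (fun _ : Fin 1 → Sp d => 1 / θ.1) (fun _ : Fin 1 → Sp d => 1 / θ.1) ab u = 1 / θ.1 := by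
  have hintegrand : ∀ u : Fin (1 - 1) → Sp d, overlapIntegrand (stationaryKernel C θ)
      (fun _ : Fin 1 → Sp d => 1 / θ.1) (fun _ : Fin 1 → Sp d => 1 / θ.1) ab u = 1 / θ.1 :=
    fun u => by
      rw [overlapIntegrand, jointIntensity_one hC, if_neg (by norm_num)]
      field_simp
      ring
  simp only [hintegrand, integral_const, smul_eq_mul]
  have hvol : (volume : Measure (Fin (1 - 1) → Sp d)).real Set.univ = 1 := by
    rw [Measure.real, volume_pi, Measure.pi_univ]
    rfl
  rw [hvol, one_mul]

lemma integral_overlapIntegrand_one_one_two (hK : IsContractionKernel (stationaryKernel C θ))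
    (hlam : θ.1 ≠ 0) (hC : C θ.2 0 = 1) (ab : (Fin 1 ↪ Fin 2) × (Fin 1 ↪ Fin 2)) :
    ∫ u : Fin (2 - 1) → Sp d, overlapIntegrand (stationaryKernel C θ)
      (fun _ : Fin 1 → Sp d => 1 / θ.1) (fun _ : Fin 1 → Sp d => 1 / θ.1) ab u =
      -∫ u, C θ.2 u ^ 2 := by
  have hintegrand : ∀ u : Fin (2 - 1) → Sp d, overlapIntegrand (stationaryKernel C θ)
      (fun _ : Fin 1 → Sp d => 1 / θ.1) (fun _ : Fin 1 → Sp d => 1 / θ.1) ab u =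
      -(C θ.2 (u 0) ^ 2) := fun u => by
    rw [overlapIntegrand, if_pos rfl, jointIntensity_one hC, jointIntensity_one hC,
      jointIntensity_two_anchored hK hC u]
    field_simp
    ring
  simp only [hintegrand, integral_neg]
  exact congrArg _ ((volume_preserving_funUnique (Fin 1) (Sp d)).integral_comp
    (MeasurableEquiv.measurableEmbedding _) fun u => C θ.2 u ^ 2)

open Classical in
lemma card_overlaps_one_one_one :
    (Finset.univ.filter fun ab => ab ∈ overlaps 1 1 1).card = 1 := by
  have hall : ∀ ab : (Fin 1 ↪ Fin 1) × (Fin 1 ↪ Fin 1), ab ∈ overlaps 1 1 1 := fun _ _ =>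
    Or.inl ⟨0, Subsingleton.elim _ _⟩
  rw [Finset.filter_true_of_mem fun ab _ => hall ab, Finset.card_univ, Fintype.card_prod,
    Fintype.card_embedding_eq, Fintype.card_fin, Nat.descFactorial_self, Nat.factorial_one]

lemma limitCov_const (hK : IsContractionKernel (stationaryKernel C θ)) (hlam : θ.1 ≠ 0)
    (hC : C θ.2 0 = 1) :
    limitCov (stationaryKernel C θ) (fun _ : Fin 1 → Sp d => 1 / θ.1)
      (fun _ : Fin 1 → Sp d => 1 / θ.1) = 1 / θ.1 - ∫ u, C θ.2 u ^ 2 := by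
  classical
  have hcard : (Finset.univ.filter fun ab => ab ∈ overlaps 1 1 2).card = 2 := card_overlaps_add 1 1
  have hIcc : Finset.Icc (max 1 1) (1 + 1) = {1, 2} := rfl
  rw [limitCov, hIcc, Finset.sum_pair (by norm_num)]
  simp only [integral_overlapIntegrand_one_one_one hlam hC,
    integral_overlapIntegrand_one_one_two hK hlam hC, Finset.sum_const,
    card_overlaps_one_one_one, hcard, nsmul_eq_mul, Nat.factorial_one, Nat.factorial_two]
  push_cast
  ring

end LimitVariance

section NormalizedScore
variable {d q l : ℕ} {C : EuclideanSpace ℝ (Fin q) → Sp d → ℝ} {θ : Param q} {r : ℝ}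
  {w : (Fin l → Sp d) → ℝ} {D : ℕ → Set (Sp d)} {Ω : Type*} [MeasurableSpace Ω]
  {X : Ω → Set (Sp d)}

lemma isNormalizedStatSum_normalizedScore_zero (hX : IsPointProcess X)
    (hK : IsContractionKernel (stationaryKernel C θ)) (hθ : θ.1 ≠ 0) (hr : 0 ≤ r)
    (hDm : ∀ n, MeasurableSet (D n)) (hDb : ∀ n, Bornology.IsBounded (D n)) :
    IsNormalizedStatSum hX (stationaryKernel C θ) r hDb (fun _ : Fin 1 → Sp d => 1 / θ.1)
      fun n ω => normalizedScore C w (D n) (X ω) θ 0 := by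
  refine ⟨_, isLocalStat_const hK hr 0, fun _ => 0, fun n => (volume (D n)).toReal,
    tendsto_const_nhds, fun n => funext fun ω => ?_⟩
  beta_reduce
  rw [normalizedScore, score_zero (hX.finite_inter ω _ (hDb n)) (hDm n) hθ, zero_mul, sub_zero]
  rfl

lemma IsRegularAt.isLocalStat_limitScoreDensity (hC : IsRegularAt C θ) (hw : IsWeight r w)
    (i : Fin q) : IsLocalStat (stationaryKernel C θ) r (limitScoreDensity C w θ i) := by
  rw [limitScoreDensity_eq_scoreDensity, ← alphaCurve_zero C i θ]
  exact (hC.isRegularCurve i).isLocalStat_scoreDensity hw _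

lemma IsRegularAt.isNormalizedStatSum_normalizedScore_succ (hC : IsRegularAt C θ)
    (hX : IsPointProcess X) (hl : 1 ≤ l) (hw : IsWeight r w)
    (hD : IsAddFoelner (Sp d) volume atTop D) (hDm : ∀ n, MeasurableSet (D n))
    (hDb : ∀ n, Bornology.IsBounded (D n)) (i : Fin q) :
    IsNormalizedStatSum hX (stationaryKernel C θ) r hDb (limitScoreDensity C w θ i)
      fun n ω => normalizedScore C w (D n) (X ω) θ i.succ := by
  have hcurve := hC.isRegularCurve i
  have hκ := (hcurve.tendsto_modifiedKDeriv_div hl hw hD hDm hDb).sub_const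
    ((∫ u : Fin (l - 1) → Sp d, intensityDeriv (alphaCurve C i θ) (anchored u) * w (anchored u)) /
      ∫ u : Fin (l - 1) → Sp d, jointIntensity (alphaCurve C i θ 0) (anchored u) * w (anchored u))
  rw [sub_self] at hκ
  refine ⟨w, hw.isLocalStat hC.isContractionKernel, _, fun _ => 0, hκ,
    fun n => funext fun ω => ?_⟩
  beta_reduce
  rw [normalizedScore, score_succ hcurve hw (hX.finite_inter ω _ (hDb n)) (hDm n) (hDb n),
    limitScoreDensity_eq_scoreDensity, sub_zero]
  exact congrArg _ (sum_scoreDensity _ _ _)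

end NormalizedScore

end DPPScore

end

open DPPScore in
theorem mainTheorem5_general {d q p : ℕ} (hp : 1 ≤ p)
    {C : EuclideanSpace ℝ (Fin q) → Sp d → ℝ} {θ : Param q} (hC : IsRegularAt C θ)
    {r : ℝ} (hr : 0 ≤ r) {w : (Fin p → Sp d) → ℝ} (hw : IsWeight r w)
    {D : ℕ → Set (Sp d)} (hD : IsAddFoelner (Sp d) volume atTop D)
    (hDm : ∀ n, MeasurableSet (D n)) (hDb : ∀ n, Bornology.IsBounded (D n))
    {Ω : Type*} [MeasurableSpace Ω] {P : Measure Ω} [IsProbabilityMeasure P]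
    {X : Ω → Set (Sp d)} (hX : IsDPP P X (stationaryKernel C θ)) :
    (∀ n i, MemLp (fun ω => normalizedScore C w (D n) (X ω) θ i) 2 P) ∧
    ∃ Sig : Matrix (Fin (q + 1)) (Fin (q + 1)) ℝ,
      Tendsto (fun n : ℕ => Matrix.of fun i j : Fin (q + 1) =>
          cov[fun ω => normalizedScore C w (D n) (X ω) θ i,
            fun ω => normalizedScore C w (D n) (X ω) θ j; P]) atTop (𝓝 Sig) ∧
      Sig 0 0 = 1 / θ.1 - ∫ u, C θ.2 u ^ 2 ∧
      (∀ i : Fin q,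
        HasLimitCov (stationaryKernel C θ) (fun _ : Fin 1 → Sp d => 1 / θ.1)
          (limitScoreDensity C w θ i) (Sig 0 i.succ) ∧
        Sig i.succ 0 = Sig 0 i.succ) ∧
      ∀ i j : Fin q,
        HasLimitCov (stationaryKernel C θ) (limitScoreDensity C w θ i)
          (limitScoreDensity C w θ j) (Sig i.succ j.succ) := by
  have hK := hC.isContractionKernel
  have hconst := isLocalStat_const hK hr (1 / θ.1)
  have hf := hC.isLocalStat_limitScoreDensity hw
  have hscore₀ := isNormalizedStatSum_normalizedScore_zero (w := w) hX.isPointProcess hK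
    hC.lam_pos.ne' hr hDm hDb
  have hscore := hC.isNormalizedStatSum_normalizedScore_succ hX.isPointProcess hp hw hD hDm hDb
  have h₀₁ := fun i => hscore₀.tendsto_cov hX le_rfl hp hK hconst (hf i) hD hDm (hscore i)
  refine ⟨fun n => Fin.cases (hscore₀.memLp hX le_rfl hK hconst hDm n)
      fun i => (hscore i).memLp hX hp hK (hf i) hDm n,
    Matrix.of (Fin.cons
      (Fin.cons (1 / θ.1 - ∫ u, C θ.2 u ^ 2) fun j => limitCov (stationaryKernel C θ)
        (fun _ : Fin 1 → Sp d => 1 / θ.1) (limitScoreDensity C w θ j))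
      fun i => Fin.cons (limitCov (stationaryKernel C θ) (fun _ : Fin 1 → Sp d => 1 / θ.1)
          (limitScoreDensity C w θ i))
        fun j => limitCov (stationaryKernel C θ) (limitScoreDensity C w θ i)
          (limitScoreDensity C w θ j)),
    tendsto_pi_nhds.2 fun i => tendsto_pi_nhds.2 fun j => ?_, rfl,
    fun i => ⟨hasLimitCov_limitCov le_rfl hp hK hconst (hf i), rfl⟩,
    fun i j => hasLimitCov_limitCov hp hp hK (hf i) (hf j)⟩
  cases i using Fin.cases with
  | zero =>
    cases j using Fin.cases with
    | zero =>
      exact limitCov_const hK hC.lam_pos.ne' hC.normalized ▸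
        hscore₀.tendsto_cov hX le_rfl le_rfl hK hconst hconst hD hDm hscore₀
    | succ j => exact h₀₁ j
  | succ i =>
    cases j using Fin.cases with
    | zero => exact (h₀₁ i).congr fun n => covariance_comm _ _
    | succ j => exact (hscore i).tendsto_cov hX hp hp hK (hf i) (hf j) hD hDm (hscore j)

theorem mainTheorem5 {d q p : ℕ} (hd : 1 ≤ d) (hp : 2 ≤ p)
    (C : EuclideanSpace ℝ (Fin q) → DPPScore.Sp d → ℝ)
    (Θl : Set ℝ) (Θa : Set (EuclideanSpace ℝ (Fin q)))
    (hexist : DPPScore.ExistenceAssumption C Θl Θa)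
    (hreg : DPPScore.RegularityAssumption C Θl Θa)
    (θ₀ : DPPScore.Param q) (hθ₀ : θ₀ ∈ interior (Θl ×ˢ Θa))
    {r : ℝ} (hr : 0 < r) (w : (Fin p → DPPScore.Sp d) → ℝ) (hw : DPPScore.IsWeight r w)
    (D : ℕ → Set (DPPScore.Sp d)) (hD : DPPScore.IsWindowSequence D)
    {Ω : Type*} [MeasurableSpace Ω] (P : Measure Ω) [IsProbabilityMeasure P]
    (X : Ω → Set (DPPScore.Sp d))
    (hX : DPPScore.IsDPP P X (DPPScore.stationaryKernel C θ₀)) :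
    (∀ n i, MemLp (fun ω => DPPScore.normalizedScore C w (D n) (X ω) θ₀ i) 2 P) ∧
    ∃ Sig : Matrix (Fin (q + 1)) (Fin (q + 1)) ℝ,
      Tendsto
        (fun n : ℕ => Matrix.of fun i j : Fin (q + 1) =>
          cov[fun ω => DPPScore.normalizedScore C w (D n) (X ω) θ₀ i,
            fun ω => DPPScore.normalizedScore C w (D n) (X ω) θ₀ j; P])
        atTop (𝓝 Sig) ∧
      Sig 0 0 = 1 / θ₀.1 - ∫ u, C θ₀.2 u ^ 2 ∧
      (∀ i : Fin q,
        DPPScore.HasLimitCov (DPPScore.stationaryKernel C θ₀)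
          (fun _ : Fin 1 → DPPScore.Sp d => 1 / θ₀.1)
          (DPPScore.limitScoreDensity C w θ₀ i) (Sig 0 i.succ) ∧
        Sig i.succ 0 = Sig 0 i.succ) ∧
      ∀ i j : Fin q,
        DPPScore.HasLimitCov (DPPScore.stationaryKernel C θ₀)
          (DPPScore.limitScoreDensity C w θ₀ i) (DPPScore.limitScoreDensity C w θ₀ j)
          (Sig i.succ j.succ) := by
  exact mainTheorem5_general (one_le_two.trans hp) (hreg.isRegularAt hexist hθ₀) hr.le hw
    (hD.isAddFoelner hd) hD.measurableSet hD.isBounded hX
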